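/- Fix $\alpha\in(0,\tfrac13)$. Let $p_1=(0,0)$, $p_2=(\tfrac12,\tfrac{\sqrt3}2)$, $p_3=(1,0)$, $p_4=\tfrac{p_2+p_3}2$, $p_5=\tfrac{p_1+p_3}2$, $p_6=\tfrac{p_1+p_2}2$, let $T$ be the triangle with vertices $p_1,p_2,p_3$, and put $$A_1=A_2=A_3=\tfrac{1-\alpha}{2}I,\quad A_4=\tfrac{\alpha}{4}\begin{pmatrix}1&-\sqrt3\\-\sqrt3&3\end{pmatrix},\quad A_5=\alpha\begin{pmatrix}1&0\\0&0\end{pmatrix},\quad A_6=\tfrac{\alpha}{4}\begin{pmatrix}1&\sqrt3\\\sqrt3&3\end{pmatrix}$$ and $F_j(x)=A_j(x-p_j)+p_j$. The stretched Sierpinski gasket $K_\alpha\subset\mathbb R^2$ is the unique nonempty compact set with $K_\alpha=\bigcup_{j=1}^6F_j(K_\alpha)$. For a word $v=v_1\cdots v_n$ in the letters $1,2,3$ (possibly empty) let $F_v$ be the composition of the corresponding maps. Let $\mathscr E$ be the countable set of all segments that are either a side of a triangle $F_v(T)$ or one of the joining edges $F_v(F_j(T))$, $j\in\{4,5,6\}$,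 with $v$ ranging over all words. For $\epsilon\in\mathscr E$ with endpoints $\epsilon^-,\epsilon^+$ and length $\ell_\epsilon$, let $R_\epsilon:[0,\ell_\epsilon]\to K_\alpha$, $R_\epsilon(t)=\ell_\epsilon^{-1}(t\epsilon^++(\ell_\epsilon-t)\epsilon^-)$. Let $S(K_\alpha)=(C(K_\alpha),\mathcal H_\alpha,D_\alpha)$, with representation $\pi_\alpha$, be the direct sum over $\epsilon\in\mathscr E$ of the curve triples of the $R_\epsilon$. For $\ell=\ell_\epsilon$, the curve triple consists of the Hilbert space $L^2([-\ell,\ell],(2\ell)^{-1}dx)$ (functions regarded as $2\ell$-periodic), the representation $(\pi(f)h)(x)=f(R_\epsilon(|x|))h(x)$ of $C(K_\alpha)$ (complex-valued continuous functions), and the self-adjoint operator $-i\frac{d}{dx}+\frac{\pi}{2\ell}$ with periodic boundary conditions, that is, the operator with eigenvectors $e^{i\pi kx/\ell}$ and eigenvalues $\frac{(2k+1)\pi}{2\ell}$, $k\in\mathbb Z$. Let $$d_s=\inf\{p>0:\operatorname{tr}((I+D_\alpha^2)^{-p/2})<\infty\}$$ be the spectral dimension of $S(K_\alpha)$. For a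 compact operator $A$ on a Hilbert space let $\mu_1(A)\ge\mu_2(A)\ge\cdots\ge0$ be the eigenvalues of $|A|$ with multiplicity, and let $\mathcal L^{(1,\infty)}$ be the set of compact $A$ with $\sup_{N\ge1}\frac1{\log(1+N)}\sum_{n=1}^N\mu_n(A)<\infty$. Let $w$ be a dilation invariant extended limit, i.e. a positive linear functional on $\ell^\infty$ with $w(1,1,\dots)=1$ that vanishes on $c_0$ and satisfies $w(x_1,x_1,x_2,x_2,\dots)=w(x_1,x_2,\dots)$. The Dixmier trace is $\mathrm{Tr}_w(A)=w\big(\frac1{\log(1+N)}\sum_{n=1}^N\mu_n(A)\big)_{N\ge1}$ for $0\le A\in\mathcal L^{(1,\infty)}$, extended to $\mathcal L^{(1,\infty)}$ by linearity (decomposing $A$ into the positive and negative parts of its real and imaginary parts). **Theorem.** The $d_s$-dimensional Hausdorff measure of $K_\alpha$ is positive and finite. Let $\mathcal H^{d_s}$ denote this measure normalized to total mass $1$. Then for every $f\in C(K_\alpha)$ and every dilation invariant extended limit $w$, the operator $\pi_\alpha(f)|D_\alpha|^{-d_s}$ belongs to $\mathcal L^{(1,\infty)}$ and $$\mathrm{Tr}_w\big(\pi_\alpha(f)|D_\alpha|^{-d_s}\big)=c_{d_s}\int_{K_\alpha}f\,d\mathcal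 H^{d_s},\qquad c_{d_s}=\frac{2^{d_s+1}(2^{d_s}-1)\,\zeta(d_s)\,(3+3\alpha^{d_s})}{d_s\,\pi^{d_s}\big(2^{d_s}\log 2-3(1-\alpha)^{d_s}\log(1-\alpha)\big)},$$ where $\zeta$ is the Riemann zeta function. In particular the value does not depend on $w$. -/

import Mathlib

open MeasureTheory Filter Topology

noncomputable section

namespace StretchedGasket

/-! ### Operators on Hilbert spaces -/

section Operators

variable {H : Type*} [NormedAddCommGroup H] [InnerProductSpace ℂ H]

/-- The space of all `h` with `∑ |c i ⟨b i, h⟩|² < ∞`. -/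
def diagonalDomain {ι : Type*} (b : HilbertBasis ι ℂ H) (c : ι → ℝ) : Submodule ℂ H where
  carrier := {h | Memℓp (fun i => (c i : ℂ) * b.repr h i) 2}
  add_mem' := fun {x y} hx hy => by
    have h := Memℓp.add hx hy
    refine (congrArg (fun g => Memℓp g 2) ?_).mp h
    funext i
    simp [mul_add]
  zero_mem' := by
    refine (congrArg (fun g => Memℓp g 2) ?_).mp (zero_memℓp : Memℓp (0 : ∀ _ : ι, ℂ) 2)
    funext i
    simp
  smul_mem' := fun a x hx => by
    have h := Memℓp.const_smul hx a
    refine (congrArg (fun g => Memℓp g 2) ?_).mp h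
    funext i
    simp [mul_left_comm]

/-- The self-adjoint operator that is diagonal in the orthonormal basis `b` with real eigenvalues
`c`, on its maximal domain: `D h = ∑ c i ⟨b i, h⟩ b i`. -/
def diagonalOp {ι : Type*} (b : HilbertBasis ι ℂ H) (c : ι → ℝ) : H →ₗ.[ℂ] H where
  domain := diagonalDomain b c
  toFun :=
    { toFun := fun h => b.repr.symm ⟨fun i => (c i : ℂ) * b.repr (h : H) i, h.2⟩
      map_add' := fun x y => by
        rw [← map_add]
        congr 1
        ext i
        change (c i : ℂ) * b.repr ((x : H) + (y : H)) i =
          (c i : ℂ) * b.repr (x : H) i + (c i : ℂ) * b.repr (y : H) i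
        rw [map_add, lp.coeFn_add, Pi.add_apply, mul_add]
      map_smul' := fun a x => by
        rw [RingHom.id_apply, ← map_smul]
        congr 1
        ext i
        change (c i : ℂ) * b.repr (a • (x : H)) i = a * ((c i : ℂ) * b.repr (x : H) i)
        rw [map_smul, lp.coeFn_smul, Pi.smul_apply, smul_eq_mul, mul_left_comm] }

/-- `A` acts as `g(D)` on the eigenvectors of `D`. -/
def IsFunctionOf (D : H →ₗ.[ℂ] H) (g : ℝ → ℝ) (A : H →L[ℂ] H) : Prop :=
  ∀ (x : D.domain) (c : ℝ), D x = (c : ℂ) • (x : H) → A x = (g c : ℂ) • (x : H)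

open Classical in
/-- The functional calculus `g(D)` of a self-adjoint operator `D` that has an orthonormal basis of
eigenvectors: the unique bounded operator with `g(D) x = g(c) x` whenever `D x = c x`. (Default
value `0` if there is no such operator or more than one, which does not happen when the eigenvectors
of `D` are total and `g` is bounded on the eigenvalues.) -/
def functionOf (D : H →ₗ.[ℂ] H) (g : ℝ → ℝ) : H →L[ℂ] H :=
  if h : ∃! A : H →L[ℂ] H, IsFunctionOf D g A then h.choose else 0

/-- `|D|^{-s}`. -/
def absNegPow (D : H →ₗ.[ℂ] H) (s : ℝ) : H →L[ℂ] H :=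
  functionOf D fun c => |c| ^ (-s)

/-- A positive bounded operator has finite trace. -/
def HasFiniteTrace (T : H →L[ℂ] H) : Prop :=
  ∃ (s : Set H) (b : HilbertBasis s ℂ H), Summable fun i => (inner ℂ (b i) (T (b i))).re

/-- The spectral dimension `inf {p > 0 : tr ((I + D²)^{-p/2}) < ∞}`. -/
def spectralDimension (D : H →ₗ.[ℂ] H) : ℝ :=
  sInf {p : ℝ | 0 < p ∧ HasFiniteTrace (functionOf D fun c => (1 + c ^ 2) ^ (-p / 2))}

variable [CompleteSpace H]

/-- The eigenvalues of `|T|`, with multiplicity and in decreasing order, numbered from `0`: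
`μ n` is the least `t ≥ 0` such that at most `n` eigenvalues of `|T|` exceed `t`. -/
def singularValue (T : H →L[ℂ] H) (n : ℕ) : ℝ :=
  sInf {t : ℝ | 0 ≤ t ∧
    Module.rank ℂ
      (⨆ s : Set.Ioi t,
        Module.End.eigenspace ((CFC.abs T : H →L[ℂ] H) : H →ₗ[ℂ] H) ((s : ℝ) : ℂ) :
          Submodule ℂ H) ≤ (n : Cardinal)}

/-- The sequence `N ↦ (μ_1 + ⋯ + μ_N) / log (1 + N)`, `N ≥ 1`; the entry with index `n` is the one
for `N = n + 1`. -/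
def dixmierSeq (T : H →L[ℂ] H) (n : ℕ) : ℝ :=
  (∑ j ∈ Finset.range (n + 1), singularValue T j) / Real.log (1 + ((n + 1 : ℕ) : ℝ))

/-- The Dixmier ideal `L^{(1,∞)}`. -/
def InDixmierIdeal (T : H →L[ℂ] H) : Prop :=
  IsCompactOperator T ∧ BddAbove (Set.range (dixmierSeq T))

end Operators

open scoped ComplexOrder in
/-- A dilation invariant extended limit: a state of `ℓ^∞` that vanishes on `c₀` and satisfies
`w (x₁, x₁, x₂, x₂, …) = w (x₁, x₂, …)`. -/
structure ExtendedLimit where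
  toLinearMap : lp (fun _ : ℕ => ℂ) ⊤ →ₗ[ℂ] ℂ
  nonneg : ∀ x : lp (fun _ : ℕ => ℂ) ⊤, (∀ n, 0 ≤ x n) → 0 ≤ toLinearMap x
  map_one : toLinearMap 1 = 1
  map_null : ∀ x : lp (fun _ : ℕ => ℂ) ⊤, Tendsto (fun n => x n) atTop (𝓝 0) → toLinearMap x = 0
  map_dilation : ∀ x y : lp (fun _ : ℕ => ℂ) ⊤, (∀ n, y n = x (n / 2)) →
    toLinearMap y = toLinearMap x

section Dixmier

variable {H : Type*} [NormedAddCommGroup H] [InnerProductSpace ℂ H] [CompleteSpace H]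

open Classical in
/-- The Dixmier trace of a positive operator of the Dixmier ideal. -/
def dixmierTracePos (w : ExtendedLimit) (T : H →L[ℂ] H) : ℂ :=
  if h : Memℓp (fun n => (dixmierSeq T n : ℂ)) ⊤ then w.toLinearMap ⟨_, h⟩ else 0

/-- The Dixmier trace of an operator of the Dixmier ideal, extended by linearity from the positive
operators through `T = (Re T)⁺ - (Re T)⁻ + i ((Im T)⁺ - (Im T)⁻)`. -/
def dixmierTrace (w : ExtendedLimit) (T : H →L[ℂ] H) : ℂ :=
  dixmierTracePos w ((realPart T : H →L[ℂ] H)⁺) - dixmierTracePos w ((realPart T : H →L[ℂ] H)⁻) +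
    Complex.I * (dixmierTracePos w ((imaginaryPart T : H →L[ℂ] H)⁺) -
      dixmierTracePos w ((imaginaryPart T : H →L[ℂ] H)⁻))

end Dixmier

/-! ### Hilbert direct sums -/

section DirectSum

variable {ι : Type*} {E : ι → Type*} [∀ i, NormedAddCommGroup (E i)]
  [∀ i, InnerProductSpace ℂ (E i)]

/-- The direct sum of (unbounded) operators `D i`, on the domain
`{x : x i ∈ Dom (D i) for all i and ∑ ‖D i (x i)‖² < ∞}`. -/
def directSumOp (D : ∀ i, E i →ₗ.[ℂ] E i) : lp E 2 →ₗ.[ℂ] lp E 2 where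
  domain :=
    { carrier := {x | ∃ h : ∀ i, x i ∈ (D i).domain, Memℓp (fun i => D i ⟨x i, h i⟩) 2}
      add_mem' := fun {x y} hx hy => by
        obtain ⟨hx, hx'⟩ := hx
        obtain ⟨hy, hy'⟩ := hy
        refine ⟨fun i => (D i).domain.add_mem (hx i) (hy i), ?_⟩
        refine (congrArg (fun g => Memℓp g 2) ?_).mp (Memℓp.add hx' hy')
        funext i
        exact ((D i).map_add ⟨x i, hx i⟩ ⟨y i, hy i⟩).symm
      zero_mem' := by
        refine ⟨fun i => (D i).domain.zero_mem, ?_⟩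
        refine (congrArg (fun g => Memℓp g 2) ?_).mp (zero_memℓp : Memℓp (0 : ∀ i, E i) 2)
        funext i
        exact ((D i).map_zero).symm
      smul_mem' := fun a x hx => by
        obtain ⟨hx, hx'⟩ := hx
        refine ⟨fun i => (D i).domain.smul_mem a (hx i), ?_⟩
        refine (congrArg (fun g => Memℓp g 2) ?_).mp (Memℓp.const_smul hx' a)
        funext i
        exact ((D i).map_smul a ⟨x i, hx i⟩).symm }
  toFun :=
    { toFun := fun x => ⟨fun i => D i ⟨(x : lp E 2) i, x.2.choose i⟩, x.2.choose_spec⟩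
      map_add' := fun x y => by
        ext i
        exact (D i).map_add ⟨(x : lp E 2) i, x.2.choose i⟩ ⟨(y : lp E 2) i, y.2.choose i⟩
      map_smul' := fun a x => by
        ext i
        exact (D i).map_smul a ⟨(x : lp E 2) i, x.2.choose i⟩ }

theorem memℓp_directSum {T : ∀ i, E i →L[ℂ] E i} {C : ℝ} (hT : ∀ i, ‖T i‖ ≤ C) (x : lp E 2) :
    Memℓp (fun i => T i (x i)) 2 := by
  have h1 : Memℓp (fun i => C * ‖x i‖) 2 := (lp.memℓp x).norm.const_mul C
  exact h1.mono fun i => ((T i).le_opNorm _).trans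
    (mul_le_mul_of_nonneg_right (hT i) (norm_nonneg _))

/-- The direct sum of a uniformly bounded family of bounded operators. -/
def directSumCLM (T : ∀ i, E i →L[ℂ] E i) (C : ℝ) (hT : ∀ i, ‖T i‖ ≤ C) :
    lp E 2 →L[ℂ] lp E 2 :=
  LinearMap.mkContinuous
    { toFun := fun x => ⟨fun i => T i (x i), memℓp_directSum hT x⟩
      map_add' := fun x y => by
        ext i
        exact (T i).map_add _ _
      map_smul' := fun a x => by
        ext i
        exact (T i).map_smul _ _ }
    |C| (fun x => by
      refine lp.norm_le_of_tsum_le (by norm_num) (by positivity) ?_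
      rw [Real.mul_rpow (abs_nonneg _) (norm_nonneg _), lp.norm_rpow_eq_tsum (by norm_num) x,
        ← tsum_mul_left]
      refine Summable.tsum_le_tsum (fun i => ?_) ?_ ?_
      · rw [← Real.mul_rpow (abs_nonneg _) (norm_nonneg _)]
        refine Real.rpow_le_rpow (norm_nonneg _) ?_ (by norm_num)
        exact ((T i).le_opNorm _).trans
          (mul_le_mul_of_nonneg_right ((hT i).trans (le_abs_self C)) (norm_nonneg _))
      · exact (memℓp_directSum hT x).summable (by norm_num)
      · exact ((lp.memℓp x).summable (by norm_num)).mul_left _)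

end DirectSum

/-! ### The spectral triple of a curve -/

section Curve

variable (l : ℝ) [hl : Fact (0 < l)]

instance fact_two_mul : Fact (0 < 2 * l) := ⟨mul_pos two_pos hl.out⟩

/-- `L²([-l, l])` with normalized Lebesgue measure, its elements being considered as `2l`-periodic
functions. -/
abbrev CurveSpace : Type := Lp ℂ 2 (AddCircle.haarAddCircle : Measure (AddCircle (2 * l)))

/-- `D_l = -i d/dx + π/(2l)` with periodic boundary conditions: the basis vector `exp (iπkx/l)` has
the eigenvalue `(2k+1)π/(2l)`. -/
def curveDirac : CurveSpace l →ₗ.[ℂ] CurveSpace l :=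
  diagonalOp fourierBasis fun k : ℤ => (2 * k + 1) * Real.pi / (2 * l)

variable {X : Type*} [TopologicalSpace X] (R : C(Set.Icc (0 : ℝ) l, X))

/-- The function `x ↦ f (R |x|)` on `[-l, l]`, considered as a `2l`-periodic function: the norm on
`AddCircle (2 * l)` of the class of `x ∈ [-l, l]` is `|x|`. -/
def curvePullback (f : C(X, ℂ)) : C(AddCircle (2 * l), ℂ) where
  toFun x := f (R ⟨‖x‖, norm_nonneg x, by
    have h := AddCircle.norm_le_half_period (2 * l) (x := x) (fact_two_mul l).out.ne'
    rwa [abs_of_pos (fact_two_mul l).out, mul_div_cancel_left₀ l two_ne_zero] at h⟩)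
  continuous_toFun := by fun_prop

/-- The representation `π_l(f) h (x) = f (R |x|) h (x)`. -/
def curveRep (f : C(X, ℂ)) : CurveSpace l →L[ℂ] CurveSpace l :=
  (ContinuousLinearMap.mul ℂ ℂ).holderL AddCircle.haarAddCircle ⊤ 2 2
    (ContinuousMap.toLp ⊤ AddCircle.haarAddCircle ℂ (curvePullback l R f))

theorem norm_curveRep_le [CompactSpace X] (f : C(X, ℂ)) : ‖curveRep l R f‖ ≤ ‖f‖ := by
  have h1 : ‖ContinuousMap.toLp ⊤ (AddCircle.haarAddCircle : Measure (AddCircle (2 * l))) ℂ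
      (curvePullback l R f)‖ ≤ ‖f‖ := by
    refine Lp.norm_le_of_ae_bound (norm_nonneg f) ?_ |>.trans ?_
    · filter_upwards [ContinuousMap.coeFn_toLp (p := ⊤)
        (AddCircle.haarAddCircle : Measure (AddCircle (2 * l))) (𝕜 := ℂ)
        (curvePullback l R f)] with x hx
      rw [hx]
      exact f.norm_coe_le_norm _
    · simp
  refine (ContinuousLinearMap.le_opNorm _ _).trans ?_
  refine (mul_le_mul (ContinuousLinearMap.norm_holderL_le _) h1 (norm_nonneg _)
    (norm_nonneg _)).trans ?_
  simp

end Curve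

/-! ### The stretched Sierpinski gasket -/

abbrev Plane : Type := EuclideanSpace ℝ (Fin 2)

/-- The points `p_1, …, p_6`. -/
def pt : Fin 6 → Plane :=
  ![!₂[0, 0], !₂[1 / 2, √3 / 2], !₂[1, 0], !₂[3 / 4, √3 / 4], !₂[1 / 2, 0], !₂[1 / 4, √3 / 4]]

/-- The matrices `A_1, …, A_6`. -/
def mat (α : ℝ) : Fin 6 → Matrix (Fin 2) (Fin 2) ℝ :=
  ![((1 - α) / 2) • 1, ((1 - α) / 2) • 1, ((1 - α) / 2) • 1,
    (α / 4) • !![1, -√3; -√3, 3], α • !![1, 0; 0, 0], (α / 4) • !![1, √3; √3, 3]]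

/-- The affine contractions `F_j (x) = A_j (x - p_j) + p_j`, `j = 1, …, 6`. -/
def F (α : ℝ) (j : Fin 6) (x : Plane) : Plane :=
  (mat α j).toEuclideanLin (x - pt j) + pt j

/-- `K` is the stretched Sierpinski gasket: the (unique) nonempty compact set with
`K = F_1(K) ∪ ⋯ ∪ F_6(K)`. -/
def IsGasket (α : ℝ) (K : TopologicalSpace.NonemptyCompacts Plane) : Prop :=
  (K : Set Plane) = ⋃ j, F α j '' K

/-- The vertices `p_1, p_2, p_3`. -/
def vtx (i : Fin 3) : Plane := pt (Fin.castAdd 3 i)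

/-- `F_w`, for a word `w` in the letters `1, 2, 3`. -/
def wordMap (α : ℝ) : List (Fin 3) → Plane → Plane
  | [] => id
  | i :: w => F α (Fin.castAdd 3 i) ∘ wordMap α w

/-- The edges of all the graph approximations, each of them listed once. For a word `w` of length
`n`, `tri w i` are the three sides of the triangle `F_w(T)`, and `join w i` are the three edges
`F_w(F_4(T))`, `F_w(F_5(T))`, `F_w(F_6(T))` that join the triangles of level `n + 1` in it; the
index `i` denotes the side opposite to the vertex `i`, with the endpoints `i + 1`, `i + 2` mod 3. -/
inductive Edge
  | tri (w : List (Fin 3)) (i : Fin 3)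
  | join (w : List (Fin 3)) (i : Fin 3)

/-- The affine map that carries a side of `T` onto the edge. -/
def edgeMap (α : ℝ) : Edge → Plane → Plane
  | .tri w _, x => wordMap α w x
  | .join w i, x => wordMap α w (F α (Fin.natAdd 3 i) x)

/-- The side of `T` from which an edge comes. -/
def Edge.side : Edge → Fin 3
  | .tri _ i => i
  | .join _ i => i

/-- The initial point of an edge. -/
def edgeStart (α : ℝ) (e : Edge) : Plane := edgeMap α e (vtx (e.side + 1))

/-- The final point of an edge. -/
def edgeEnd (α : ℝ) (e : Edge) : Plane := edgeMap α e (vtx (e.side + 2))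

/-- The length of an edge. -/
def edgeLength (α : ℝ) (e : Edge) : ℝ := dist (edgeStart α e) (edgeEnd α e)

theorem F_affine (α : ℝ) (j : Fin 6) (x y : Plane) (t : ℝ) :
    F α j (x + t • (y - x)) = F α j x + t • (F α j y - F α j x) := by
  simp only [F, map_sub, map_add, map_smul]
  module

theorem wordMap_affine (α : ℝ) (w : List (Fin 3)) (x y : Plane) (t : ℝ) :
    wordMap α w (x + t • (y - x)) =
      wordMap α w x + t • (wordMap α w y - wordMap α w x) := by
  induction w with
  | nil => rfl
  | cons i w ih => simp only [wordMap, Function.comp_apply, ih, F_affine]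

theorem edgeMap_affine (α : ℝ) (e : Edge) (x y : Plane) (t : ℝ) :
    edgeMap α e (x + t • (y - x)) = edgeMap α e x + t • (edgeMap α e y - edgeMap α e x) := by
  cases e <;> simp only [edgeMap, F_affine, wordMap_affine]

theorem F_corner (α : ℝ) (i : Fin 3) (x : Plane) :
    F α (Fin.castAdd 3 i) x = vtx i + ((1 - α) / 2) • (x - vtx i) := by
  have h : mat α (Fin.castAdd 3 i) = ((1 - α) / 2) • 1 := by fin_cases i <;> rfl
  ext k
  fin_cases k <;> simp [F, h, vtx, Matrix.toEuclideanLin, add_comm]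

theorem F_side (α : ℝ) (i : Fin 3) (t : ℝ) :
    F α (Fin.natAdd 3 i) (vtx (i + 1) + t • (vtx (i + 2) - vtx (i + 1))) =
      vtx (i + 1) + ((1 - α) / 2 + α * t) • (vtx (i + 2) - vtx (i + 1)) := by
  have h3 : √3 * √3 = 3 := Real.mul_self_sqrt (by norm_num)
  ext k
  fin_cases i <;> fin_cases k <;>
    simp [F, mat, pt, vtx, Matrix.toEuclideanLin, Matrix.toLpLin_apply] <;> grind

theorem vtx_ne (i : Fin 3) : vtx (i + 1) ≠ vtx (i + 2) := by
  intro h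
  have h0 := congrArg (fun v : Plane => v 0) h
  fin_cases i <;> simp [vtx, pt] at h0

theorem wordMap_injective {α : ℝ} (hα : α < 1) (w : List (Fin 3)) :
    Function.Injective (wordMap α w) := by
  induction w with
  | nil => exact Function.injective_id
  | cons i w ih =>
    refine Function.Injective.comp (fun x y h => ?_) ih
    rw [F_corner, F_corner] at h
    have h' := smul_right_injective Plane (r := (1 - α) / 2) (by linarith) (add_left_cancel h)
    exact sub_left_injective h'

theorem edgeLength_pos (α : Set.Ioo (0 : ℝ) (1 / 3)) (e : Edge) : 0 < edgeLength α e := by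
  have h0 := α.2.1
  have h1 : (α : ℝ) < 1 := by linarith [α.2.2]
  refine dist_pos.2 ?_
  cases e with
  | tri w i => exact fun h => vtx_ne i (wordMap_injective h1 w h)
  | join w i =>
    intro h
    have h := wordMap_injective h1 w h
    have ha := F_side α i 0
    have hb := F_side α i 1
    simp only [zero_smul, add_zero, one_smul, add_sub_cancel, mul_zero, mul_one] at ha hb
    simp only [Edge.side] at h
    rw [ha, hb] at h
    have h := add_left_cancel h
    rw [← sub_eq_zero, ← sub_smul, smul_eq_zero] at h
    rcases h with h | h
    · linarith
    · exact vtx_ne i (sub_eq_zero.1 h).symm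

instance fact_edgeLength_pos (α : Set.Ioo (0 : ℝ) (1 / 3)) (e : Edge) :
    Fact (0 < edgeLength α e) := ⟨edgeLength_pos α e⟩

section Contained

variable {α : Set.Ioo (0 : ℝ) (1 / 3)} {K : TopologicalSpace.NonemptyCompacts Plane}

theorem IsGasket.map_mem (hK : IsGasket α K) (j : Fin 6) {x : Plane} (hx : x ∈ K) :
    F α j x ∈ K := by
  have h : F α j x ∈ (K : Set Plane) := by
    rw [hK]
    exact Set.mem_iUnion.2 ⟨j, x, hx, rfl⟩
  exact h

theorem IsGasket.vtx_mem (hK : IsGasket α K) (i : Fin 3) : vtx i ∈ K := by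
  obtain ⟨k, hk⟩ := K.nonempty
  have h0 := α.2.1
  have h1 := α.2.2
  have hmem : ∀ n : ℕ, vtx i + ((1 - (α : ℝ)) / 2) ^ n • (k - vtx i) ∈ (K : Set Plane) := by
    intro n
    induction n with
    | zero => simpa using hk
    | succ n ih =>
      have h := hK.map_mem (Fin.castAdd 3 i) ih
      rw [F_corner, add_sub_cancel_left, smul_smul, ← pow_succ'] at h
      exact h
  have hlim : Tendsto (fun n : ℕ => vtx i + ((1 - (α : ℝ)) / 2) ^ n • (k - vtx i)) atTop
      (𝓝 (vtx i + (0 : ℝ) • (k - vtx i))) :=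
    ((tendsto_pow_atTop_nhds_zero_of_lt_one (by linarith) (by linarith)).smul_const _).const_add _
  rw [zero_smul, add_zero] at hlim
  exact K.isCompact.isClosed.mem_of_tendsto hlim (Eventually.of_forall hmem)

theorem IsGasket.side_mem (hK : IsGasket α K) (i : Fin 3) {t : ℝ} (ht : t ∈ Set.Icc (0 : ℝ) 1) :
    vtx (i + 1) + t • (vtx (i + 2) - vtx (i + 1)) ∈ K := by
  have h0 := α.2.1
  have h1 := α.2.2
  set a := vtx (i + 1) with ha
  set b := vtx (i + 2) with hb
  have key : ∀ n : ℕ, ∀ t ∈ Set.Icc (0 : ℝ) 1, ∃ s : ℝ, a + s • (b - a) ∈ K ∧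
      |s - t| ≤ (1 / 2) ^ n := by
    intro n
    induction n with
    | zero =>
      intro t ht
      refine ⟨0, by simpa using hK.vtx_mem (i + 1), ?_⟩
      rw [zero_sub, abs_neg, abs_of_nonneg ht.1, pow_zero]
      exact ht.2
    | succ n ih =>
      intro t ht
      have step : ∀ c d u : ℝ, 0 < c → c ≤ 1 / 2 → u ∈ Set.Icc (0 : ℝ) 1 → t = d + c * u →
          (∀ s : ℝ, a + s • (b - a) ∈ K → a + (d + c * s) • (b - a) ∈ K) →
          ∃ s : ℝ, a + s • (b - a) ∈ K ∧ |s - t| ≤ (1 / 2) ^ (n + 1) := by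
        intro c d u hc hc' hu htu hK'
        obtain ⟨s, hs, hsu⟩ := ih u hu
        refine ⟨d + c * s, hK' s hs, ?_⟩
        have e1 : d + c * s - t = c * (s - u) := by rw [htu]; ring
        rw [e1, abs_mul, abs_of_pos hc, pow_succ']
        exact mul_le_mul hc' hsu (abs_nonneg _) (by norm_num)
      have hr : 0 < (1 - (α : ℝ)) / 2 := by linarith
      rcases le_total t ((1 - (α : ℝ)) / 2) with h | h
      · refine step ((1 - (α : ℝ)) / 2) 0 (t / ((1 - (α : ℝ)) / 2)) hr (by linarith)
          ⟨div_nonneg ht.1 hr.le, (div_le_one hr).2 h⟩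
          (by rw [mul_div_cancel₀ _ hr.ne', zero_add]) fun s hs => ?_
        have h := hK.map_mem (Fin.castAdd 3 (i + 1)) hs
        rw [F_corner, ← ha, add_sub_cancel_left, smul_smul] at h
        rwa [zero_add]
      rcases le_total t ((1 - (α : ℝ)) / 2 + α) with h' | h'
      · refine step α ((1 - (α : ℝ)) / 2) ((t - (1 - (α : ℝ)) / 2) / α) h0 (by linarith)
          ⟨div_nonneg (by linarith) h0.le, (div_le_one h0).2 (by linarith)⟩
          (by rw [mul_div_cancel₀ _ h0.ne']; ring) fun s hs => ?_
        have h := hK.map_mem (Fin.natAdd 3 i) hs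
        rwa [ha, hb, F_side] at h
      · refine step ((1 - (α : ℝ)) / 2) (1 - (1 - (α : ℝ)) / 2)
          ((t - (1 - (1 - (α : ℝ)) / 2)) / ((1 - (α : ℝ)) / 2)) hr (by linarith)
          ⟨div_nonneg (by linarith) hr.le, (div_le_one hr).2 (by linarith [ht.2])⟩
          (by rw [mul_div_cancel₀ _ hr.ne']; ring) fun s hs => ?_
        have h := hK.map_mem (Fin.castAdd 3 (i + 2)) hs
        rw [F_corner, ← hb] at h
        convert h using 1
        module
  choose s hs hst using fun n => key n t ht
  have hlim : Tendsto s atTop (𝓝 t) := by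
    rw [tendsto_iff_dist_tendsto_zero]
    exact squeeze_zero (fun _ => dist_nonneg) (fun n => by simpa [Real.dist_eq] using hst n)
      (tendsto_pow_atTop_nhds_zero_of_lt_one (r := (1 / 2 : ℝ)) (by norm_num) (by norm_num))
  exact K.isCompact.isClosed.mem_of_tendsto ((hlim.smul_const (b - a)).const_add a)
    (Eventually.of_forall hs)

theorem IsGasket.wordMap_mem (hK : IsGasket α K) (w : List (Fin 3)) {x : Plane} (hx : x ∈ K) :
    wordMap α w x ∈ K := by
  induction w with
  | nil => exact hx
  | cons i w ih => exact hK.map_mem _ ih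

theorem IsGasket.edgeMap_mem (hK : IsGasket α K) (e : Edge) {x : Plane} (hx : x ∈ K) :
    edgeMap α e x ∈ K := by
  cases e with
  | tri w i => exact hK.wordMap_mem w hx
  | join w i => exact hK.wordMap_mem w (hK.map_mem _ hx)

/-- The arc length parametrization `t ↦ (t ε⁺ + (L - t) ε⁻) / L` of the edge `ε = [ε⁻, ε⁺]` of
length `L`, as a curve in `K`. -/
def edgeCurve (hK : IsGasket α K) (e : Edge) : C(Set.Icc (0 : ℝ) (edgeLength α e), K) where
  toFun t := ⟨(1 / edgeLength α e) •
      ((t : ℝ) • edgeEnd α e + (edgeLength α e - t) • edgeStart α e), by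
    have hL := edgeLength_pos α e
    have h := hK.edgeMap_mem e (hK.side_mem e.side (t := t / edgeLength α e)
      ⟨div_nonneg t.2.1 hL.le, (div_le_one hL).2 t.2.2⟩)
    rw [edgeMap_affine] at h
    convert h using 1
    change _ = edgeStart α e + ((t : ℝ) / edgeLength α e) • (edgeEnd α e - edgeStart α e)
    match_scalars
    · field_simp
    · field_simp
      ring⟩
  continuous_toFun := by fun_prop

end Contained

/-! ### The spectral triple of the stretched Sierpinski gasket -/

/-- The Hilbert space `⨁ L²([-L(ε), L(ε)])`, the sum running over all edges `ε`. -/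
abbrev GasketSpace (α : Set.Ioo (0 : ℝ) (1 / 3)) : Type :=
  lp (fun e : Edge => CurveSpace (edgeLength α e)) 2

/-- The operator `D_α`. -/
def gasketDirac (α : Set.Ioo (0 : ℝ) (1 / 3)) : GasketSpace α →ₗ.[ℂ] GasketSpace α :=
  directSumOp fun e => curveDirac (edgeLength α e)

/-- The representation `π_α` of `C(K_α)`. -/
def gasketRep {α : Set.Ioo (0 : ℝ) (1 / 3)} {K : TopologicalSpace.NonemptyCompacts Plane}
    (hK : IsGasket α K) (f : C(K, ℂ)) : GasketSpace α →L[ℂ] GasketSpace α :=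
  directSumCLM (fun e => curveRep (edgeLength α e) (edgeCurve hK e) f) ‖f‖
    fun e => norm_curveRep_le (edgeLength α e) (edgeCurve hK e) f

/-- The `d`-dimensional Hausdorff measure of a metric space, normalized to total mass `1`. -/
def hausdorffProb (X : Type*) [MetricSpace X] [MeasurableSpace X] [BorelSpace X] (d : ℝ) :
    Measure X :=
  (μH[d] (Set.univ : Set X))⁻¹ • μH[d]

/-- The constant `c_d`. -/
def traceConst (α d : ℝ) : ℂ :=
  (2 ^ (d + 1) * (2 ^ d - 1) * (3 + 3 * α ^ d) /
    (d * Real.pi ^ d * (2 ^ d * Real.log 2 - 3 * (1 - α) ^ d * Real.log (1 - α))) : ℝ) *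
      riemannZeta d

end StretchedGasket

end

open StretchedGasket

noncomputable section

namespace StretchedGasket

/-! ### Decreasing rearrangements -/

section Rearrangement

variable {ι : Type*}

/-! The operator `D_α` is diagonal in the exponentials on the edges. The edges of a word of length
`n` have length `r ^ n` or `α r ^ n`, with `r = (1 - α) / 2`. Let `d` solve `3 r ^ d = 1`. Then
`|D_α|^{-d}` has the eigenvalues `3⁻ⁿ q_j`, one for each of the `3 ^ n` words of length `n`. Here
`j` runs over the kind and side of the edge and the Fourier mode, and `∑ q_j < ∞` because `d > 1`.
For a general exponent `p > 1` level `n` contributes a constant times `(3 r ^ p) ^ n` to the trace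
of `|D_α|^{-p}`, so `d` is the spectral dimension (`summable_one_add_sq_iff`).

The representation is almost diagonal in the same basis: over an edge it multiplies by the value of
`f` at the initial point, up to the oscillation of `f` along the edge, which vanishes as the edges
shrink (`norm_gasketRep_basis_sub_le`). By Ky Fan's principle the first `N` singular values of `(Re
T)⁺` sum to the maximum of `∑ Re ⟨u_i, T u_i⟩` over orthonormal families of at most `N` vectors. For
`T = π_α(f) |D_α|^{-d}`, cutting the eigenvalues `c_k` at a threshold `t` of order `1 / N` bounds
this maximum above, and testing with basis vectors bounds it below. Both bounds are `∑ (Re f)⁺ c_k`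
over `c_k > t`, with `f` taken at initial points, up to `o(log N)` (`tendsto_dixmierSeq_posPart`).

For fixed `j` the condition `c_k > t` admits all words of length below `log₃ (q_j / t)`. The sum is
therefore `q_j` times a sum of about `log (1 / t) / log 3` level averages. If these averages
converge, Cesàro's theorem and dominated convergence in `j` give logarithmic growth with factor `∑
q_j / log 3` (`tendsto_truncSum_wordFamily`). So the Dixmier sequences converge in the ordinary
sense, every extended limit takes the same value, and `traceConst_eq` identifies the factor.

The level averages converge to the integral against normalized Hausdorff measure, since the `3 ^ n`
cells of level `n` are disjoint, shrink uniformly and carry mass `3⁻ⁿ` each; the rest of the gasket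
lies on segments, which are null as `d > 1`. The measure is finite by covering with cells. It is
positive because sending a point with address `ω` to the number with ternary digits `ω` is
`d`-Hölder and onto `[0, 1]`. -/

/-- The decreasing rearrangement of a family of nonnegative reals. -/
def decRearr (c : ι → ℝ) (n : ℕ) : ℝ := sInf {t : ℝ | 0 ≤ t ∧ {k | t < c k}.encard ≤ n}

variable {c : ι → ℝ}

theorem decRearr_nonneg (c : ι → ℝ) (n : ℕ) : 0 ≤ decRearr c n :=
  Real.sInf_nonneg fun _ ht => ht.1

theorem decRearr_le {n : ℕ} {t : ℝ} (h0 : 0 ≤ t) (h : {k | t < c k}.encard ≤ n) :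
    decRearr c n ≤ t :=
  csInf_le ⟨0, fun _ ht => ht.1⟩ ⟨h0, h⟩

/-- Only finitely many values exceed `1`, so the family is bounded above. This keeps the infimum in
`decRearr` from being taken over the empty set. -/
theorem nonempty_decRearr_set (hfin : ∀ t : ℝ, 0 < t → {k | t < c k}.Finite) (n : ℕ) :
    {t : ℝ | 0 ≤ t ∧ {k | t < c k}.encard ≤ n}.Nonempty := by
  obtain ⟨B, hB⟩ := ((hfin 1 one_pos).image c).bddAbove
  refine ⟨max B 1, by positivity, ?_⟩
  have : {k | max B 1 < c k} = ∅ := by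
    ext k
    simp only [Set.mem_ofPred_eq, Set.mem_empty_iff_false, iff_false, not_lt]
    by_contra! h
    have h1 : c k ≤ B := hB ⟨k, lt_of_le_of_lt (le_max_right _ _) h, rfl⟩
    exact absurd (lt_of_le_of_lt (le_max_left _ _) h) (not_lt.2 h1)
  rw [this]
  simp

/-- The infimum is not known to be attained. The smallest value on the finite set `s` lies strictly
above it, which leaves room for an admissible `t` in between. -/
theorem card_le_of_forall_decRearr_lt (hfin : ∀ t : ℝ, 0 < t → {k | t < c k}.Finite) {n : ℕ}
    {s : Finset ι} (hs : ∀ k ∈ s, decRearr c n < c k) : s.card ≤ n := by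
  rcases s.eq_empty_or_nonempty with rfl | hne
  · simp
  obtain ⟨k, hk, hmin⟩ := s.exists_min_image c hne
  obtain ⟨t, ht, htk⟩ := exists_lt_of_csInf_lt (nonempty_decRearr_set hfin n) (hs k hk)
  have h : (s : Set ι).encard ≤ n :=
    (Set.encard_le_encard fun l hl => htk.trans_le (hmin l hl)).trans ht.2
  simpa [Set.encard_coe_eq_coe_finsetCard] using h

theorem decRearr_antitone (hfin : ∀ t : ℝ, 0 < t → {k | t < c k}.Finite) :
    Antitone (decRearr c) := fun m n hmn =>
  csInf_le_csInf ⟨0, fun _ ht => ht.1⟩ (nonempty_decRearr_set hfin m)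
    fun _ ht => ⟨ht.1, ht.2.trans (by exact_mod_cast hmn)⟩

/-- The first `N` terms of the decreasing rearrangement are the values on a finite set. -/
theorem exists_finset_sum_eq_sum_decRearr (hfin : ∀ t : ℝ, 0 < t → {k | t < c k}.Finite)
    (N : ℕ) :
    ∃ s : Finset ι, s.card ≤ N ∧ (∀ k ∈ s, 0 < c k) ∧
      ∑ k ∈ s, c k = ∑ j ∈ Finset.range N, decRearr c j ∧
      (∀ k ∉ s, c k ≤ decRearr c N) ∧ (∀ k ∈ s, decRearr c N ≤ c k) ∧
      (s.card < N → decRearr c N = 0) := by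
  classical
  induction N with
  | zero =>
    refine ⟨∅, by simp, by simp, by simp, fun k _ => ?_, by simp, by simp⟩
    by_contra! h
    have := card_le_of_forall_decRearr_lt hfin (n := 0) (s := {k}) (by simpa using h)
    simp at this
  | succ N ih =>
    obtain ⟨s, hcard, hpos, hsum, hout, hin, hlt⟩ := ih
    have hanti := decRearr_antitone hfin (Nat.le_succ N)
    -- Once the rearrangement has reached `0` the set no longer grows; this is the only way it can
    -- have fewer elements than terms.
    rcases (decRearr_nonneg c N).eq_or_lt with h0 | h0
    · have h1 : decRearr c (N + 1) = 0 := le_antisymm (h0 ▸ hanti) (decRearr_nonneg _ _)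
      refine ⟨s, by omega, hpos, ?_, fun k hk => ?_, fun k hk => ?_, fun _ => h1⟩
      · rw [Finset.sum_range_succ, ← hsum, ← h0, add_zero]
      · rw [h1, h0]; exact hout k hk
      · rw [h1]; exact (hpos k hk).le
    · have hN : s.card = N := by
        by_contra hne
        exact h0.ne' (hlt (by omega))
      -- The infimum is attained outside `s`. Otherwise the largest value left outside `s` is a
      -- level below `decRearr c N` whose superlevel set lies inside `s`, hence is admissible.
      -- Cutting at half the infimum makes that largest value exist.
      obtain ⟨k, hk, hkeq⟩ : ∃ k ∉ s, c k = decRearr c N := by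
        by_contra! hno
        have hF := (hfin (decRearr c N / 2) (by positivity)).subset
          (t := {k | decRearr c N / 2 < c k ∧ k ∉ s}) fun k hk => hk.1
        obtain ⟨t, ht0, htN, ht⟩ : ∃ t, 0 ≤ t ∧ t < decRearr c N ∧ ∀ k ∉ s, c k ≤ t := by
          rcases Set.eq_empty_or_nonempty {k | decRearr c N / 2 < c k ∧ k ∉ s} with he | hne
          · refine ⟨decRearr c N / 2, by positivity, by linarith, fun k hk => ?_⟩
            by_contra! h
            exact (Set.eq_empty_iff_forall_notMem.1 he k) ⟨h, hk⟩
          · obtain ⟨l, hl, hmax⟩ := Set.exists_max_image _ c hF hne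
            refine ⟨c l, by linarith [hl.1], lt_of_le_of_ne (hout l hl.2) (hno l hl.2),
              fun k hk => ?_⟩
            by_cases h : decRearr c N / 2 < c k
            · exact hmax k ⟨h, hk⟩
            · linarith [hl.1]
        refine absurd (decRearr_le (c := c) (n := N) ht0 ?_) (not_le.2 htN)
        refine (Set.encard_le_encard (t := (s : Set ι)) fun k hk => ?_).trans ?_
        · by_contra h
          exact absurd (ht k h) (not_le.2 hk)
        · rw [Set.encard_coe_eq_coe_finsetCard, hN]
      have hin' : ∀ l ∈ insert k s, decRearr c N ≤ c l := by
        intro l hl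
        rcases Finset.mem_insert.1 hl with rfl | hl
        · exact hkeq.ge
        · exact hin l hl
      have hc' : (insert k s).card = N + 1 := by rw [Finset.card_insert_of_notMem hk, hN]
      refine ⟨insert k s, hc'.le, fun l hl => h0.trans_le (hin' l hl), ?_, fun l hl => ?_,
        fun l hl => hanti.trans (hin' l hl), fun h => absurd hc' h.ne⟩
      · rw [Finset.sum_insert hk, Finset.sum_range_succ, hsum, hkeq, add_comm]
      · by_contra! h
        have hl' : c l ≤ decRearr c N := hout l fun h => hl (Finset.mem_insert_of_mem h)
        have := card_le_of_forall_decRearr_lt hfin (n := N + 1) (s := insert l (insert k s))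
          (fun j hj => by
            rcases Finset.mem_insert.1 hj with rfl | hj
            · exact h
            · exact h.trans_le (hl'.trans (hin' j hj)))
        rw [Finset.card_insert_of_notMem hl, hc'] at this
        omega

/-- Weighted sums with weights in `[0, 1]` of total mass at most `N` are bounded by the sum of the
`N` largest values. -/
theorem hasSum_mul_le_sum_decRearr (hfin : ∀ t : ℝ, 0 < t → {k | t < c k}.Finite)
    {a : ι → ℝ} (h0 : ∀ k, 0 ≤ a k) (h1 : ∀ k, a k ≤ 1) {N : ℕ} {m S : ℝ} (ha : HasSum a m)
    (hm : m ≤ N) (hS : HasSum (fun k => c k * a k) S) :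
    S ≤ ∑ j ∈ Finset.range N, decRearr c j := by
  obtain ⟨s, hcard, hpos, hsum, hout, hin, hlt⟩ := exists_finset_sum_eq_sum_decRearr hfin N
  set ρ := decRearr c N
  have hρ : 0 ≤ ρ := decRearr_nonneg c N
  -- After subtracting `ρ` the terms outside `s` are nonpositive, and those in `s` are at most `c k
  -- - ρ`.
  have hsub : HasSum (fun k => (c k - ρ) * a k) (S - ρ * m) := by
    simpa only [sub_mul] using hS.sub (ha.mul_left ρ)
  have hle : S - ρ * m ≤ ∑ k ∈ s, (c k - ρ) := by
    refine hasSum_le_of_sum_le hsub fun F => ?_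
    classical
    calc ∑ k ∈ F, (c k - ρ) * a k
        ≤ ∑ k ∈ F ∩ s, (c k - ρ) * a k := by
          rw [← Finset.sum_inter_add_sum_sdiff F s]
          have : ∑ k ∈ F \ s, (c k - ρ) * a k ≤ 0 := Finset.sum_nonpos fun k hk =>
            mul_nonpos_of_nonpos_of_nonneg (sub_nonpos.2 (hout k (Finset.mem_sdiff.1 hk).2)) (h0 k)
          linarith
      _ ≤ ∑ k ∈ F ∩ s, (c k - ρ) := Finset.sum_le_sum fun k hk =>
          mul_le_of_le_one_right (sub_nonneg.2 (hin k (Finset.mem_inter.1 hk).2)) (h1 k)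
      _ ≤ ∑ k ∈ s, (c k - ρ) := Finset.sum_le_sum_of_subset_of_nonneg Finset.inter_subset_right
          fun k hk _ => sub_nonneg.2 (hin k hk)
  rw [Finset.sum_sub_distrib, hsum, Finset.sum_const, nsmul_eq_mul] at hle
  -- The leftover `ρ * (m - s.card)` is nonpositive when `s` has `N` elements, and `ρ = 0` when it
  -- has fewer.
  rcases hcard.eq_or_lt with h | h
  · rw [h] at hle
    nlinarith
  · have : ρ = 0 := hlt h
    rw [this] at hle
    linarith

end Rearrangement

/-! ### Positive compact operators -/

universe u

section Compact

variable {H : Type*} [NormedAddCommGroup H] [InnerProductSpace ℂ H]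

/-- An operator that is dominated pointwise by a compact operator is compact. -/
theorem isCompactOperator_of_norm_le [CompleteSpace H] {A B : H →L[ℂ] H}
    (hA : IsCompactOperator A) (h : ∀ x, ‖B x‖ ≤ ‖A x‖) : IsCompactOperator B := by
  change IsCompactOperator (B : H →ₗ[ℂ] H)
  rw [isCompactOperator_iff_isCompact_closure_image_closedBall (B : H →ₗ[ℂ] H) zero_lt_one]
  refine TotallyBounded.isCompact_of_isClosed (TotallyBounded.closure ?_) isClosed_closure
  have hT : TotallyBounded (A '' Metric.closedBall 0 1) :=
    ((IsCompactOperator.isCompact_closure_image_closedBall (f := (A : H →ₗ[ℂ] H)) hA 1)).totallyBounded.subset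
      subset_closure
  rw [Metric.totallyBounded_iff] at hT ⊢
  intro ε hε
  obtain ⟨t, ht, hcov⟩ := hT (ε / 2) (by positivity)
  -- Each useful centre of the `ε / 2`-net is replaced by the image of a point of the unit ball,
  -- because the domination compares `B` and `A` only on differences of arguments.
  have hch : ∀ y : H, ∃ x : H, (∃ z ∈ Metric.closedBall (0 : H) 1, A z ∈ Metric.ball y (ε / 2)) →
      x ∈ Metric.closedBall (0 : H) 1 ∧ A x ∈ Metric.ball y (ε / 2) := by
    intro y
    by_cases hy : ∃ z ∈ Metric.closedBall (0 : H) 1, A z ∈ Metric.ball y (ε / 2)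
    · obtain ⟨z, hz⟩ := hy
      exact ⟨z, fun _ => hz⟩
    · exact ⟨0, fun h => absurd h hy⟩
  choose g hg using hch
  refine ⟨(fun y => B (g y)) '' t, ht.image _, ?_⟩
  rintro _ ⟨x, hx, rfl⟩
  obtain ⟨y, hy, hxy⟩ := Set.mem_iUnion₂.1 (hcov ⟨x, hx, rfl⟩)
  refine Set.mem_iUnion₂.2 ⟨_, ⟨y, hy, rfl⟩, ?_⟩
  have h2 := (hg y ⟨x, hx, hxy⟩).2
  rw [Metric.mem_ball, dist_eq_norm] at hxy h2 ⊢
  calc ‖B x - B (g y)‖ = ‖B (x - g y)‖ := by rw [map_sub]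
    _ ≤ ‖A (x - g y)‖ := h _
    _ = ‖(A x - y) - (A (g y) - y)‖ := by rw [map_sub]; congr 1; abel
    _ ≤ ‖A x - y‖ + ‖A (g y) - y‖ := norm_sub_le _ _
    _ < ε := by linarith

/-- A compact operator has only finitely many eigenvalues above a positive threshold, in an
orthonormal family of eigenvectors. -/
theorem finite_eigenvalue_gt {ι : Type*} {A : H →L[ℂ] H} (hA : IsCompactOperator A) {v : ι → H}
    (hv : Orthonormal ℂ v) {c : ι → ℝ} (hc : ∀ k, A (v k) = (c k : ℂ) • v k) {t : ℝ} (ht : 0 < t) :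
    {k | t < c k}.Finite := by
  by_contra hinf
  have hT : TotallyBounded (A '' Metric.closedBall 0 1) :=
    ((IsCompactOperator.isCompact_closure_image_closedBall (f := (A : H →ₗ[ℂ] H)) hA 1)).totallyBounded.subset
      subset_closure
  rw [Metric.totallyBounded_iff] at hT
  obtain ⟨T, hTf, hcov⟩ := hT (t / 2) (by positivity)
  have hmem : ∀ k, ∃ y ∈ T, A (v k) ∈ Metric.ball y (t / 2) := fun k => by
    simpa using hcov ⟨v k, by simp [hv.1 k], rfl⟩
  choose g hgT hg using hmem
  -- By pigeonhole two images `A (v k)`, `A (v l)` share a ball of radius `t / 2`. Pairing their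
  -- difference with `v k` shows that they are at least `c k > t` apart.
  obtain ⟨k, hk, l, hl, hkl, he⟩ := Set.Infinite.exists_ne_map_eq_of_mapsTo hinf
    (fun k _ => hgT k) hTf
  have h1 := hg k
  have h2 := hg l
  rw [← he] at h2
  have h3 : dist (A (v k)) (A (v l)) < t := by
    have := dist_triangle_right (A (v k)) (A (v l)) (g k)
    rw [Metric.mem_ball] at h1 h2
    linarith
  have h4 : (c k : ℝ) = RCLike.re (inner ℂ (v k) (A (v k) - A (v l))) := by
    rw [hc, hc, inner_sub_right, inner_smul_right, inner_smul_right, hv.2 hkl,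
      inner_self_eq_norm_sq_to_K, hv.1 k]
    simp
  have h5 : c k ≤ dist (A (v k)) (A (v l)) := by
    rw [h4, dist_eq_norm]
    refine (RCLike.re_le_norm _).trans ((norm_inner_le_norm _ _).trans ?_)
    rw [hv.1 k, one_mul]
  have : t < c k := hk
  linarith

theorem isClosed_eigenspace (A : H →L[ℂ] H) (μ : ℂ) :
    IsClosed ((Module.End.eigenspace (A : H →ₗ[ℂ] H) μ : Submodule ℂ H) : Set H) := by
  have : ((Module.End.eigenspace (A : H →ₗ[ℂ] H) μ : Submodule ℂ H) : Set H) =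
      {x | A x = μ • x} := by
    ext x
    exact Module.End.mem_eigenspace_iff
  rw [this]
  exact isClosed_eq A.continuous (continuous_const_smul μ)

variable [CompleteSpace H]

/-- Completeness of the family is phrased through orthogonal complements so that bases of different
eigenspaces can be united into a basis of the whole space. -/
theorem exists_orthonormal_span_dense {U : Submodule ℂ H} (hU : IsClosed (U : Set H)) :
    ∃ (w : Set U) (v : w → U), Orthonormal ℂ v ∧
      ∀ x : H, (∀ i, inner ℂ x (v i : H) = 0) → x ∈ Uᗮ := by
  have : CompleteSpace U := hU.completeSpace_coe
  obtain ⟨w, b, -⟩ := exists_hilbertBasis ℂ U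
  refine ⟨w, b, b.orthonormal, fun x hx => ?_⟩
  rw [Submodule.mem_orthogonal']
  intro u hu
  have h1 : HasSum (fun i => (b.repr ⟨u, hu⟩ i • b i : U)) ⟨u, hu⟩ := b.hasSum_repr ⟨u, hu⟩
  have h2 := (innerSL ℂ x).hasSum (U.subtypeL.hasSum h1)
  have h3 : (fun i => innerSL ℂ x (U.subtypeL (b.repr ⟨u, hu⟩ i • b i : U))) = fun _ => 0 := by
    funext i
    simp [hx i]
  have h4 : HasSum (fun i => innerSL ℂ x (U.subtypeL (b.repr ⟨u, hu⟩ i • b i : U)))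
      (inner ℂ x u) := h2
  rw [h3] at h4
  exact h4.unique hasSum_zero

/-- The spectral theorem for positive compact operators. -/
theorem exists_hilbertBasis_eigenvectors {H : Type u} [NormedAddCommGroup H]
    [InnerProductSpace ℂ H] [CompleteSpace H] {A : H →L[ℂ] H} (hA : IsCompactOperator A)
    (hpos : 0 ≤ A) :
    ∃ (ι : Type u) (b : HilbertBasis ι ℂ H) (c : ι → ℝ), (∀ k, 0 ≤ c k) ∧
      (∀ k, A (b k) = (c k : ℂ) • b k) ∧ ∀ t : ℝ, 0 < t → {k | t < c k}.Finite := by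
  have hP : A.IsPositive := (ContinuousLinearMap.nonneg_iff_isPositive A).1 hpos
  have hsym : (A : H →ₗ[ℂ] H).IsSymmetric := hP.isSelfAdjoint.isSymmetric
  -- A basis is chosen for every complex `μ`; a trivial eigenspace contributes no vectors. That only
  -- real `μ` occur follows from `⟨v, A v⟩ = μ`.
  choose w b hb hbU using fun μ : ℂ => exists_orthonormal_span_dense (isClosed_eigenspace A μ)
  have horth := hsym.orthogonalFamily_eigenspaces.orthonormal_sigma_orthonormal
    (v_family := b) hb
  obtain ⟨v, hv⟩ : ∃ v : (Σ μ, w μ) → H, v = fun a => (b a.1 a.2 : H) := ⟨_, rfl⟩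
  have horth : Orthonormal ℂ v := by rw [hv]; exact horth
  have hdense : (Submodule.span ℂ (Set.range v))ᗮ = ⊥ := by
    rw [Submodule.eq_bot_iff]
    intro x hx
    have hx' : x ∈ (⨆ μ, Module.End.eigenspace (A : H →ₗ[ℂ] H) μ)ᗮ := by
      rw [Submodule.mem_orthogonal'] at hx
      rw [← Submodule.iInf_orthogonal, Submodule.mem_iInf]
      exact fun μ => hbU μ x fun i =>
        hx _ (Submodule.subset_span ⟨⟨μ, i⟩, by rw [hv]⟩)
    rw [ContinuousLinearMap.orthogonalComplement_iSup_eigenspaces_eq_bot hA hsym] at hx'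
    exact (Submodule.mem_bot ℂ).1 hx'
  have heig : ∀ k : Σ μ, w μ, A (v k) = k.1 • v k := fun k => by
    rw [hv]; exact Module.End.mem_eigenspace_iff.1 (b k.1 k.2).2
  have hinner : ∀ k, inner ℂ (v k) (A (v k)) = k.1 := fun k => by
    rw [heig, inner_smul_right, inner_self_eq_norm_sq_to_K, horth.1 k]
    simp
  have hreal : ∀ k : Σ μ, w μ, ((k.1.re : ℝ) : ℂ) = k.1 := fun k => by
    refine Complex.conj_eq_iff_re.1 ?_
    rw [← hinner k, inner_conj_symm]
    exact hsym _ _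
  have heig' : ∀ k : Σ μ, w μ, A (v k) = ((k.1.re : ℝ) : ℂ) • v k := fun k => by
    rw [hreal]; exact heig k
  refine ⟨_, HilbertBasis.mkOfOrthogonalEqBot horth hdense, fun k => k.1.re, fun k => ?_,
    fun k => ?_, fun t ht => finite_eigenvalue_gt hA horth heig' ht⟩
  · have := hP.re_inner_nonneg_right (v k)
    rw [hinner] at this
    exact this
  · rw [HilbertBasis.coe_mkOfOrthogonalEqBot]
    exact heig' k

/-- An eigenvector for `s > t` has no component along `b k` unless `c k = s`. Only finitely many `k`
qualify, so the algebraic span suffices without closure. -/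
theorem iSup_eigenspace_eq_span {ι : Type*} {A : H →L[ℂ] H} (hpos : 0 ≤ A)
    (b : HilbertBasis ι ℂ H) {c : ι → ℝ} (hc : ∀ k, A (b k) = (c k : ℂ) • b k)
    (hfin : ∀ t : ℝ, 0 < t → {k | t < c k}.Finite) {t : ℝ} (ht : 0 ≤ t) :
    (⨆ s : Set.Ioi t, Module.End.eigenspace (A : H →ₗ[ℂ] H) ((s : ℝ) : ℂ) : Submodule ℂ H) =
      Submodule.span ℂ (b '' {k | t < c k}) := by
  have hP : A.IsPositive := (ContinuousLinearMap.nonneg_iff_isPositive A).1 hpos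
  have hsym : (A : H →ₗ[ℂ] H).IsSymmetric := hP.isSelfAdjoint.isSymmetric
  apply le_antisymm
  · refine iSup_le fun s x hx => ?_
    have hs : t < (s : ℝ) := s.2
    have hx' : A x = ((s : ℝ) : ℂ) • x := Module.End.mem_eigenspace_iff.1 hx
    have hz : ∀ k, c k ≠ s → b.repr x k = 0 := fun k hk => by
      rw [b.repr_apply_apply]
      have h1 : inner ℂ (A (b k)) x = inner ℂ (b k) (A x) := hsym _ _
      rw [hc, hx', inner_smul_left, inner_smul_right, Complex.conj_ofReal, ← sub_eq_zero,
        ← sub_mul, mul_eq_zero, ← Complex.ofReal_sub, Complex.ofReal_eq_zero] at h1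
      exact h1.resolve_left (sub_ne_zero.2 hk)
    have hF := (hfin (s / 2) (by linarith)).subset (t := {k | c k = s}) fun k hk => by
      have hk : c k = s := hk
      simp only [Set.mem_ofPred_eq, hk]; linarith
    have h1 := b.hasSum_repr x
    have h2 := hasSum_sum_of_ne_finset_zero (f := fun i => b.repr x i • b i) (s := hF.toFinset)
      (L := SummationFilter.unconditional _)
      fun k hk => by
        rw [hz k (fun h => hk (by simpa using h)), zero_smul]
    rw [HasSum.unique h1 h2]
    refine Submodule.sum_mem _ fun k hk => Submodule.smul_mem _ _ (Submodule.subset_span ⟨k, ?_, rfl⟩)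
    have hk : c k = s := by simpa using hk
    simp only [Set.mem_ofPred_eq, hk]; exact hs
  · rw [Submodule.span_le]
    rintro _ ⟨k, hk, rfl⟩
    exact (le_iSup (fun s : Set.Ioi t =>
      Module.End.eigenspace (A : H →ₗ[ℂ] H) ((s : ℝ) : ℂ)) ⟨c k, hk⟩)
      (Module.End.mem_eigenspace_iff.2 (hc k))

/-- The rank in the definition of `singularValue` is that of a span of orthonormal vectors, hence
counts the indices with `c k > t`. -/
theorem singularValue_eq_decRearr {ι : Type*} {A : H →L[ℂ] H} (hpos : 0 ≤ A)
    (b : HilbertBasis ι ℂ H) {c : ι → ℝ} (hc : ∀ k, A (b k) = (c k : ℂ) • b k)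
    (hfin : ∀ t : ℝ, 0 < t → {k | t < c k}.Finite) (n : ℕ) :
    singularValue A n = decRearr c n := by
  rw [singularValue, decRearr, CFC.abs_of_nonneg A hpos]
  congr 1
  ext t
  refine and_congr_right fun ht => ?_
  rw [iSup_eigenspace_eq_span hpos b hc hfin ht,
    ← toENat_rank_span_set (b.orthonormal.linearIndependent.linearIndepOn _)]
  simp

end Compact

/-! ### Ky Fan's maximum principle -/

section KyFan

variable {H : Type*} [NormedAddCommGroup H] [InnerProductSpace ℂ H]

theorem hasSum_norm_inner_sq {ι : Type*} (b : HilbertBasis ι ℂ H) (u : H) :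
    HasSum (fun k => ‖inner ℂ (b k) u‖ ^ 2) (‖u‖ ^ 2) := by
  have h := Complex.hasSum_re (b.hasSum_inner_mul_inner u u)
  have h2 : (inner ℂ u u).re = ‖u‖ ^ 2 := (norm_sq_eq_re_inner (𝕜 := ℂ) u).symm
  rw [h2] at h
  refine h.congr_fun fun k => ?_
  rw [← inner_conj_symm u, Complex.conj_mul', ← Complex.ofReal_pow, Complex.ofReal_re]

theorem hasSum_eigenvalue_mul_norm_inner_sq {ι : Type*} {A : H →L[ℂ] H}
    (hA : (A : H →ₗ[ℂ] H).IsSymmetric)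
    (b : HilbertBasis ι ℂ H) {c : ι → ℝ} (hc : ∀ k, A (b k) = (c k : ℂ) • b k) (u : H) :
    HasSum (fun k => c k * ‖inner ℂ (b k) u‖ ^ 2) (inner ℂ u (A u)).re := by
  refine (Complex.hasSum_re (b.hasSum_inner_mul_inner u (A u))).congr_fun fun k => ?_
  have h1 : inner ℂ (b k) (A u) = (c k : ℂ) * inner ℂ (b k) u := by
    have : inner ℂ (A (b k)) u = inner ℂ (b k) (A u) := hA _ _
    rw [← this, hc, inner_smul_left, Complex.conj_ofReal]
  rw [h1, mul_left_comm, ← inner_conj_symm u, Complex.conj_mul', ← Complex.ofReal_pow,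
    ← Complex.ofReal_mul, Complex.ofReal_re]

/-- For an orthonormal family, the weights `∑ i, |⟨x, u i⟩|²` of a unit vector `x` are at most `1`. -/
theorem sum_norm_inner_sq_le {κ : Type*} [Fintype κ] {u : κ → H} (hu : Orthonormal ℂ u) (x : H) :
    ∑ i, ‖inner ℂ x (u i)‖ ^ 2 ≤ ‖x‖ ^ 2 := by
  refine le_of_eq_of_le (Finset.sum_congr rfl fun i _ => ?_)
    (hu.sum_inner_products_le (s := Finset.univ) x)
  rw [norm_inner_symm]

theorem hasSum_sum_norm_inner_sq {ι κ : Type*} [Fintype κ] (b : HilbertBasis ι ℂ H) {u : κ → H}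
    (hu : Orthonormal ℂ u) :
    HasSum (fun k => ∑ i, ‖inner ℂ (b k) (u i)‖ ^ 2) (Fintype.card κ) := by
  have h : HasSum (fun k => ∑ i, ‖inner ℂ (b k) (u i)‖ ^ 2) (∑ i, ‖u i‖ ^ 2) :=
    hasSum_sum fun i _ => hasSum_norm_inner_sq b (u i)
  simpa [hu.1] using h

variable [CompleteSpace H]

/-- In an eigenbasis the left side is `∑ c k * a k` with `a k = ∑ i, |⟨b k, u i⟩|²`. Bessel gives `a
k ≤ 1` and Parseval gives total weight `Fintype.card κ`. -/
theorem sum_inner_le_sum_singularValue {κ : Type*} [Fintype κ] {A : H →L[ℂ] H}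
    (hA : IsCompactOperator A) (hpos : 0 ≤ A) {u : κ → H} (hu : Orthonormal ℂ u) {N : ℕ}
    (hN : Fintype.card κ ≤ N) :
    ∑ i, (inner ℂ (u i) (A (u i))).re ≤ ∑ j ∈ Finset.range N, singularValue A j := by
  obtain ⟨ι, b, c, hc0, hc, hfin⟩ := exists_hilbertBasis_eigenvectors hA hpos
  have hsym : (A : H →ₗ[ℂ] H).IsSymmetric :=
    ((ContinuousLinearMap.nonneg_iff_isPositive A).1 hpos).isSelfAdjoint.isSymmetric
  simp_rw [singularValue_eq_decRearr hpos b hc hfin]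
  refine hasSum_mul_le_sum_decRearr hfin (a := fun k => ∑ i, ‖inner ℂ (b k) (u i)‖ ^ 2)
    (fun k => by positivity) (fun k => ?_) (hasSum_sum_norm_inner_sq b hu) (by exact_mod_cast hN) ?_
  · simpa [b.orthonormal.1 k] using sum_norm_inner_sq_le hu (b k)
  · simp_rw [Finset.mul_sum]
    exact hasSum_sum fun i _ => hasSum_eigenvalue_mul_norm_inner_sq hsym b hc (u i)

/-- Equality in Ky Fan's principle is reached on eigenvectors. Only positive eigenvalues are kept,
so `m < N` is possible for operators of small rank. -/
theorem exists_orthonormal_sum_singularValue {A : H →L[ℂ] H}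
    (hA : IsCompactOperator A) (hpos : 0 ≤ A) (N : ℕ) :
    ∃ m ≤ N, ∃ (u : Fin m → H) (c : Fin m → ℝ), Orthonormal ℂ u ∧ (∀ i, 0 < c i) ∧
      (∀ i, A (u i) = (c i : ℂ) • u i) ∧ ∑ j ∈ Finset.range N, singularValue A j = ∑ i, c i := by
  obtain ⟨ι, b, c, hc0, hc, hfin⟩ := exists_hilbertBasis_eigenvectors hA hpos
  simp_rw [singularValue_eq_decRearr hpos b hc hfin]
  obtain ⟨s, hcard, hp, hsum, -⟩ := exists_finset_sum_eq_sum_decRearr hfin N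
  refine ⟨s.card, hcard, fun i => b (s.equivFin.symm i), fun i => c (s.equivFin.symm i),
    b.orthonormal.comp (fun i => (s.equivFin.symm i : ι))
      (Subtype.val_injective.comp s.equivFin.symm.injective),
    fun i => hp _ (s.equivFin.symm i).2, fun i => hc _, ?_⟩
  rw [← hsum, ← Finset.sum_coe_sort]
  exact (s.equivFin.symm.sum_comp fun k : s => c k).symm

/-- The vectors `A⁺ x` and `A⁻ x` are orthogonal because `A⁺ A⁻ = 0`, so Pythagoras applies to their
difference `A x`. Compactness then passes from `A` to `A⁺`. -/
theorem norm_posPart_apply_le {A : H →L[ℂ] H} (hA : IsSelfAdjoint A) (x : H) :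
    ‖A⁺ x‖ ≤ ‖A x‖ := by
  have hp : IsSelfAdjoint A⁺ := (CFC.posPart_nonneg A).isSelfAdjoint
  have h0 : inner ℂ (A⁺ x) (A⁻ x) = 0 := by
    have h1 : inner ℂ (A⁺ x) (A⁻ x) = inner ℂ x (A⁺ (A⁻ x)) := hp.isSymmetric _ _
    have h2 : A⁺ (A⁻ x) = (A⁺ * A⁻) x := rfl
    rw [h1, h2, CFC.posPart_mul_negPart]
    simp
  have h3 : A x = A⁺ x - A⁻ x := by
    conv_lhs => rw [← CFC.posPart_sub_negPart A hA]
    rfl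
  have h4 := norm_sub_sq (𝕜 := ℂ) (A⁺ x) (A⁻ x)
  rw [h0, ← h3] at h4
  refine le_of_sq_le_sq ?_ (norm_nonneg _)
  rw [h4]
  simp

theorem isCompactOperator_posPart {A : H →L[ℂ] H} (hA : IsSelfAdjoint A)
    (hc : IsCompactOperator A) : IsCompactOperator (A⁺ : H →L[ℂ] H) :=
  isCompactOperator_of_norm_le hc (norm_posPart_apply_le hA)

/-- Since `A ≤ A⁺`, the bound for positive operators carries over. -/
theorem sum_inner_le_sum_singularValue_posPart {κ : Type*} [Fintype κ] {A : H →L[ℂ] H}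
    (hA : IsSelfAdjoint A) (hc : IsCompactOperator A) {u : κ → H} (hu : Orthonormal ℂ u) {N : ℕ}
    (hN : Fintype.card κ ≤ N) :
    ∑ i, (inner ℂ (u i) (A (u i))).re ≤ ∑ j ∈ Finset.range N, singularValue (A⁺) j := by
  refine le_trans (Finset.sum_le_sum fun i _ => ?_) (sum_inner_le_sum_singularValue
    (isCompactOperator_posPart hA hc) (CFC.posPart_nonneg A) hu hN)
  have h := ((ContinuousLinearMap.le_def _ _).1 (CFC.le_posPart hA)).re_inner_nonneg_right (u i)
  rw [sub_apply, inner_sub_right, map_sub] at h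
  exact sub_nonneg.1 h

/-- The operator `A⁻` kills every eigenvector of `A⁺` with positive eigenvalue, so `A` and `A⁺`
agree on the extremal family. -/
theorem exists_orthonormal_sum_singularValue_posPart {A : H →L[ℂ] H}
    (hA : IsSelfAdjoint A) (hc : IsCompactOperator A) (N : ℕ) :
    ∃ m ≤ N, ∃ u : Fin m → H, Orthonormal ℂ u ∧
      ∑ j ∈ Finset.range N, singularValue (A⁺) j = ∑ i, (inner ℂ (u i) (A (u i))).re := by
  obtain ⟨m, hm, u, c, hu, hpos, heig, hsum⟩ := exists_orthonormal_sum_singularValue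
    (isCompactOperator_posPart hA hc) (CFC.posPart_nonneg A) N
  refine ⟨m, hm, u, hu, hsum.trans (Finset.sum_congr rfl fun i _ => ?_)⟩
  have hneg : A⁻ (u i) = 0 := by
    have h1 : A⁻ (A⁺ (u i)) = (A⁻ * A⁺) (u i) := rfl
    rw [CFC.negPart_mul_posPart, heig, map_smul] at h1
    exact (smul_eq_zero.1 h1).resolve_left (by exact_mod_cast (hpos i).ne')
  have h3 : A (u i) = A⁺ (u i) - A⁻ (u i) := by
    conv_lhs => rw [← CFC.posPart_sub_negPart A hA]
    rfl
  rw [h3, hneg, sub_zero, heig, inner_smul_right, inner_self_eq_norm_sq_to_K, hu.1 i]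
  simp

theorem norm_abs_apply (T : H →L[ℂ] H) (x : H) : ‖CFC.abs T x‖ = ‖T x‖ := by
  have hp : IsSelfAdjoint (CFC.abs T) := (CFC.abs_nonneg T).isSelfAdjoint
  have h1 : inner ℂ (CFC.abs T x) (CFC.abs T x) = inner ℂ (T x) (T x) := by
    have h2 : inner ℂ (CFC.abs T x) (CFC.abs T x) = inner ℂ x ((CFC.abs T * CFC.abs T) x) :=
      hp.isSymmetric _ _
    rw [h2, CFC.abs_mul_abs, ContinuousLinearMap.star_eq_adjoint]
    exact ContinuousLinearMap.adjoint_inner_right T x (T x)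
  rw [inner_self_eq_norm_sq_to_K, inner_self_eq_norm_sq_to_K] at h1
  have h3 : ‖CFC.abs T x‖ ^ 2 = ‖T x‖ ^ 2 := by exact_mod_cast h1
  exact (sq_eq_sq₀ (norm_nonneg _) (norm_nonneg _)).1 h3

theorem singularValue_abs (T : H →L[ℂ] H) (n : ℕ) :
    singularValue (CFC.abs T) n = singularValue T n := by
  rw [singularValue, singularValue, CFC.abs_of_nonneg (CFC.abs T) (CFC.abs_nonneg T)]

/-- This replaces the polar decomposition: if the `u i` are eigenvectors of `|T|` with eigenvalues
`c i > 0`, then the vectors `(c i)⁻¹ T (u i)` are orthonormal because `T* T = |T|²`. -/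
theorem exists_orthonormal_sum_singularValue_eq_sum_inner {T : H →L[ℂ] H}
    (hc : IsCompactOperator T) (N : ℕ) :
    ∃ m ≤ N, ∃ u v : Fin m → H, Orthonormal ℂ u ∧ Orthonormal ℂ v ∧
      ∑ j ∈ Finset.range N, singularValue T j = ∑ i, (inner ℂ (v i) (T (u i))).re := by
  obtain ⟨m, hm, u, c, hu, hpos, heig, hsum⟩ := exists_orthonormal_sum_singularValue
    (isCompactOperator_of_norm_le hc fun x => (norm_abs_apply T x).le) (CFC.abs_nonneg T) N
  simp_rw [singularValue_abs] at hsum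
  have hne : ∀ i, (c i : ℂ) ≠ 0 := fun i => by exact_mod_cast (hpos i).ne'
  have hTT : ∀ i j, inner ℂ (T (u i)) (T (u j)) = (c j : ℂ) ^ 2 * inner ℂ (u i) (u j) := by
    intro i j
    have h1 : inner ℂ (T (u i)) (T (u j)) = inner ℂ (u i) ((star T * T) (u j)) := by
      rw [ContinuousLinearMap.star_eq_adjoint]
      exact (ContinuousLinearMap.adjoint_inner_right T (u i) (T (u j))).symm
    have h2 : (star T * T) (u j) = CFC.abs T (CFC.abs T (u j)) := by
      rw [← CFC.abs_mul_abs]; rfl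
    rw [h1, h2, heig, map_smul, heig, smul_smul, inner_smul_right, sq]
  refine ⟨m, hm, u, fun i => (c i : ℂ)⁻¹ • T (u i), hu, ?_, hsum.trans
    (Finset.sum_congr rfl fun i _ => ?_)⟩
  · classical
    rw [orthonormal_iff_ite] at hu ⊢
    intro i j
    rw [inner_smul_left, inner_smul_right, hTT, hu]
    split_ifs with h
    · subst h
      rw [map_inv₀, Complex.conj_ofReal]
      field_simp [hne i]
    · simp
  · rw [inner_smul_left, hTT, inner_self_eq_norm_sq_to_K, hu.1 i, map_inv₀, Complex.conj_ofReal]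
    have : (c i : ℂ)⁻¹ * ((c i : ℂ) ^ 2 * ((1 : ℝ) : ℂ) ^ 2) = c i := by
      field_simp [hne i]
      simp
    erw [this]
    simp

end KyFan

/-! ### Products of a bounded and a diagonal operator -/

section Diagonal

variable {H : Type*} [NormedAddCommGroup H] [InnerProductSpace ℂ H]
variable {ι : Type*} (b : HilbertBasis ι ℂ H) {c : ι → ℝ} {P : H →L[ℂ] H}

/-- The sum of `g k * c k` over all `k` with `c k > t`. -/
def truncSum (c g : ι → ℝ) (t : ℝ) : ℝ := ∑' k, {k | t < c k}.indicator (fun k => g k * c k) k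

theorem hasSum_truncSum (g : ι → ℝ) {t : ℝ} (hfin : {k | t < c k}.Finite) :
    HasSum ({k | t < c k}.indicator (fun k => g k * c k)) (truncSum c g t) :=
  (summable_of_hasFiniteSupport (hfin.subset Set.support_indicator_subset)).hasSum

theorem truncSum_eq_sum (g : ι → ℝ) {t : ℝ} (hfin : {k | t < c k}.Finite) :
    truncSum c g t = ∑ k ∈ hfin.toFinset, g k * c k := by
  refine (hasSum_truncSum g hfin).unique ?_
  have h := hasSum_sum_of_ne_finset_zero (L := SummationFilter.unconditional _)
    (f := {k | t < c k}.indicator (fun k => g k * c k)) (s := hfin.toFinset) fun k hk =>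
      Set.indicator_of_notMem (by simpa using hk) _
  rwa [Finset.sum_congr rfl fun k hk => Set.indicator_of_mem (by simpa using hk) _] at h

theorem hasSum_inner_comp_diagonal (hP : ∀ k, P (b k) = (c k : ℂ) • b k) (M : H →L[ℂ] H)
    (u v : H) :
    HasSum (fun k => (c k : ℂ) * (inner ℂ (b k) u * inner ℂ v (M (b k))))
      (inner ℂ v (M (P u))) := by
  have h := (innerSL ℂ v).hasSum (M.hasSum (P.hasSum (b.hasSum_repr u)))
  refine (show HasSum _ (inner ℂ v (M (P u))) from h).congr_fun fun k => ?_
  simp only [map_smul, hP, b.repr_apply_apply, innerSL_apply_apply, smul_eq_mul]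
  ring

/-- The quadratic form of a diagonal operator on an orthonormal family. -/
theorem re_sum_inner_diagonal_le {κ : Type*} [Fintype κ]
    (hP : ∀ k, P (b k) = (c k : ℂ) • b k) (hc : ∀ k, 0 ≤ c k) {C : H →L[ℂ] H} {z : ι → ℂ}
    (hC : ∀ k, C (b k) = z k • b k) {B : ℝ} (hz : ∀ k, ‖z k‖ ≤ B) (hB : 0 ≤ B)
    {t : ℝ} (ht : 0 ≤ t) (hfin : {k | t < c k}.Finite) {u : κ → H} (hu : Orthonormal ℂ u) :
    (∑ i, inner ℂ (u i) (C (P (u i)))).re ≤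
      truncSum c (fun k => (z k).re⁺) t + t * (Fintype.card κ * B) := by
  have hs := Complex.hasSum_re (hasSum_sum (s := Finset.univ) fun i _ =>
    hasSum_inner_comp_diagonal b hP C (u i) (u i))
  have ha := hasSum_sum_norm_inner_sq b hu
  refine hasSum_le (fun k => ?_) hs ((hasSum_truncSum _ hfin).add ((ha.mul_right B).mul_left t))
  have h0 : 0 ≤ ∑ i, ‖inner ℂ (b k) (u i)‖ ^ 2 := by positivity
  have h1 : ∑ i, ‖inner ℂ (b k) (u i)‖ ^ 2 ≤ 1 := by
    simpa [b.orthonormal.1 k] using sum_norm_inner_sq_le hu (b k)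
  have h2 : (∑ i, (c k : ℂ) * (inner ℂ (b k) (u i) * inner ℂ (u i) (C (b k)))).re =
      c k * ((z k).re * ∑ i, ‖inner ℂ (b k) (u i)‖ ^ 2) := by
    have : ∀ i, inner ℂ (b k) (u i) * inner ℂ (u i) (C (b k)) =
        z k * ((‖inner ℂ (b k) (u i)‖ ^ 2 : ℝ) : ℂ) := fun i => by
      rw [hC, inner_smul_right, ← inner_conj_symm (u i), mul_left_comm, Complex.mul_conj']
      push_cast
      rfl
    simp_rw [this]
    rw [← Finset.mul_sum, ← Finset.mul_sum, ← Complex.ofReal_sum, Complex.re_ofReal_mul,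
      Complex.re_mul_ofReal]
  rw [h2]
  have h3 : (z k).re ≤ (z k).re⁺ := le_posPart _
  have h3' : 0 ≤ (z k).re⁺ := posPart_nonneg _
  -- Above the threshold the weight is at most `1`. Below it `c k ≤ t`, and the total weight
  -- `Fintype.card κ` bounds the sum of all such terms.
  by_cases hk : t < c k
  · rw [Set.indicator_of_mem (by exact hk)]
    have h4 : (z k).re * ∑ i, ‖inner ℂ (b k) (u i)‖ ^ 2 ≤ (z k).re⁺ :=
      (mul_le_mul_of_nonneg_right h3 h0).trans (mul_le_of_le_one_right h3' h1)
    have h5 := mul_le_mul_of_nonneg_left h4 (hc k)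
    have h6 : 0 ≤ t * ((∑ i, ‖inner ℂ (b k) (u i)‖ ^ 2) * B) := by positivity
    linarith
  · rw [Set.indicator_of_notMem (by exact hk), zero_add, mul_comm _ B]
    have h7 : (z k).re ≤ B := (Complex.re_le_norm _).trans (hz k)
    calc c k * ((z k).re * ∑ i, ‖inner ℂ (b k) (u i)‖ ^ 2)
        ≤ c k * (B * ∑ i, ‖inner ℂ (b k) (u i)‖ ^ 2) := by
          gcongr; exact hc k
      _ ≤ t * (B * ∑ i, ‖inner ℂ (b k) (u i)‖ ^ 2) := by
          gcongr; exact not_lt.1 hk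

variable [CompleteSpace H]

/-- Above the threshold, Cauchy–Schwarz over `i` and Bessel for both families bound a term by `‖M (b
k)‖ * c k`. Below it, the inequality `2xy ≤ x² + y²` leaves weights that are summable over `k` by
Parseval. This controls both a small off-diagonal error and the singular values of a general
product. -/
theorem norm_sum_inner_comp_diagonal_le {κ : Type*} [Fintype κ]
    (hP : ∀ k, P (b k) = (c k : ℂ) • b k) (hc : ∀ k, 0 ≤ c k) (M : H →L[ℂ] H) {g : ι → ℝ}
    (hg : ∀ k, ‖M (b k)‖ ≤ g k) {t : ℝ} (ht : 0 ≤ t) (hfin : {k | t < c k}.Finite)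
    {u v : κ → H} (hu : Orthonormal ℂ u) (hv : Orthonormal ℂ v) :
    ‖∑ i, inner ℂ (v i) (M (P (u i)))‖ ≤
      truncSum c g t + t * (Fintype.card κ * (1 + ‖M‖ ^ 2) / 2) := by
  set M' := ContinuousLinearMap.adjoint M
  have hM' : ∀ k i, inner ℂ (v i) (M (b k)) = inner ℂ (M' (v i)) (b k) := fun k i =>
    (ContinuousLinearMap.adjoint_inner_left M (b k) (v i)).symm
  have hs := hasSum_sum (s := Finset.univ) fun i _ => hasSum_inner_comp_diagonal b hP M (u i) (v i)
  set a : ι → ℝ := fun k =>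
    ∑ i, (‖inner ℂ (b k) (u i)‖ ^ 2 + ‖inner ℂ (b k) (M' (v i))‖ ^ 2) / 2 with ha
  have has : HasSum a (∑ i, (‖u i‖ ^ 2 + ‖M' (v i)‖ ^ 2) / 2) :=
    hasSum_sum fun i _ => ((hasSum_norm_inner_sq b (u i)).add
      (hasSum_norm_inner_sq b (M' (v i)))).div_const 2
  -- The total mass of the weights `a`: the `u i` are unit vectors, and the adjoint has norm `‖M‖`.
  have hm : ∑ i, (‖u i‖ ^ 2 + ‖M' (v i)‖ ^ 2) / 2 ≤ Fintype.card κ * (1 + ‖M‖ ^ 2) / 2 := by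
    calc ∑ i, (‖u i‖ ^ 2 + ‖M' (v i)‖ ^ 2) / 2 ≤ ∑ _i : κ, (1 + ‖M‖ ^ 2) / 2 := by
          refine Finset.sum_le_sum fun i _ => ?_
          have h1 : ‖M' (v i)‖ ≤ ‖M‖ := by
            have := M'.le_opNorm (v i)
            rwa [hv.1 i, mul_one, show ‖M'‖ = ‖M‖ from
              LinearIsometryEquiv.norm_map ContinuousLinearMap.adjoint M] at this
          rw [hu.1 i]
          gcongr
          simp
      _ = Fintype.card κ * (1 + ‖M‖ ^ 2) / 2 := by
          rw [Finset.sum_const, Finset.card_univ, nsmul_eq_mul]; ring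
  have hbd : ∀ k, ‖∑ i, (c k : ℂ) * (inner ℂ (b k) (u i) * inner ℂ (v i) (M (b k)))‖ ≤
      {k | t < c k}.indicator (fun k => g k * c k) k + t * a k := by
    intro k
    have h1 : ‖∑ i, (c k : ℂ) * (inner ℂ (b k) (u i) * inner ℂ (v i) (M (b k)))‖ ≤
        c k * ∑ i, ‖inner ℂ (b k) (u i)‖ * ‖inner ℂ (v i) (M (b k))‖ := by
      rw [← Finset.mul_sum, norm_mul, Complex.norm_of_nonneg (hc k)]
      refine mul_le_mul_of_nonneg_left ((norm_sum_le _ _).trans_eq ?_) (hc k)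
      simp_rw [norm_mul]
    have ha0 : 0 ≤ a k := by simp only [ha]; positivity
    refine h1.trans ?_
    by_cases hk : t < c k
    · rw [Set.indicator_of_mem (by exact hk)]
      have h2 : ∑ i, ‖inner ℂ (b k) (u i)‖ * ‖inner ℂ (v i) (M (b k))‖ ≤ g k := by
        refine (Real.sum_mul_le_sqrt_mul_sqrt _ _ _).trans ?_
        have h3 : √(∑ i, ‖inner ℂ (b k) (u i)‖ ^ 2) ≤ 1 := by
          rw [← Real.sqrt_one]
          apply Real.sqrt_le_sqrt
          simpa [b.orthonormal.1 k] using sum_norm_inner_sq_le hu (b k)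
        have h4 : √(∑ i, ‖inner ℂ (v i) (M (b k))‖ ^ 2) ≤ g k := by
          refine (Real.sqrt_le_sqrt (hv.sum_inner_products_le (s := Finset.univ) (M (b k)))).trans ?_
          rw [Real.sqrt_sq (norm_nonneg _)]
          exact hg k
        exact (mul_le_mul h3 h4 (Real.sqrt_nonneg _) zero_le_one).trans_eq (one_mul _)
      have h5 := mul_le_mul_of_nonneg_left h2 (hc k)
      have h6 := mul_nonneg ht ha0
      linarith
    · rw [Set.indicator_of_notMem (by exact hk), zero_add]
      refine mul_le_mul (not_lt.1 hk) (Finset.sum_le_sum fun i _ => ?_) (by positivity) ht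
      rw [hM', norm_inner_symm (M' (v i))]
      nlinarith [sq_nonneg (‖inner ℂ (b k) (u i)‖ - ‖inner ℂ (b k) (M' (v i))‖)]
  have h := tsum_of_norm_bounded ((hasSum_truncSum g hfin).add (has.mul_left t)) hbd
  rw [hs.tsum_eq] at h
  refine h.trans (add_le_add_right (mul_le_mul_of_nonneg_left hm ht) _)

/-- Cutting off the eigenvalues at most `1 / (n + 1)` leaves a finite-rank operator within that
distance in norm. -/
theorem isCompactOperator_diagonal (hP : ∀ k, P (b k) = (c k : ℂ) • b k) (hc : ∀ k, 0 ≤ c k)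
    (hfin : ∀ t : ℝ, 0 < t → {k | t < c k}.Finite) : IsCompactOperator P := by
  have hinner : ∀ x k, inner ℂ (b k) (P x) = (c k : ℂ) * inner ℂ (b k) x := fun x k => by
    have h := hasSum_inner_comp_diagonal b hP (ContinuousLinearMap.id ℂ H) x (b k)
    refine h.unique ?_
    classical
    convert hasSum_ite_eq k ((c k : ℂ) * inner ℂ (b k) x) using 2 with l
    rw [ContinuousLinearMap.id_apply, orthonormal_iff_ite.1 b.orthonormal]
    by_cases hkl : k = l
    · subst hkl; simp
    · rw [if_neg hkl, if_neg (Ne.symm hkl), mul_zero, mul_zero]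
  have key : ∀ n : ℕ, ∃ Q : H →L[ℂ] H, IsCompactOperator Q ∧ ‖Q - P‖ ≤ 1 / ((n : ℝ) + 1) := by
    intro n
    have ht : (0 : ℝ) < 1 / ((n : ℝ) + 1) := by positivity
    set t : ℝ := 1 / ((n : ℝ) + 1)
    set U : Submodule ℂ H := Submodule.span ℂ (b '' {k | t < c k}) with hU
    have : FiniteDimensional ℂ U := FiniteDimensional.span_of_finite ℂ ((hfin t ht).image b)
    have hcomp : IsCompactOperator (U.orthogonalProjectionOnto) :=
      have : ProperSpace U := FiniteDimensional.proper ℂ U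
      isCompactOperator_of_locallyCompactSpace_dom U.orthogonalProjectionOnto
    refine ⟨P ∘L (U.subtypeL ∘L U.orthogonalProjectionOnto), ?_, ?_⟩
    · exact hcomp.clm_comp (P ∘L U.subtypeL)
    · refine ContinuousLinearMap.opNorm_le_bound _ ht.le fun x => ?_
      set y : H := x - U.starProjection x with hy
      have hyU : y ∈ Uᗮ := U.sub_starProjection_mem_orthogonal x
      have h1 : (P ∘L (U.subtypeL ∘L U.orthogonalProjectionOnto) - P) x = -P y := by
        rw [hy, map_sub]
        simp
      rw [h1, norm_neg]
      have h2 : ‖P y‖ ^ 2 ≤ t ^ 2 * ‖y‖ ^ 2 := by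
        refine hasSum_le (fun k => ?_) (hasSum_norm_inner_sq b (P y))
          ((hasSum_norm_inner_sq b y).mul_left (t ^ 2))
        rw [hinner, norm_mul, Complex.norm_of_nonneg (hc k), mul_pow]
        by_cases hk : t < c k
        · have : inner ℂ (b k) y = 0 :=
            (Submodule.mem_orthogonal U y).1 hyU _ (Submodule.subset_span ⟨k, hk, rfl⟩)
          simp [this]
        · gcongr
          · exact hc k
          · exact not_lt.1 hk
      have h3 : ‖y‖ ≤ ‖x‖ := by
        have hle := norm_sub_sq (𝕜 := ℂ) x (U.starProjection x)
        have h4 : inner ℂ x (U.starProjection x) = inner ℂ (U.starProjection x) (U.starProjection x) := by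
          rw [← sub_eq_zero, ← inner_sub_left]
          exact (Submodule.mem_orthogonal' U _).1 hyU _ (U.starProjection_apply_mem x)
        rw [h4] at hle
        have h5 := norm_sq_eq_re_inner (𝕜 := ℂ) (U.starProjection x)
        refine le_of_sq_le_sq ?_ (norm_nonneg _)
        rw [hy, hle, ← h5]
        nlinarith [sq_nonneg ‖U.starProjection x‖]
      have h6 : ‖P y‖ ≤ t * ‖y‖ := by
        refine le_of_sq_le_sq ?_ (by positivity)
        rw [mul_pow]; exact h2
      exact h6.trans (mul_le_mul_of_nonneg_left h3 ht.le)
  choose Q hQ hQP using key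
  refine isCompactOperator_of_tendsto (F := Q) (l := atTop) ?_ (Eventually.of_forall hQ)
  rw [tendsto_iff_norm_sub_tendsto_zero]
  exact squeeze_zero (fun _ => norm_nonneg _) hQP tendsto_one_div_add_atTop_nhds_zero_nat

end Diagonal

/-! ### Asymptotics of the Dixmier sequence -/

section DixmierAsymptotics

theorem tendsto_neg_log_div_log {C : ℝ} (hC : 0 < C) :
    Tendsto (fun n : ℕ => -Real.log (C / ((n + 1 : ℕ) : ℝ)) / Real.log (1 + ((n + 1 : ℕ) : ℝ)))
      atTop (𝓝 1) := by
  have hcast : Tendsto (fun n : ℕ => (1 : ℝ) + ((n + 1 : ℕ) : ℝ)) atTop atTop :=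
    tendsto_atTop_add_const_left _ _
      (tendsto_natCast_atTop_atTop.comp (tendsto_add_atTop_nat 1))
  have hlog := Real.tendsto_log_atTop.comp hcast
  have h1 : Tendsto (fun n : ℕ => (Real.log 2 + |Real.log C|) / Real.log (1 + ((n + 1 : ℕ) : ℝ)))
      atTop (𝓝 0) := tendsto_const_nhds.div_atTop hlog
  rw [tendsto_iff_norm_sub_tendsto_zero]
  refine squeeze_zero (fun _ => norm_nonneg _) (fun n => ?_) h1
  have hn : (0 : ℝ) < ((n + 1 : ℕ) : ℝ) := by positivity
  have hn1 : (1 : ℝ) ≤ ((n + 1 : ℕ) : ℝ) := by push_cast; linarith [Nat.cast_nonneg (α := ℝ) n]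
  have hpos : 0 < Real.log (1 + ((n + 1 : ℕ) : ℝ)) := Real.log_pos (by linarith)
  rw [div_sub_one hpos.ne', norm_div, Real.norm_eq_abs, Real.norm_eq_abs, abs_of_pos hpos]
  gcongr
  rw [Real.log_div hC.ne' hn.ne']
  have h2 : Real.log ((n + 1 : ℕ) : ℝ) ≤ Real.log (1 + ((n + 1 : ℕ) : ℝ)) :=
    Real.log_le_log hn (by linarith)
  have h3 : Real.log (1 + ((n + 1 : ℕ) : ℝ)) ≤ Real.log 2 + Real.log ((n + 1 : ℕ) : ℝ) := by
    rw [← Real.log_mul two_ne_zero hn.ne']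
    exact Real.log_le_log (by linarith) (by linarith)
  rw [abs_le]
  constructor <;> cases abs_cases (Real.log C) <;> linarith [Real.log_pos one_lt_two]

/-- Replacing the cutoff `1 / N` by `C / N` shifts `-log t` by a bounded amount only. Hence upper
and lower estimates with different cutoffs have the same limit. -/
theorem tendsto_div_log_of_tendsto {S : ℝ → ℝ} {L C : ℝ} (hC : 0 < C)
    (hS : Tendsto (fun t => S t / -Real.log t) (𝓝[>] 0) (𝓝 L)) :
    Tendsto (fun n : ℕ => S (C / ((n + 1 : ℕ) : ℝ)) / Real.log (1 + ((n + 1 : ℕ) : ℝ)))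
      atTop (𝓝 L) := by
  have ht : Tendsto (fun n : ℕ => C / ((n + 1 : ℕ) : ℝ)) atTop (𝓝[>] 0) := by
    refine tendsto_nhdsWithin_iff.2 ⟨tendsto_const_nhds.div_atTop
      (tendsto_natCast_atTop_atTop.comp (tendsto_add_atTop_nat 1)), Eventually.of_forall fun n => ?_⟩
    exact Set.mem_Ioi.2 (by positivity)
  have h := (hS.comp ht).mul (tendsto_neg_log_div_log hC)
  rw [mul_one] at h
  refine h.congr' ?_
  have hlt : ∀ᶠ n : ℕ in atTop, C / ((n + 1 : ℕ) : ℝ) < 1 :=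
    (ht.mono_right nhdsWithin_le_nhds).eventually (gt_mem_nhds one_pos)
  filter_upwards [hlt] with n hn
  have : Real.log (C / ((n + 1 : ℕ) : ℝ)) < 0 := Real.log_neg (by positivity) hn
  rw [Function.comp_apply, div_mul_div_cancel₀ (neg_ne_zero.2 this.ne)]

theorem tendsto_const_div_log (C : ℝ) :
    Tendsto (fun n : ℕ => C / Real.log (1 + ((n + 1 : ℕ) : ℝ))) atTop (𝓝 0) :=
  tendsto_const_nhds.div_atTop (Real.tendsto_log_atTop.comp (tendsto_atTop_add_const_left _ _
    (tendsto_natCast_atTop_atTop.comp (tendsto_add_atTop_nat 1))))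

variable {H : Type*} [NormedAddCommGroup H] [InnerProductSpace ℂ H]
variable {ι : Type*} (b : HilbertBasis ι ℂ H)

theorem exists_diagonal {z : ι → ℂ} {B : ℝ} (hz : ∀ k, ‖z k‖ ≤ B) :
    ∃ C : H →L[ℂ] H, ∀ x k, inner ℂ (b k) (C x) = z k * inner ℂ (b k) x := by
  have hT : ∀ k, ‖z k • ContinuousLinearMap.id ℂ ℂ‖ ≤ B := fun k => by
    simpa [norm_smul] using hz k
  refine ⟨b.repr.symm.toContinuousLinearEquiv.toContinuousLinearMap ∘L
    directSumCLM (E := fun _ : ι => ℂ) (fun k => z k • ContinuousLinearMap.id ℂ ℂ) B hT ∘L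
      b.repr.toContinuousLinearEquiv.toContinuousLinearMap, fun x k => ?_⟩
  rw [← b.repr_apply_apply, ← b.repr_apply_apply]
  simp [directSumCLM]

theorem apply_basis_of_inner_eq {z : ι → ℂ} {C : H →L[ℂ] H}
    (hC : ∀ x k, inner ℂ (b k) (C x) = z k * inner ℂ (b k) x) (k : ι) : C (b k) = z k • b k := by
  classical
  apply b.repr.injective
  ext l
  rw [b.repr_apply_apply, hC, b.repr_apply_apply, inner_smul_right,
    orthonormal_iff_ite.1 b.orthonormal]
  split_ifs with h
  · rw [h]
  · simp

variable [CompleteSpace H] {c : ι → ℝ} {P : H →L[ℂ] H}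

theorem re_inner_realPart (T : H →L[ℂ] H) (u : H) :
    (inner ℂ u ((realPart T : H →L[ℂ] H) u)).re = (inner ℂ u (T u)).re := by
  have h : (inner ℂ u (star T u)).re = (inner ℂ u (T u)).re := by
    rw [ContinuousLinearMap.star_eq_adjoint, ContinuousLinearMap.adjoint_inner_right,
      ← inner_conj_symm, Complex.conj_re]
  rw [realPart_apply_coe]
  change (inner ℂ u ((2 : ℝ)⁻¹ • (T u + star T u))).re = _
  rw [inner_smul_right_eq_smul, inner_add_right, Complex.smul_re, Complex.add_re, h, smul_eq_mul]
  ring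

theorem isCompactOperator_realPart_mul (hP : IsCompactOperator P) (hPs : IsSelfAdjoint P)
    (M : H →L[ℂ] H) : IsCompactOperator ((realPart (M * P) : H →L[ℂ] H)) := by
  rw [realPart_apply_coe, star_mul, hPs.star_eq]
  have h1 : IsCompactOperator (M * P) := hP.clm_comp M
  have h2 : IsCompactOperator (P * star M) := hP.comp_clm (star M)
  exact (h1.add h2).smul _

theorem isSelfAdjoint_diagonal (hP : ∀ k, P (b k) = (c k : ℂ) • b k) : IsSelfAdjoint P := by
  rw [ContinuousLinearMap.isSelfAdjoint_iff']
  refine ContinuousLinearMap.ext fun x => b.repr.injective ?_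
  ext k
  rw [b.repr_apply_apply, b.repr_apply_apply, ContinuousLinearMap.adjoint_inner_right, hP,
    inner_smul_left, Complex.conj_ofReal]
  have h := hasSum_inner_comp_diagonal b hP (ContinuousLinearMap.id ℂ H) x (b k)
  refine HasSum.unique ?_ h
  classical
  convert hasSum_ite_eq k ((c k : ℂ) * inner ℂ (b k) x) using 2 with l
  rw [ContinuousLinearMap.id_apply, orthonormal_iff_ite.1 b.orthonormal]
  by_cases hkl : k = l
  · subst hkl; simp
  · rw [if_neg hkl, if_neg (Ne.symm hkl), mul_zero, mul_zero]

/-- If `M` is diagonal up to an error that is negligible on average, then the Dixmier sequence of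
the positive part of `Re (M P)` converges to the logarithmic mean of the positive parts of the
diagonal entries. -/
theorem tendsto_dixmierSeq_posPart (hP : ∀ k, P (b k) = (c k : ℂ) • b k) (hc : ∀ k, 0 ≤ c k)
    (hfin : ∀ t : ℝ, 0 < t → {k | t < c k}.Finite) {C₀ : ℝ} (hC₀ : 0 < C₀)
    (hcount : ∀ t : ℝ, 0 < t → ({k | t < c k}.ncard : ℝ) ≤ C₀ / t)
    (M : H →L[ℂ] H) {z : ι → ℂ} {B : ℝ} (hB : 0 ≤ B) (hz : ∀ k, ‖z k‖ ≤ B) {m : ι → ℝ}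
    (hm : ∀ k, ‖M (b k) - z k • b k‖ ≤ m k) {L : ℝ}
    (hL : Tendsto (fun t => truncSum c (fun k => (z k).re⁺) t / -Real.log t) (𝓝[>] 0) (𝓝 L))
    (h0 : Tendsto (fun t => truncSum c m t / -Real.log t) (𝓝[>] 0) (𝓝 0)) :
    Tendsto (dixmierSeq ((realPart (M * P) : H →L[ℂ] H)⁺)) atTop (𝓝 L) := by
  obtain ⟨C, hCx⟩ := exists_diagonal b hz
  have hC := apply_basis_of_inner_eq b hCx
  have hcomp : IsCompactOperator ((realPart (M * P) : H →L[ℂ] H)) :=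
    isCompactOperator_realPart_mul (isCompactOperator_diagonal b hP hc hfin)
      (isSelfAdjoint_diagonal b hP) M
  have hsa : IsSelfAdjoint ((realPart (M * P) : H →L[ℂ] H)) := (realPart (M * P)).2
  set D := M - C with hD
  have hDk : ∀ k, ‖D (b k)‖ ≤ m k := fun k => by
    rw [hD, sub_apply, hC]; exact hm k
  -- The part below the cutoff `1 / N`, summed over at most `N` vectors, contributes at most `B`
  -- from the diagonal part and `(1 + ‖D‖ ^ 2) / 2` from the error.
  set κ : ℝ := B + (1 + ‖D‖ ^ 2) / 2 with hκ
  have upper : ∀ n : ℕ, dixmierSeq ((realPart (M * P) : H →L[ℂ] H)⁺) n ≤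
      truncSum c (fun k => (z k).re⁺) (1 / ((n + 1 : ℕ) : ℝ)) / Real.log (1 + ((n + 1 : ℕ) : ℝ)) +
      truncSum c m (1 / ((n + 1 : ℕ) : ℝ)) / Real.log (1 + ((n + 1 : ℕ) : ℝ)) +
      κ / Real.log (1 + ((n + 1 : ℕ) : ℝ)) := by
    intro n
    have hlog : 0 ≤ Real.log (1 + ((n + 1 : ℕ) : ℝ)) := Real.log_nonneg (le_add_of_nonneg_right (Nat.cast_nonneg _))
    rw [dixmierSeq, ← add_div, ← add_div]
    refine div_le_div_of_nonneg_right ?_ hlog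
    obtain ⟨r, hr, u, hu, hsum⟩ := exists_orthonormal_sum_singularValue_posPart hsa hcomp (n + 1)
    have ht : (0 : ℝ) < 1 / ((n + 1 : ℕ) : ℝ) := by positivity
    have hsplit : ∑ i, (inner ℂ (u i) ((realPart (M * P) : H →L[ℂ] H) (u i))).re =
        (∑ i, inner ℂ (u i) (C (P (u i)))).re + (∑ i, inner ℂ (u i) (D (P (u i)))).re := by
      simp_rw [re_inner_realPart]
      rw [← Complex.add_re, ← Finset.sum_add_distrib, Complex.re_sum]
      refine Finset.sum_congr rfl fun i _ => ?_
      rw [← inner_add_right, hD, sub_apply, add_sub_cancel]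
      rfl
    rw [hsum, hsplit]
    have h1 := re_sum_inner_diagonal_le b hP hc hC hz hB ht.le (hfin _ ht) hu
    have h2 := (Complex.re_le_norm _).trans
      (norm_sum_inner_comp_diagonal_le b hP hc D hDk ht.le (hfin _ ht) hu hu)
    have h3 : 1 / ((n + 1 : ℕ) : ℝ) * (Fintype.card (Fin r) * B) +
        1 / ((n + 1 : ℕ) : ℝ) * (Fintype.card (Fin r) * (1 + ‖D‖ ^ 2) / 2) ≤ κ := by
      have hrn : (r : ℝ) ≤ ((n + 1 : ℕ) : ℝ) := by exact_mod_cast hr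
      have hn : (0 : ℝ) < ((n + 1 : ℕ) : ℝ) := by positivity
      have hκ0 : 0 ≤ κ := by positivity
      rw [Fintype.card_fin, ← mul_add, one_div, inv_mul_le_iff₀ hn,
        show (r : ℝ) * B + r * (1 + ‖D‖ ^ 2) / 2 = r * κ by rw [hκ]; ring]
      exact mul_le_mul_of_nonneg_right hrn hκ0
    linarith
  -- The cutoff `C₀ / N` is chosen so that at most `N` eigenvalues exceed it. The corresponding
  -- basis vectors with positive `(z k).re` are then admissible test vectors.
  have lower : ∀ n : ℕ,
      truncSum c (fun k => (z k).re⁺) (C₀ / ((n + 1 : ℕ) : ℝ)) / Real.log (1 + ((n + 1 : ℕ) : ℝ)) -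
      truncSum c m (C₀ / ((n + 1 : ℕ) : ℝ)) / Real.log (1 + ((n + 1 : ℕ) : ℝ)) ≤
      dixmierSeq ((realPart (M * P) : H →L[ℂ] H)⁺) n := by
    intro n
    have hlog : 0 ≤ Real.log (1 + ((n + 1 : ℕ) : ℝ)) := Real.log_nonneg (le_add_of_nonneg_right (Nat.cast_nonneg _))
    rw [dixmierSeq, ← sub_div]
    refine div_le_div_of_nonneg_right ?_ hlog
    have hn : (0 : ℝ) < ((n + 1 : ℕ) : ℝ) := by positivity
    have ht : (0 : ℝ) < C₀ / ((n + 1 : ℕ) : ℝ) := by positivity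
    set t : ℝ := C₀ / ((n + 1 : ℕ) : ℝ) with htdef
    classical
    set s := (hfin t ht).toFinset.filter fun k => 0 < (z k).re with hs
    have hcard : Fintype.card s ≤ n + 1 := by
      rw [Fintype.card_coe]
      refine (Finset.card_filter_le _ _).trans ?_
      have h := hcount t ht
      rw [Set.ncard_eq_toFinset_card _ (hfin t ht),
        show C₀ / t = ((n + 1 : ℕ) : ℝ) by rw [htdef, div_div_cancel₀ hC₀.ne']] at h
      exact_mod_cast h
    have hu : Orthonormal ℂ fun k : s => b k :=
      b.orthonormal.comp (fun k : s => (k : ι)) Subtype.val_injective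
    refine le_trans ?_ (sum_inner_le_sum_singularValue_posPart hsa hcomp hu hcard)
    rw [truncSum_eq_sum _ (hfin t ht), truncSum_eq_sum _ (hfin t ht)]
    simp_rw [re_inner_realPart]
    rw [Finset.sum_coe_sort s fun k => (inner ℂ (b k) ((M * P) (b k))).re]
    have hterm : ∀ k, (z k).re * c k - m k * c k ≤ (inner ℂ (b k) ((M * P) (b k))).re := fun k => by
      have h1 : (M * P) (b k) = (c k : ℂ) • (z k • b k + D (b k)) := by
        change M (P (b k)) = _
        rw [hP, map_smul, hD, sub_apply, hC, add_sub_cancel]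
      rw [h1, inner_smul_right, Complex.re_ofReal_mul, inner_add_right, inner_smul_right,
        inner_self_eq_norm_sq_to_K, b.orthonormal.1 k, Complex.add_re]
      have h2 : -(m k) ≤ (inner ℂ (b k) (D (b k))).re := by
        have h3 : ‖inner ℂ (b k) (D (b k))‖ ≤ m k := by
          refine (norm_inner_le_norm _ _).trans ?_
          rw [b.orthonormal.1 k, one_mul]
          exact hDk k
        exact neg_le_of_abs_le ((Complex.abs_re_le_norm _).trans h3)
      have h4 := mul_le_mul_of_nonneg_left h2 (hc k)
      simp only [RCLike.ofReal_one, one_pow, mul_one]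
      linarith
    have hm0 : ∀ k, 0 ≤ m k := fun k => (norm_nonneg _).trans (hDk k)
    calc ∑ k ∈ (hfin t ht).toFinset, (z k).re⁺ * c k - ∑ k ∈ (hfin t ht).toFinset, m k * c k
        ≤ ∑ k ∈ s, (z k).re * c k - ∑ k ∈ s, m k * c k := by
          refine sub_le_sub (le_of_eq ?_) (Finset.sum_le_sum_of_subset_of_nonneg
            (Finset.filter_subset _ _) fun k _ _ => mul_nonneg (hm0 k) (hc k))
          rw [hs, Finset.sum_filter]
          refine Finset.sum_congr rfl fun k _ => ?_
          split_ifs with h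
          · rw [posPart_of_nonneg h.le]
          · rw [posPart_of_nonpos (not_lt.1 h), zero_mul]
      _ ≤ ∑ k ∈ s, (inner ℂ (b k) ((M * P) (b k))).re := by
          rw [← Finset.sum_sub_distrib]
          exact Finset.sum_le_sum fun k _ => hterm k
  refine tendsto_of_tendsto_of_tendsto_of_le_of_le ?_ ?_ lower upper
  · simpa using (tendsto_div_log_of_tendsto hC₀ hL).sub (tendsto_div_log_of_tendsto hC₀ h0)
  · simpa using ((tendsto_div_log_of_tendsto one_pos hL).add
      (tendsto_div_log_of_tendsto one_pos h0)).add (tendsto_const_div_log κ)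

/-- The crude bound `‖M (b k)‖ ≤ B` suffices: the singular values of `M * P` sum to at most `B`
times the truncated sum of the `c k`, plus a constant. -/
theorem inDixmierIdeal_mul_diagonal (hP : ∀ k, P (b k) = (c k : ℂ) • b k) (hc : ∀ k, 0 ≤ c k)
    (hfin : ∀ t : ℝ, 0 < t → {k | t < c k}.Finite) (M : H →L[ℂ] H) {B : ℝ}
    (hM : ‖M‖ ≤ B) {L : ℝ}
    (hL : Tendsto (fun t => truncSum c (fun _ => B) t / -Real.log t) (𝓝[>] 0) (𝓝 L)) :
    InDixmierIdeal (M * P) := by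
  have hcomp : IsCompactOperator (M * P) := (isCompactOperator_diagonal b hP hc hfin).clm_comp M
  refine ⟨hcomp, ?_⟩
  set κ : ℝ := (1 + ‖M‖ ^ 2) / 2 with hκ
  obtain ⟨R, hR⟩ := ((tendsto_div_log_of_tendsto one_pos hL).add
    (tendsto_const_div_log κ)).bddAbove_range
  refine ⟨R, ?_⟩
  rintro _ ⟨n, rfl⟩
  refine le_trans ?_ (hR ⟨n, rfl⟩)
  have hlog : 0 ≤ Real.log (1 + ((n + 1 : ℕ) : ℝ)) := Real.log_nonneg (le_add_of_nonneg_right (Nat.cast_nonneg _))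
  simp only
  rw [dixmierSeq, ← add_div]
  refine div_le_div_of_nonneg_right ?_ hlog
  obtain ⟨r, hr, u, v, hu, hv, hsum⟩ :=
    exists_orthonormal_sum_singularValue_eq_sum_inner hcomp (n + 1)
  have ht : (0 : ℝ) < 1 / ((n + 1 : ℕ) : ℝ) := by positivity
  rw [hsum, ← Complex.re_sum]
  have h2 := (Complex.re_le_norm _).trans
    (norm_sum_inner_comp_diagonal_le b hP hc M (g := fun _ => B) (fun k =>
      (M.le_opNorm _).trans (by rw [b.orthonormal.1 k, mul_one]; exact hM)) ht.le (hfin _ ht) hu hv)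
  refine h2.trans (add_le_add_right ?_ _)
  have hrn : (r : ℝ) ≤ ((n + 1 : ℕ) : ℝ) := by exact_mod_cast hr
  have hn : (0 : ℝ) < ((n + 1 : ℕ) : ℝ) := by positivity
  rw [Fintype.card_fin, one_div, inv_mul_le_iff₀ hn, mul_div_assoc]
  exact mul_le_mul_of_nonneg_right hrn (by positivity)

/-- A convergent sequence differs from a constant one by an element of `c₀`. Convergence also gives
the boundedness that keeps `dixmierTracePos` off its default value. -/
theorem dixmierTracePos_eq_of_tendsto (w : ExtendedLimit) {T : H →L[ℂ] H} {L : ℝ}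
    (hT : Tendsto (dixmierSeq T) atTop (𝓝 L)) : dixmierTracePos w T = L := by
  have hT' : Tendsto (fun n => (dixmierSeq T n : ℂ)) atTop (𝓝 (L : ℂ)) :=
    (Complex.continuous_ofReal.tendsto L).comp hT
  have hmem : Memℓp (fun n => (dixmierSeq T n : ℂ)) ⊤ :=
    memℓp_infty (hT'.norm.bddAbove_range)
  rw [dixmierTracePos, dif_pos hmem]
  set x : lp (fun _ : ℕ => ℂ) ⊤ := ⟨_, hmem⟩
  have h1 : w.toLinearMap (x - (L : ℂ) • 1) = 0 := by
    refine w.map_null _ ?_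
    have : (fun n => (x - (L : ℂ) • 1 : lp (fun _ : ℕ => ℂ) ⊤) n) =
        fun n => (dixmierSeq T n : ℂ) - L := by
      funext n
      change (dixmierSeq T n : ℂ) - (L : ℂ) * 1 = _
      rw [mul_one]
    rw [this]
    simpa using hT'.sub_const (L : ℂ)
  rw [map_sub, map_smul, w.map_one, smul_eq_mul, mul_one, sub_eq_zero] at h1
  exact h1

end DixmierAsymptotics

/-! ### Functional calculus and trace of a diagonal operator -/

section FunctionalCalculus

variable {H : Type*} [NormedAddCommGroup H] [InnerProductSpace ℂ H]
variable {ι : Type*} (b : HilbertBasis ι ℂ H)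

theorem ext_inner_basis {x y : H} (h : ∀ k, inner ℂ (b k) x = inner ℂ (b k) y) : x = y := by
  apply b.repr.injective
  ext k
  rw [b.repr_apply_apply, b.repr_apply_apply, h]

/-- The operator with diagonal entries `g (c k)` qualifies, because an eigenvector of `D` for `r`
has components only where `c k = r`. It is the only one, since the `b k` are eigenvectors with dense
span. So `functionOf` does not fall back to `0`. -/
theorem inner_functionOf {D : H →ₗ.[ℂ] H} {c : ι → ℝ}
    (hb : ∀ k, ∃ h : b k ∈ D.domain, D ⟨b k, h⟩ = (c k : ℂ) • b k)
    (hD : ∀ (x : D.domain) k, inner ℂ (b k) (D x) = (c k : ℂ) * inner ℂ (b k) (x : H))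
    {g : ℝ → ℝ} {B : ℝ} (hg : ∀ k, |g (c k)| ≤ B) (x : H) (k : ι) :
    inner ℂ (b k) (functionOf D g x) = (g (c k) : ℂ) * inner ℂ (b k) x := by
  obtain ⟨A, hA⟩ := exists_diagonal b (z := fun k => (g (c k) : ℂ)) (B := B)
    (fun k => by rw [Complex.norm_real]; exact hg k)
  have hfun : IsFunctionOf D g A := by
    intro x r hx
    refine ext_inner_basis b fun k => ?_
    rw [hA, inner_smul_right]
    have h1 := hD x k
    rw [hx, inner_smul_right, ← sub_eq_zero, ← sub_mul, mul_eq_zero, sub_eq_zero] at h1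
    rcases h1 with h1 | h1
    · rw [Complex.ofReal_inj.1 h1]
    · rw [h1, mul_zero, mul_zero]
  have huniq : ∃! A : H →L[ℂ] H, IsFunctionOf D g A := by
    refine ⟨A, hfun, fun A' hA' => ?_⟩
    have hdense : Dense ((Submodule.span ℂ (Set.range b) : Submodule ℂ H) : Set H) := by
      exact Submodule.dense_iff_topologicalClosure_eq_top.2 b.dense_span
    refine ContinuousLinearMap.ext_on hdense ?_
    rintro _ ⟨k, rfl⟩
    obtain ⟨hk, hDk⟩ := hb k
    exact (hA' ⟨b k, hk⟩ (c k) hDk).trans (hfun ⟨b k, hk⟩ (c k) hDk).symm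
  have heq : functionOf D g = A := by
    rw [functionOf, dif_pos huniq]
    exact huniq.unique huniq.choose_spec.1 hfun
  rw [heq, hA]

variable [CompleteSpace H]

/-- `HasFiniteTrace` asks for one good basis, so the forward direction is the independence of the
trace from the basis: finite partial sums over `b` are bounded by exchanging the two summations. -/
theorem hasFiniteTrace_iff {T : H →L[ℂ] H} {g : ι → ℝ} (hg : ∀ k, 0 ≤ g k)
    (hT : ∀ x k, inner ℂ (b k) (T x) = (g k : ℂ) * inner ℂ (b k) x) :
    HasFiniteTrace T ↔ Summable g := by
  have hTb := apply_basis_of_inner_eq b hT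
  have hsym : (T : H →ₗ[ℂ] H).IsSymmetric := (isSelfAdjoint_diagonal b hTb).isSymmetric
  constructor
  · rintro ⟨s, b', hs⟩
    refine summable_of_sum_le hg (c := ∑' i, (inner ℂ (b' i) (T (b' i))).re) fun F => ?_
    have h1 : ∀ i, HasSum (fun k => g k * ‖inner ℂ (b k) (b' i)‖ ^ 2)
        (inner ℂ (b' i) (T (b' i))).re := fun i =>
      hasSum_eigenvalue_mul_norm_inner_sq hsym b hTb (b' i)
    have h2 : HasSum (fun i => ∑ k ∈ F, g k * ‖inner ℂ (b k) (b' i)‖ ^ 2) (∑ k ∈ F, g k) := by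
      refine hasSum_sum fun k _ => ?_
      have h3 := (hasSum_norm_inner_sq b' (b k)).mul_left (g k)
      rw [b.orthonormal.1 k, one_pow, mul_one] at h3
      exact h3.congr_fun fun i => by rw [norm_inner_symm]
    exact hasSum_le (fun i => sum_le_hasSum F (fun k _ => by have := hg k; positivity) (h1 i)) h2
      hs.hasSum
  · intro hs
    have hinj : Function.Injective b := b.orthonormal.linearIndependent.injective
    -- The definition wants a basis indexed by a subset of `H`, so `b` is reindexed by its range.
    refine ⟨Set.range b, HilbertBasis.mk (v := ((↑) : Set.range b → H)) ?_ ?_, ?_⟩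
    · exact b.orthonormal.toSubtypeRange
    · rw [Subtype.range_coe]
      exact b.dense_span.ge
    · rw [HilbertBasis.coe_mk, ← (Equiv.ofInjective b hinj).summable_iff]
      refine hs.congr fun k => ?_
      simp only [Function.comp_apply, Equiv.ofInjective_apply]
      rw [hTb, inner_smul_right, inner_self_eq_norm_sq_to_K, b.orthonormal.1 k]
      simp

end FunctionalCalculus

/-! ### The eigenbasis of a direct sum -/

section DirectSumBasis

variable {ι κ : Type*} {E : ι → Type*} [∀ i, NormedAddCommGroup (E i)]
  [∀ i, InnerProductSpace ℂ (E i)]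

open Classical in
theorem exists_directSumBasis [∀ i, CompleteSpace (E i)] (b : ∀ i, HilbertBasis κ ℂ (E i)) :
    ∃ B : HilbertBasis (ι × κ) ℂ (lp E 2), ∀ p, B p = lp.single 2 p.1 (b p.1 p.2) := by
  have horth : Orthonormal ℂ fun p : ι × κ => (lp.single 2 p.1 (b p.1 p.2) : lp E 2) := by
    rw [orthonormal_iff_ite]
    rintro ⟨i, k⟩ ⟨j, l⟩
    rw [lp.inner_single_left]
    by_cases hij : i = j
    · subst hij
      simp only [lp.single_apply_self]
      rw [orthonormal_iff_ite.1 (b i).orthonormal]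
      simp
    · simp only
      rw [lp.single_apply_ne _ _ _ hij, inner_zero_right, if_neg]
      exact fun h => hij (congrArg Prod.fst h)
  have hbot : (Submodule.span ℂ (Set.range fun p : ι × κ =>
      (lp.single 2 p.1 (b p.1 p.2) : lp E 2)))ᗮ = ⊥ := by
    rw [Submodule.eq_bot_iff]
    intro x hx
    ext i : 2
    refine ext_inner_basis (b i) fun k => ?_
    have h := (Submodule.mem_orthogonal _ x).1 hx _ (Submodule.subset_span ⟨(i, k), rfl⟩)
    rw [lp.inner_single_left] at h
    simpa using h
  exact ⟨HilbertBasis.mkOfOrthogonalEqBot horth hbot, fun p => by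
    rw [HilbertBasis.coe_mkOfOrthogonalEqBot]⟩

theorem inner_diagonalOp {H : Type*} [NormedAddCommGroup H] [InnerProductSpace ℂ H]
    (b : HilbertBasis κ ℂ H) (c : κ → ℝ) (x : (diagonalOp b c).domain) (k : κ) :
    inner ℂ (b k) (diagonalOp b c x) = (c k : ℂ) * inner ℂ (b k) (x : H) := by
  rw [← b.repr_apply_apply, ← b.repr_apply_apply]
  change b.repr (b.repr.symm _) k = _
  rw [LinearIsometryEquiv.apply_symm_apply]

theorem basis_mem_diagonalOp_domain {H : Type*} [NormedAddCommGroup H] [InnerProductSpace ℂ H]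
    (b : HilbertBasis κ ℂ H) (c : κ → ℝ) (k : κ) :
    ∃ h : b k ∈ (diagonalOp b c).domain, diagonalOp b c ⟨b k, h⟩ = (c k : ℂ) • b k := by
  classical
  have hmem : b k ∈ (diagonalOp b c).domain := by
    change Memℓp (fun i => (c i : ℂ) * b.repr (b k) i) 2
    have h : (fun i => (c i : ℂ) * b.repr (b k) i) = fun i => (c k : ℂ) * b.repr (b k) i := by
      funext i
      rw [b.repr_apply_apply, orthonormal_iff_ite.1 b.orthonormal]
      split_ifs with h
      · rw [h]
      · simp
    rw [h]
    exact Memℓp.const_mul (lp.memℓp (b.repr (b k))) _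
  refine ⟨hmem, ext_inner_basis b fun i => ?_⟩
  rw [inner_diagonalOp, inner_smul_right, orthonormal_iff_ite.1 b.orthonormal]
  split_ifs with h
  · rw [h]
  · simp

theorem inner_directSumOp_diagonal (b : ∀ i, HilbertBasis κ ℂ (E i)) (c : ι → κ → ℝ)
    {B : HilbertBasis (ι × κ) ℂ (lp E 2)}
    (hB : ∀ (p : ι × κ) (x : lp E 2), inner ℂ (B p) x = inner ℂ (b p.1 p.2) (x p.1))
    (x : (directSumOp fun i => diagonalOp (b i) (c i)).domain) (p : ι × κ) :
    inner ℂ (B p) (directSumOp (fun i => diagonalOp (b i) (c i)) x) =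
      (c p.1 p.2 : ℂ) * inner ℂ (B p) (x : lp E 2) := by
  rw [hB, hB]
  exact inner_diagonalOp (b p.1) (c p.1) ⟨(x : lp E 2) p.1, x.2.choose p.1⟩ p.2

open Classical in
theorem basis_mem_directSumOp_domain (b : ∀ i, HilbertBasis κ ℂ (E i)) (c : ι → κ → ℝ)
    {B : HilbertBasis (ι × κ) ℂ (lp E 2)} (hBs : ∀ p, B p = lp.single 2 p.1 (b p.1 p.2))
    (hB : ∀ (p : ι × κ) (x : lp E 2), inner ℂ (B p) x = inner ℂ (b p.1 p.2) (x p.1))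
    (p : ι × κ) :
    ∃ h : B p ∈ (directSumOp fun i => diagonalOp (b i) (c i)).domain,
      directSumOp (fun i => diagonalOp (b i) (c i)) ⟨B p, h⟩ = (c p.1 p.2 : ℂ) • B p := by
  have hi : ∀ i, ∃ h : B p i ∈ (diagonalOp (b i) (c i)).domain,
      diagonalOp (b i) (c i) ⟨B p i, h⟩ = (c p.1 p.2 : ℂ) • B p i := by
    intro i
    rw [hBs]
    by_cases h : p.1 = i
    · subst h
      simp only [lp.single_apply_self]
      exact basis_mem_diagonalOp_domain (b p.1) (c p.1) p.2
    · simp only [lp.single_apply_ne _ _ _ (Ne.symm h)]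
      exact ⟨Submodule.zero_mem _, by rw [smul_zero]; exact (diagonalOp (b i) (c i)).map_zero⟩
  have hmem : B p ∈ (directSumOp fun i => diagonalOp (b i) (c i)).domain := by
    refine ⟨fun i => (hi i).choose, ?_⟩
    have h : (fun i => diagonalOp (b i) (c i) ⟨B p i, (hi i).choose⟩) =
        fun i => (c p.1 p.2 : ℂ) • B p i := funext fun i => (hi i).choose_spec
    rw [h]
    exact (lp.memℓp (B p)).const_smul _
  refine ⟨hmem, ext_inner_basis B fun q => ?_⟩
  rw [inner_directSumOp_diagonal b c hB, inner_smul_right, orthonormal_iff_ite.1 B.orthonormal]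
  split_ifs with h
  · rw [h]
  · simp

end DirectSumBasis

/-! ### The eigenbasis of `D_α` -/

section GasketBasis

variable (α : Set.Ioo (0 : ℝ) (1 / 3))

/-- The basis of `⨁ L²([-L(ε), L(ε)])` that consists of the exponentials `exp (iπkx/L(ε))`. -/
def gasketBasis : HilbertBasis (Edge × ℤ) ℂ (GasketSpace α) :=
  (exists_directSumBasis fun e : Edge => fourierBasis (T := 2 * edgeLength α e)).choose

open Classical in
theorem gasketBasis_apply (p : Edge × ℤ) :
    gasketBasis α p = lp.single 2 p.1 (fourierBasis (T := 2 * edgeLength α p.1) p.2) :=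
  (exists_directSumBasis fun e : Edge => fourierBasis (T := 2 * edgeLength α e)).choose_spec p

theorem inner_gasketBasis (p : Edge × ℤ) (x : GasketSpace α) :
    inner ℂ (gasketBasis α p) x =
      inner ℂ (fourierBasis (T := 2 * edgeLength α p.1) p.2) (x p.1) := by
  classical
  rw [gasketBasis_apply, lp.inner_single_left]

/-- The eigenvalues of `D_α`. -/
def diracEigenvalue (p : Edge × ℤ) : ℝ := (2 * p.2 + 1) * Real.pi / (2 * edgeLength α p.1)

theorem inner_functionOf_gasketDirac {g : ℝ → ℝ} {B : ℝ}
    (hg : ∀ p, |g (diracEigenvalue α p)| ≤ B) (x : GasketSpace α) (p : Edge × ℤ) :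
    inner ℂ (gasketBasis α p) (functionOf (gasketDirac α) g x) =
      (g (diracEigenvalue α p) : ℂ) * inner ℂ (gasketBasis α p) x :=
  inner_functionOf (gasketBasis α) (c := diracEigenvalue α)
    (fun p => basis_mem_directSumOp_domain (fun _ => fourierBasis)
      (fun e (k : ℤ) => (2 * k + 1) * Real.pi / (2 * edgeLength α e)) (gasketBasis_apply α)
      (inner_gasketBasis α) p)
    (fun x p => inner_directSumOp_diagonal (fun _ => fourierBasis)
      (fun e (k : ℤ) => (2 * k + 1) * Real.pi / (2 * edgeLength α e)) (inner_gasketBasis α) x p)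
    hg x p

end GasketBasis

/-! ### Logarithmic averages over words -/

section WordSums

/-- The number of `n` with `3 ^ n < x`. -/
def powCount (x : ℝ) : ℕ := ⌈Real.logb 3 x⌉₊

theorem lt_powCount_iff {x : ℝ} (hx : 0 < x) {n : ℕ} : n < powCount x ↔ (3 : ℝ) ^ n < x := by
  rw [powCount, Nat.lt_ceil, Real.lt_logb_iff_rpow_lt (by norm_num) hx, Real.rpow_natCast]

/-- The last power in the sum is below `x`, and a geometric sum of ratio `3` is less than `3 / 2`
times its last term. This factor enters the bound on the number of eigenvalues above `t`. -/
theorem sum_pow_powCount_le {x : ℝ} (hx : 0 < x) :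
    ∑ n ∈ Finset.range (powCount x), (3 : ℝ) ^ n ≤ 3 / 2 * x := by
  rw [geom_sum_eq (by norm_num)]
  rcases Nat.eq_zero_or_pos (powCount x) with h | h
  · rw [h]
    norm_num
    positivity
  · obtain ⟨n, hn⟩ := Nat.exists_eq_succ_of_ne_zero h.ne'
    have h1 := (lt_powCount_iff hx).1 (show n < powCount x by omega)
    rw [hn, pow_succ]
    linarith

theorem powCount_mono {x y : ℝ} (hx : 0 < x) (hxy : x ≤ y) : powCount x ≤ powCount y :=
  Nat.ceil_le_ceil (Real.logb_le_logb_of_le (by norm_num) hx hxy)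

/-- The count differs from `-log t / log 3` by a bounded amount: `log x / log 3`, plus at most `1`
for rounding up. -/
theorem tendsto_powCount_div_neg_log {x : ℝ} (hx : 0 < x) :
    Tendsto (fun t : ℝ => (powCount (x / t) : ℝ) / -Real.log t) (𝓝[>] 0) (𝓝 (1 / Real.log 3)) := by
  have h3 : 0 < Real.log 3 := Real.log_pos (by norm_num)
  have hlog : Tendsto (fun t : ℝ => -Real.log t) (𝓝[>] 0) atTop :=
    tendsto_neg_atBot_atTop.comp Real.tendsto_log_nhdsGT_zero
  have hone : ∀ a : ℝ, Tendsto (fun t : ℝ => (1 / Real.log 3) + a / -Real.log t) (𝓝[>] 0)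
      (𝓝 (1 / Real.log 3)) := fun a => by
    simpa using (tendsto_const_nhds.div_atTop hlog).const_add (1 / Real.log 3)
  have hev : ∀ᶠ t : ℝ in 𝓝[>] 0, 0 < t ∧ t < 1 ∧ t < x := by
    filter_upwards [self_mem_nhdsWithin, nhdsWithin_le_nhds (gt_mem_nhds one_pos),
      nhdsWithin_le_nhds (gt_mem_nhds hx)] with t h1 h2 h3
    exact ⟨h1, h2, h3⟩
  have hlb : ∀ t : ℝ, 0 < t → t < 1 → Real.logb 3 (x / t) / -Real.log t =
      1 / Real.log 3 + (Real.log x / Real.log 3) / -Real.log t := by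
    intro t h0 h1
    have : Real.log t < 0 := Real.log_neg h0 h1
    rw [Real.logb, Real.log_div hx.ne' h0.ne', div_add_div _ _ h3.ne' (by linarith), div_div,
      div_eq_div_iff (mul_ne_zero h3.ne' (by linarith)) (mul_ne_zero h3.ne' (by linarith))]
    field_simp
    ring
  refine tendsto_of_tendsto_of_tendsto_of_le_of_le' (hone (Real.log x / Real.log 3))
    (hone (Real.log x / Real.log 3 + 1)) ?_ ?_
  · filter_upwards [hev] with t ht
    have hneg : 0 < -Real.log t := by linarith [Real.log_neg ht.1 ht.2.1]
    rw [← hlb t ht.1 ht.2.1]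
    gcongr
    exact Nat.le_ceil _
  · filter_upwards [hev] with t ht
    have hneg : 0 < -Real.log t := by linarith [Real.log_neg ht.1 ht.2.1]
    rw [add_div, ← add_assoc, ← hlb t ht.1 ht.2.1, ← add_div]
    gcongr
    refine (Nat.ceil_lt_add_one ?_).le
    exact Real.logb_nonneg (by norm_num) ((one_le_div ht.1).2 ht.2.2.le)

theorem tendsto_powCount {x : ℝ} (hx : 0 < x) :
    Tendsto (fun t : ℝ => powCount (x / t)) (𝓝[>] 0) atTop := by
  have hlog : Tendsto (fun t : ℝ => -Real.log t) (𝓝[>] 0) atTop :=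
    tendsto_neg_atBot_atTop.comp Real.tendsto_log_nhdsGT_zero
  have h := (tendsto_powCount_div_neg_log hx).pos_mul_atTop
    (one_div_pos.2 (Real.log_pos (by norm_num))) hlog
  rw [← tendsto_natCast_atTop_iff (R := ℝ)]
  refine h.congr' ?_
  filter_upwards [hlog.eventually_gt_atTop 0] with t ht
  exact div_mul_cancel₀ _ ht.ne'

/-- The words in three letters, sorted by their length. -/
abbrev SizedWord : Type := Σ n : ℕ, Fin n → Fin 3

variable {J : Type*} {q : J → ℝ}

/-- The family that takes each value `3⁻ⁿ q j` once for every word of length `n`. -/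
def wordFamily (q : J → ℝ) (x : SizedWord × J) : ℝ := ((3 : ℝ) ^ x.1.1)⁻¹ * q x.2

theorem lt_wordFamily_iff (hq : ∀ j, 0 < q j) {t : ℝ} (ht : 0 < t) (x : SizedWord × J) :
    t < wordFamily q x ↔ x.1.1 < powCount (q x.2 / t) := by
  have h3 : (0 : ℝ) < 3 ^ x.1.1 := by positivity
  rw [lt_powCount_iff (div_pos (hq _) ht), wordFamily, lt_inv_mul_iff₀ h3, lt_div_iff₀ ht]

theorem finite_lt_wordFamily (hq : ∀ j, 0 < q j) (hs : Summable q) {t : ℝ} (ht : 0 < t) :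
    {x | t < wordFamily q x}.Finite := by
  have hJ : {j | t < q j}.Finite := by
    have := hs.tendsto_cofinite_zero.eventually (gt_mem_nhds ht)
    refine Set.Finite.subset this ?_
    intro j hj h
    exact lt_asymm (show q j < t from h) hj
  have hW : {w : SizedWord | w.1 < powCount ((∑' j, q j) / t)}.Finite := by
    refine Set.Finite.subset ((Finset.range (powCount ((∑' j, q j) / t))).sigma
      fun n => (Finset.univ : Finset (Fin n → Fin 3))).finite_toSet ?_
    intro w hw
    simpa using hw
  refine (hW.prod hJ).subset fun x hx => ?_
  have hx' := (lt_wordFamily_iff hq ht x).1 hx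
  refine ⟨?_, ?_⟩
  · refine hx'.trans_le (powCount_mono (div_pos (hq _) ht) ?_)
    gcongr
    exact hs.le_tsum x.2 fun j _ => (hq j).le
  · refine lt_of_lt_of_le (show t < wordFamily q x from hx) ?_
    exact mul_le_of_le_one_left (hq _).le (inv_le_one_of_one_le₀ (one_le_pow₀ (by norm_num)))

/-- For fixed `j` the condition `t < 3⁻ⁿ q j` depends on the word only through its length and reads
`n < powCount (q j / t)`. So complete levels are summed. -/
theorem tsum_indicator_lt_wordFamily (hq : ∀ j, 0 < q j) (hs : Summable q) {t : ℝ} (ht : 0 < t)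
    (F : SizedWord × J → ℝ) :
    HasSum (fun j => ∑ n ∈ Finset.range (powCount (q j / t)), ∑ w : Fin n → Fin 3, F (⟨n, w⟩, j))
      (∑' x, {x | t < wordFamily q x}.indicator F x) := by
  have hfin := finite_lt_wordFamily hq hs ht
  have hsum : Summable ({x | t < wordFamily q x}.indicator F) :=
    summable_of_hasFiniteSupport (hfin.subset Set.support_indicator_subset)
  have h1 := ((Equiv.prodComm J SizedWord).hasSum_iff.2 hsum.hasSum)
  refine h1.prod_fiberwise fun j => ?_
  have hset : ∀ w : SizedWord, ({x | t < wordFamily q x}.indicator F ∘ Equiv.prodComm J SizedWord)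
      (j, w) = if w.1 < powCount (q j / t) then F (w, j) else 0 := by
    intro w
    simp only [Function.comp_apply, Equiv.prodComm_apply, Prod.swap_prod_mk]
    rw [Set.indicator_apply]
    exact if_congr (lt_wordFamily_iff hq ht (w, j)) rfl rfl
  simp_rw [hset]
  have h2 := hasSum_sum_of_ne_finset_zero (L := SummationFilter.unconditional _)
    (f := fun w : SizedWord => if w.1 < powCount (q j / t) then F (w, j) else 0)
    (s := (Finset.range (powCount (q j / t))).sigma fun n => (Finset.univ : Finset (Fin n → Fin 3)))
    fun w hw => if_neg (by simpa using hw)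
  convert h2 using 1
  rw [Finset.sum_sigma]
  refine Finset.sum_congr rfl fun n hn => Finset.sum_congr rfl fun w _ => ?_
  rw [if_pos (Finset.mem_range.1 hn)]

theorem ncard_lt_wordFamily_le (hq : ∀ j, 0 < q j) (hs : Summable q) {t : ℝ} (ht : 0 < t) :
    ({x | t < wordFamily q x}.ncard : ℝ) ≤ (3 / 2 * ∑' j, q j) / t := by
  have hfin := finite_lt_wordFamily hq hs ht
  have h := tsum_indicator_lt_wordFamily hq hs ht fun _ => 1
  have h1 : ∑' x, {x | t < wordFamily q x}.indicator (fun _ => (1 : ℝ)) x =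
      ({x | t < wordFamily q x}.ncard : ℝ) := by
    rw [tsum_eq_sum (s := hfin.toFinset) fun x hx =>
      Set.indicator_of_notMem (by simpa using hx) _,
      Finset.sum_congr rfl fun x hx => Set.indicator_of_mem (by simpa using hx) _,
      Set.ncard_eq_toFinset_card _ hfin]
    simp
  rw [h1] at h
  rw [mul_div_assoc]
  refine hasSum_le (fun j => ?_) h ((hs.hasSum.div_const t).mul_left (3 / 2))
  refine le_trans (le_of_eq ?_) (sum_pow_powCount_le (div_pos (hq j) ht))
  refine Finset.sum_congr rfl fun n _ => ?_
  simp

/-- If the averages of `g` over the words of length `n` converge, then the truncated sums of `g`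
against the family `3⁻ⁿ q j` grow logarithmically. -/
theorem tendsto_truncSum_wordFamily (hq : ∀ j, 0 < q j) (hs : Summable q)
    {g : SizedWord × J → ℝ} {B : ℝ} (hg : ∀ x, |g x| ≤ B) {L : ℝ}
    (hL : ∀ j, Tendsto (fun n : ℕ => ((3 : ℝ) ^ n)⁻¹ * ∑ w : Fin n → Fin 3, g (⟨n, w⟩, j)) atTop
      (𝓝 L)) :
    Tendsto (fun t => truncSum (wordFamily q) g t / -Real.log t) (𝓝[>] 0)
      (𝓝 ((∑' j, q j) * (L / Real.log 3))) := by
  -- The sign of `B` can only be read off from a value of `g`, so an empty `J` is treated apart.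
  have hB : 0 ≤ B ∨ IsEmpty J := by
    rcases isEmpty_or_nonempty J with h | ⟨⟨j⟩⟩
    · exact Or.inr h
    · exact Or.inl ((abs_nonneg _).trans (hg (⟨0, Fin.elim0⟩, j)))
  rcases hB with hB | hJ
  swap
  · have : ∀ t, truncSum (wordFamily q) g t = 0 := fun t => by
      rw [truncSum, tsum_empty]
    simp [this]
  set avg : ℕ → J → ℝ := fun n j => ((3 : ℝ) ^ n)⁻¹ * ∑ w : Fin n → Fin 3, g (⟨n, w⟩, j) with havg
  have havgB : ∀ n j, |avg n j| ≤ B := by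
    intro n j
    rw [havg]
    simp only
    rw [abs_mul, abs_of_pos (by positivity), inv_mul_le_iff₀ (by positivity)]
    refine (Finset.abs_sum_le_sum_abs _ _).trans ((Finset.sum_le_sum fun w _ => hg _).trans_eq ?_)
    simp
  -- The weight `3⁻ⁿ` turns the sum over each level into an average.
  have hform : ∀ᶠ t : ℝ in 𝓝[>] 0, ∑' j, q j * ((∑ n ∈ Finset.range (powCount (q j / t)), avg n j)
      / -Real.log t) = truncSum (wordFamily q) g t / -Real.log t := by
    filter_upwards [self_mem_nhdsWithin] with t ht
    have h := (tsum_indicator_lt_wordFamily hq hs ht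
      fun x => g x * wordFamily q x).div_const (-Real.log t)
    rw [truncSum, ← h.tsum_eq]
    congr 1
    funext j
    rw [← mul_div_assoc, Finset.mul_sum]
    congr 1
    refine Finset.sum_congr rfl fun n _ => ?_
    simp only [havg, wordFamily]
    rw [mul_left_comm, Finset.mul_sum, Finset.mul_sum]
    refine Finset.sum_congr rfl fun w _ => ?_
    ring
  refine Tendsto.congr' hform ?_
  rw [← tsum_mul_right]
  set Q := ∑' j, q j
  rcases isEmpty_or_nonempty J with hJ | ⟨⟨j₀⟩⟩
  · simp
  have hqQ : ∀ j, q j ≤ Q := fun j => hs.le_tsum j fun j _ => (hq j).le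
  have hQ : 0 < Q := (hq j₀).trans_le (hqQ j₀)
  refine tendsto_tsum_of_dominated_convergence
    (bound := fun j => q j * (B * (1 / Real.log 3 + 1))) (hs.mul_right _) (fun j => ?_) ?_
  · refine Tendsto.const_mul (q j) ?_
    -- For fixed `j`, Cesàro means of the level averages, taken over `powCount (q j / t)` levels,
    -- tend to `L`.
    have h1 := (hL j).cesaro.comp (tendsto_powCount (hq j))
    have h2 := h1.mul (tendsto_powCount_div_neg_log (hq j))
    rw [mul_one_div] at h2
    refine h2.congr' ?_
    filter_upwards [(tendsto_powCount (hq j)).eventually_ge_atTop 1] with t ht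
    have : (0 : ℝ) < powCount (q j / t) := by exact_mod_cast ht
    simp only [Function.comp_apply, havg]
    rw [inv_mul_eq_div, div_mul_div_cancel₀ this.ne']
  · have h1 : ∀ᶠ t : ℝ in 𝓝[>] 0, (powCount (Q / t) : ℝ) / -Real.log t < 1 / Real.log 3 + 1 :=
      (tendsto_powCount_div_neg_log hQ).eventually (gt_mem_nhds (by linarith))
    filter_upwards [h1, self_mem_nhdsWithin, nhdsWithin_le_nhds (gt_mem_nhds one_pos)]
      with t ht ht0 ht1 j
    have ht0 : 0 < t := ht0
    have hneg : 0 < -Real.log t := by linarith [Real.log_neg ht0 ht1]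
    rw [Real.norm_eq_abs, abs_mul, abs_of_pos (hq j), abs_div, abs_of_pos hneg]
    refine mul_le_mul_of_nonneg_left ?_ (hq j).le
    have h2 : |∑ n ∈ Finset.range (powCount (q j / t)), avg n j| ≤ B * powCount (Q / t) := by
      refine (Finset.abs_sum_le_sum_abs _ _).trans ((Finset.sum_le_sum fun n _ =>
        havgB n j).trans ?_)
      rw [Finset.sum_const, Finset.card_range, nsmul_eq_mul, mul_comm]
      refine mul_le_mul_of_nonneg_left ?_ hB
      have : q j / t ≤ Q / t := by gcongr; exact hqQ j
      exact_mod_cast powCount_mono (div_pos (hq j) ht0) this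
    calc |∑ n ∈ Finset.range (powCount (q j / t)), avg n j| / -Real.log t
        ≤ B * powCount (Q / t) / -Real.log t := by gcongr
      _ = B * (powCount (Q / t) / -Real.log t) := mul_div_assoc _ _ _
      _ ≤ B * (1 / Real.log 3 + 1) := mul_le_mul_of_nonneg_left ht.le hB

end WordSums

/-! ### The lengths of the edges -/

section Lengths

/-- The solution `d` of `3 * ((1 - α) / 2) ^ d = 1`. -/
def gasketDim (α : ℝ) : ℝ := Real.log 3 / -Real.log ((1 - α) / 2)

variable (α : Set.Ioo (0 : ℝ) (1 / 3))

theorem ratio_pos : 0 < (1 - (α : ℝ)) / 2 := by linarith [α.2.2]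

theorem ratio_lt_one : (1 - (α : ℝ)) / 2 < 1 := by linarith [α.2.1]

theorem neg_log_ratio_pos : 0 < -Real.log ((1 - (α : ℝ)) / 2) := by
  linarith [Real.log_neg (ratio_pos α) (ratio_lt_one α)]

/-- Equivalent to `(1 - α) / 2 > 1 / 3`, that is, to `α < 1 / 3`. It makes the sum over Fourier
modes converge and makes segments null. -/
theorem one_lt_gasketDim : 1 < gasketDim α := by
  rw [gasketDim, one_lt_div (neg_log_ratio_pos α), ← Real.log_inv]
  refine Real.log_lt_log (inv_pos.2 (ratio_pos α)) ?_
  rw [inv_lt_comm₀ (ratio_pos α) (by norm_num)]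
  linarith [α.2.2]

theorem ratio_rpow_gasketDim : ((1 - (α : ℝ)) / 2) ^ gasketDim α = 3⁻¹ := by
  rw [Real.rpow_def_of_pos (ratio_pos α), gasketDim, mul_div_assoc', div_neg, mul_comm,
    mul_div_cancel_right₀ _ (by linarith [neg_log_ratio_pos α]), Real.exp_neg,
    Real.exp_log (by norm_num)]

theorem dist_F_corner (i : Fin 3) (x y : Plane) :
    dist (F α (Fin.castAdd 3 i) x) (F α (Fin.castAdd 3 i) y) = (1 - (α : ℝ)) / 2 * dist x y := by
  rw [F_corner, F_corner, dist_add_left, dist_smul₀, dist_sub_right, Real.norm_of_nonneg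
    (ratio_pos α).le]

theorem dist_wordMap (w : List (Fin 3)) (x y : Plane) :
    dist (wordMap α w x) (wordMap α w y) = ((1 - (α : ℝ)) / 2) ^ w.length * dist x y := by
  induction w with
  | nil => simp [wordMap]
  | cons i w ih =>
    simp only [wordMap, Function.comp_apply, List.length_cons]
    rw [dist_F_corner, ih, pow_succ']
    ring

theorem dist_vtx (i : Fin 3) : dist (vtx (i + 1)) (vtx (i + 2)) = 1 := by
  have h3 : √3 ^ 2 = 3 := Real.sq_sqrt (by norm_num)
  rw [EuclideanSpace.dist_eq, Fin.sum_univ_two, Real.sqrt_eq_one]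
  fin_cases i <;> simp [vtx, pt, Real.dist_eq, sq_abs, div_pow] <;> nlinarith

theorem edgeLength_tri (w : List (Fin 3)) (i : Fin 3) :
    edgeLength α (.tri w i) = ((1 - (α : ℝ)) / 2) ^ w.length := by
  rw [edgeLength, edgeStart, edgeEnd]
  simp only [edgeMap, Edge.side]
  rw [dist_wordMap, dist_vtx, mul_one]

theorem edgeLength_join (w : List (Fin 3)) (i : Fin 3) :
    edgeLength α (.join w i) = α * ((1 - (α : ℝ)) / 2) ^ w.length := by
  have h0 := F_side α i 0
  have h1 := F_side α i 1
  simp only [zero_smul, add_zero, one_smul, add_sub_cancel, mul_zero, mul_one] at h0 h1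
  rw [edgeLength, edgeStart, edgeEnd]
  simp only [edgeMap, Edge.side]
  rw [dist_wordMap, h0, h1, dist_add_left, dist_eq_norm, ← sub_smul, norm_smul,
    ← dist_eq_norm (vtx (i + 2)), dist_comm (vtx (i + 2)), dist_vtx]
  rw [sub_add_cancel_left, norm_neg, Real.norm_of_nonneg α.2.1.le]
  ring

end Lengths

/-! ### The eigenvalues of `D_α`, sorted by word length -/

section Eigenvalues

/-- An edge is given by a word, its kind (`true` for joining edges), and a side. -/
def edgeEquiv : List (Fin 3) × (Bool × Fin 3) ≃ Edge where
  toFun x := bif x.2.1 then .join x.1 x.2.2 else .tri x.1 x.2.2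
  invFun
    | .tri w i => (w, false, i)
    | .join w i => (w, true, i)
  left_inv := by rintro ⟨w, _ | _, i⟩ <;> rfl
  right_inv := by rintro (⟨w, i⟩ | ⟨w, i⟩) <;> rfl

/-- The index set of the eigenbasis, sorted by word length. -/
def indexEquiv : SizedWord × ((Bool × Fin 3) × ℤ) ≃ Edge × ℤ :=
  (Equiv.prodAssoc _ _ _).symm.trans
    ((((List.equivSigmaTuple (α := Fin 3)).symm.prodCongr (Equiv.refl _)).trans edgeEquiv).prodCongr
      (Equiv.refl ℤ))

theorem indexEquiv_apply (n : ℕ) (w : Fin n → Fin 3) (s : Bool) (i : Fin 3) (k : ℤ) :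
    indexEquiv (⟨n, w⟩, ((s, i), k)) = (edgeEquiv (List.ofFn w, (s, i)), k) := rfl

variable (α : Set.Ioo (0 : ℝ) (1 / 3))

/-- The length of the two kinds of edges at level `0`. -/
def edgeScale (s : Bool) : ℝ := bif s then α else 1

theorem edgeScale_pos (s : Bool) : 0 < edgeScale α s := by
  cases s
  · exact one_pos
  · exact α.2.1

theorem edgeLength_edgeEquiv (w : List (Fin 3)) (s : Bool) (i : Fin 3) :
    edgeLength α (edgeEquiv (w, (s, i))) = edgeScale α s * ((1 - (α : ℝ)) / 2) ^ w.length := by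
  cases s
  · exact (edgeLength_tri α w i).trans (one_mul _).symm
  · exact edgeLength_join α w i

/-- The numbers `|λ| ^ (-p)`, where `λ` runs over the eigenvalues that belong to the empty word. -/
def edgeWeight (p : ℝ) (j : (Bool × Fin 3) × ℤ) : ℝ :=
  edgeScale α j.1.1 ^ p * ((2 / Real.pi) ^ p * |2 * (j.2 : ℝ) + 1| ^ (-p))

theorem abs_two_mul_add_one_pos (k : ℤ) : 0 < |2 * (k : ℝ) + 1| := by
  rw [abs_pos]
  intro h
  have : (2 * k + 1 : ℤ) = 0 := by exact_mod_cast h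
  omega

theorem edgeWeight_pos (p : ℝ) (j : (Bool × Fin 3) × ℤ) : 0 < edgeWeight α p j := by
  have h1 := edgeScale_pos α j.1.1
  have h2 := abs_two_mul_add_one_pos j.2
  have h3 := Real.pi_pos
  unfold edgeWeight
  positivity

theorem abs_diracEigenvalue_rpow (p : ℝ) (x : SizedWord × ((Bool × Fin 3) × ℤ)) :
    |diracEigenvalue α (indexEquiv x)| ^ (-p) =
      (((1 - (α : ℝ)) / 2) ^ p) ^ x.1.1 * edgeWeight α p x.2 := by
  obtain ⟨⟨n, w⟩, ⟨s, i⟩, k⟩ := x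
  have h1 := edgeScale_pos α s
  have h2 := abs_two_mul_add_one_pos k
  have h3 := Real.pi_pos
  have hr := ratio_pos α
  rw [diracEigenvalue, indexEquiv_apply]
  simp only
  rw [edgeLength_edgeEquiv, List.length_ofFn, edgeWeight]
  simp only
  set r := (1 - (α : ℝ)) / 2
  set a := edgeScale α s
  have h4 : |(2 * (k : ℝ) + 1) * Real.pi / (2 * (a * r ^ n))| =
      (r ^ n)⁻¹ * (a⁻¹ * ((2 / Real.pi)⁻¹ * |2 * (k : ℝ) + 1|)) := by
    rw [abs_div, abs_mul, abs_of_pos h3, abs_of_pos (by positivity : 0 < 2 * (a * r ^ n))]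
    field_simp
  rw [h4, Real.mul_rpow (by positivity) (by positivity), Real.mul_rpow (by positivity) (by positivity),
    Real.mul_rpow (by positivity) (by positivity), Real.rpow_neg (by positivity),
    Real.rpow_neg (by positivity), Real.rpow_neg (by positivity), Real.inv_rpow (by positivity),
    Real.inv_rpow (by positivity), Real.inv_rpow (by positivity), inv_inv, inv_inv, inv_inv,
    ← Real.rpow_natCast, ← Real.rpow_natCast, ← Real.rpow_mul hr.le, ← Real.rpow_mul hr.le,
    mul_comm p]

theorem summable_abs_two_mul_add_one_rpow {p : ℝ} (hp : 1 < p) :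
    Summable fun k : ℤ => |2 * (k : ℝ) + 1| ^ (-p) := by
  have h : Summable fun n : ℕ => (2 * (n : ℝ) + 1) ^ (-p) := by
    have h1 : Summable fun n : ℕ => ((n : ℝ)) ^ (-p) := Real.summable_nat_rpow.2 (by linarith)
    have h2 := h1.comp_injective (i := fun n : ℕ => 2 * n + 1) fun a b h => by
      simpa using h
    refine h2.congr fun n => ?_
    simp
  refine Summable.of_nat_of_neg_add_one (h.congr fun n => ?_) (h.congr fun n => ?_)
  · rw [abs_of_pos (by push_cast; positivity)]; push_cast; rfl
  · rw [show 2 * ((-((n : ℤ) + 1) : ℤ) : ℝ) + 1 = -(2 * (n : ℝ) + 1) by push_cast; ring, abs_neg,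
      abs_of_pos (by positivity)]

theorem hasSum_edgeWeight {p : ℝ} (hp : 1 < p) :
    HasSum (edgeWeight α p)
      ((3 + 3 * (α : ℝ) ^ p) * ((2 / Real.pi) ^ p * ∑' k : ℤ, |2 * (k : ℝ) + 1| ^ (-p))) := by
  have h1 := (summable_abs_two_mul_add_one_rpow hp).mul_left ((2 / Real.pi) ^ p)
  have h2 : HasSum (fun j : Bool × Fin 3 => edgeScale α j.1 ^ p) (3 + 3 * (α : ℝ) ^ p) := by
    convert hasSum_fintype (fun j : Bool × Fin 3 => edgeScale α j.1 ^ p) using 1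
    simp [Fintype.sum_prod_type, edgeScale, add_comm]
  rw [← tsum_mul_left]
  refine h2.mul h1.hasSum ?_
  refine h2.summable.mul_of_nonneg h1 (fun j => ?_) fun k => ?_
  · exact (Real.rpow_pos_of_pos (edgeScale_pos α _) p).le
  · have h3 := Real.pi_pos
    simp only [Pi.zero_apply]
    positivity

theorem summable_edgeWeight {p : ℝ} (hp : 1 < p) : Summable (edgeWeight α p) :=
  (hasSum_edgeWeight α hp).summable

/-- At the exponent `gasketDim α` the decay `3⁻ⁿ` balances the number of words of length `n`
exactly; this is the source of the logarithmic growth. -/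
theorem abs_diracEigenvalue_rpow_gasketDim (x : SizedWord × ((Bool × Fin 3) × ℤ)) :
    |diracEigenvalue α (indexEquiv x)| ^ (-gasketDim α) =
      wordFamily (edgeWeight α (gasketDim α)) x := by
  rw [abs_diracEigenvalue_rpow, ratio_rpow_gasketDim, wordFamily, inv_pow]

theorem summable_sizedWord_pow {ρ : ℝ} (hρ : 0 ≤ ρ) (h3 : 3 * ρ < 1) :
    Summable fun w : SizedWord => ρ ^ w.1 := by
  rw [summable_sigma_of_nonneg fun w => by positivity]
  refine ⟨fun n => Summable.of_finite, ?_⟩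
  refine (summable_geometric_of_lt_one (by positivity) h3).congr fun n => ?_
  simp [mul_pow]

theorem one_add_sq_rpow_le (c : ℝ) {p : ℝ} (hp : 0 < p) (hc : c ≠ 0) :
    (1 + c ^ 2) ^ (-p / 2) ≤ |c| ^ (-p) := by
  have h : |c| ^ (-p) = (c ^ 2) ^ (-p / 2) := by
    rw [← sq_abs, ← Real.rpow_natCast, ← Real.rpow_mul (abs_nonneg c)]
    congr 1
    push_cast
    ring
  rw [h]
  exact Real.rpow_le_rpow_of_nonpos (by positivity) (by linarith) (by linarith)

theorem diracEigenvalue_ne_zero (p : Edge × ℤ) : diracEigenvalue α p ≠ 0 := by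
  have h1 := abs_pos.1 (abs_two_mul_add_one_pos p.2)
  have h2 := edgeLength_pos α p.1
  have h3 := Real.pi_pos
  unfold diracEigenvalue
  positivity

/-- For `p` above the dimension, compare with `|λ|^{-p}`, whose sum is geometric of ratio `3 r ^ p <
1` in the word length. For `p` at most the dimension, one side and the mode `k = 0` already give
level sums bounded away from `0`. -/
theorem summable_one_add_sq_iff {p : ℝ} (hp : 0 < p) :
    Summable (fun x => (1 + diracEigenvalue α x ^ 2) ^ (-p / 2)) ↔ gasketDim α < p := by
  have hr := ratio_pos α
  have hr1 := ratio_lt_one α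
  have hd := one_lt_gasketDim α
  constructor
  · intro hs
    by_contra! hle
    have h1 : Summable fun w : SizedWord =>
        (1 + diracEigenvalue α (indexEquiv (w, ((false, 0), 0))) ^ 2) ^ (-p / 2) :=
      hs.comp_injective (i := fun w : SizedWord => indexEquiv (w, ((false, 0), 0)))
        fun a b h => (Prod.ext_iff.1 (indexEquiv.injective h)).1
    have h2 := h1.sigma.tendsto_atTop_zero
    -- The eigenvalue in question is `(π / 2) r⁻ⁿ`, and `1 + λ² ≤ A r⁻²ⁿ` because `r ≤ 1`.
    set A : ℝ := 1 + (Real.pi / 2) ^ 2 with hA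
    have hApos : 0 < A := by positivity
    have h3 : ∀ n : ℕ, A ^ (-p / 2) ≤ ∑' w : Fin n → Fin 3,
        (1 + diracEigenvalue α (indexEquiv (⟨n, w⟩, ((false, 0), 0))) ^ 2) ^ (-p / 2) := by
      intro n
      set r := (1 - (α : ℝ)) / 2 with hrdef
      have h4 : ∀ w : Fin n → Fin 3, ((3 : ℝ) ^ n)⁻¹ * A ^ (-p / 2) ≤
          (1 + diracEigenvalue α (indexEquiv (⟨n, w⟩, ((false, 0), 0))) ^ 2) ^ (-p / 2) := by
        intro w
        have h5 : diracEigenvalue α (indexEquiv (⟨n, w⟩, ((false, 0), 0))) =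
            (Real.pi / 2) * (r ^ n)⁻¹ := by
          rw [diracEigenvalue, indexEquiv_apply]
          simp only
          rw [edgeLength_edgeEquiv, List.length_ofFn, edgeScale, ← hrdef]
          simp
          field_simp
        have h6 : 1 + ((Real.pi / 2) * (r ^ n)⁻¹) ^ 2 ≤ A * ((r ^ n)⁻¹) ^ 2 := by
          have : 1 ≤ ((r ^ n)⁻¹) ^ 2 :=
            one_le_pow₀ (one_le_inv_iff₀.2 ⟨by positivity, pow_le_one₀ hr.le hr1.le⟩)
          rw [hA, mul_pow]
          nlinarith
        have h7 : (((r ^ n)⁻¹) ^ 2) ^ (-p / 2) = (r ^ p) ^ n := by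
          rw [← Real.rpow_natCast, ← Real.rpow_mul (by positivity), Real.inv_rpow (by positivity),
            ← Real.rpow_neg (by positivity), ← Real.rpow_natCast, ← Real.rpow_natCast,
            ← Real.rpow_mul hr.le, ← Real.rpow_mul hr.le]
          congr 1
          push_cast
          ring
        have h8 : (3 : ℝ)⁻¹ ≤ r ^ p := by
          rw [← ratio_rpow_gasketDim α]
          exact Real.rpow_le_rpow_of_exponent_ge hr hr1.le hle
        rw [h5]
        calc ((3 : ℝ) ^ n)⁻¹ * A ^ (-p / 2) ≤ (r ^ p) ^ n * A ^ (-p / 2) := by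
              rw [← inv_pow]; gcongr
          _ = (A * ((r ^ n)⁻¹) ^ 2) ^ (-p / 2) := by
              rw [Real.mul_rpow hApos.le (by positivity), h7, mul_comm]
          _ ≤ _ := Real.rpow_le_rpow_of_nonpos (by positivity) h6 (by linarith)
      rw [tsum_fintype]
      refine le_trans (le_of_eq ?_) (Finset.sum_le_sum fun w _ => h4 w)
      rw [Finset.sum_const, Finset.card_univ, nsmul_eq_mul]
      simp
    have h9 := ge_of_tendsto' h2 h3
    exact absurd h9 (not_le.2 (Real.rpow_pos_of_pos hApos _))
  · intro hlt
    have h1 : Summable fun x => |diracEigenvalue α (indexEquiv x)| ^ (-p) := by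
      simp_rw [abs_diracEigenvalue_rpow]
      refine Summable.mul_of_nonneg (f := fun w : SizedWord => (((1 - (α : ℝ)) / 2) ^ p) ^ w.1)
        (g := edgeWeight α p) (summable_sizedWord_pow (by positivity) ?_)
        (summable_edgeWeight α (hd.trans hlt)) (fun w => by simp only [Pi.zero_apply]; positivity)
        fun j => (edgeWeight_pos α p j).le
      have := Real.rpow_lt_rpow_of_exponent_gt hr hr1 hlt
      rw [ratio_rpow_gasketDim] at this
      linarith
    have h2 : Summable fun x => |diracEigenvalue α x| ^ (-p) := indexEquiv.summable_iff.1 h1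
    exact Summable.of_nonneg_of_le (fun x => by positivity)
      (fun x => one_add_sq_rpow_le _ hp (diracEigenvalue_ne_zero α x)) h2

theorem spectralDimension_gasketDirac : spectralDimension (gasketDirac α) = gasketDim α := by
  have hset : {p : ℝ | 0 < p ∧ HasFiniteTrace (functionOf (gasketDirac α) fun c =>
      (1 + c ^ 2) ^ (-p / 2))} = Set.Ioi (gasketDim α) := by
    ext p
    have hd := one_lt_gasketDim α
    have key : 0 < p → (HasFiniteTrace (functionOf (gasketDirac α) fun c =>
        (1 + c ^ 2) ^ (-p / 2)) ↔ gasketDim α < p) := fun hp => by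
      rw [← summable_one_add_sq_iff α hp]
      refine hasFiniteTrace_iff (gasketBasis α) (fun x => by positivity)
        (inner_functionOf_gasketDirac α (B := 1) fun x => ?_)
      rw [abs_of_nonneg (by positivity)]
      exact Real.rpow_le_one_of_one_le_of_nonpos (by nlinarith [sq_nonneg (diracEigenvalue α x)])
        (by linarith)
    constructor
    · rintro ⟨hp, h⟩
      exact (key hp).1 h
    · intro h
      have h : gasketDim α < p := h
      have hp : 0 < p := by linarith
      exact ⟨hp, (key hp).2 h⟩
  rw [spectralDimension, hset, csInf_Ioi]

end Eigenvalues

/-! ### The constant -/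

section Constant

/-- Positive and negative odd integers contribute equally, and the odd part of the zeta series is
the whole minus `2 ^ (-p)` times the whole. The term `n = 0` vanishes because the exponent is not
`0`. -/
theorem tsum_abs_two_mul_add_one_rpow {p : ℝ} (hp : 1 < p) :
    ∑' k : ℤ, |2 * (k : ℝ) + 1| ^ (-p) =
      2 * ((1 - (2 : ℝ) ^ (-p)) * ∑' n : ℕ, (n : ℝ) ^ (-p)) := by
  have hs : Summable fun n : ℕ => (n : ℝ) ^ (-p) := Real.summable_nat_rpow.2 (by linarith)
  have hodd : Summable fun n : ℕ => (((2 * n + 1 : ℕ) : ℝ)) ^ (-p) :=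
    hs.comp_injective (i := fun n : ℕ => 2 * n + 1) fun a b h => by simpa using h
  have heven : Summable fun n : ℕ => (((2 * n : ℕ) : ℝ)) ^ (-p) :=
    hs.comp_injective (i := fun n : ℕ => 2 * n) fun a b h => by simpa using h
  have h1 := tsum_even_add_odd (f := fun n : ℕ => (n : ℝ) ^ (-p)) heven hodd
  have h2 : ∑' n : ℕ, (((2 * n : ℕ) : ℝ)) ^ (-p) = (2 : ℝ) ^ (-p) * ∑' n : ℕ, (n : ℝ) ^ (-p) := by
    rw [← tsum_mul_left]
    congr 1
    funext n
    push_cast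
    rw [Real.mul_rpow (by norm_num) (by positivity)]
  have hpos : HasSum (fun n : ℕ => |2 * (((n : ℕ) : ℤ) : ℝ) + 1| ^ (-p))
      (∑' n : ℕ, (((2 * n + 1 : ℕ) : ℝ)) ^ (-p)) := by
    refine hodd.hasSum.congr_fun fun n => ?_
    rw [Int.cast_natCast, abs_of_pos (by positivity), Nat.cast_succ, Nat.cast_mul, Nat.cast_two]
  have hneg : HasSum (fun n : ℕ => |2 * ((-((n : ℤ) + 1) : ℤ) : ℝ) + 1| ^ (-p))
      (∑' n : ℕ, (((2 * n + 1 : ℕ) : ℝ)) ^ (-p)) := by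
    refine hodd.hasSum.congr_fun fun n => ?_
    rw [show 2 * ((-((n : ℤ) + 1) : ℤ) : ℝ) + 1 = -(2 * (n : ℝ) + 1) by push_cast; ring, abs_neg,
      abs_of_pos (by positivity), Nat.cast_succ, Nat.cast_mul, Nat.cast_two]
  rw [(HasSum.of_nat_of_neg_add_one (f := fun k : ℤ => |2 * (k : ℝ) + 1| ^ (-p)) hpos hneg).tsum_eq]
  linarith

theorem riemannZeta_ofReal {p : ℝ} (hp : 1 < p) :
    riemannZeta p = ((∑' n : ℕ, (n : ℝ) ^ (-p) : ℝ) : ℂ) := by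
  rw [zeta_eq_tsum_one_div_nat_cpow (by simpa using hp), Complex.ofReal_tsum]
  congr 1
  funext n
  rw [Complex.ofReal_cpow (by positivity), Complex.ofReal_neg, Complex.cpow_neg, one_div]
  simp

variable (α : Set.Ioo (0 : ℝ) (1 / 3))

/-- The two forms of the constant agree by `3 (1 - α) ^ d = 2 ^ d` and `log 3 = d (log 2 - log (1 -
α))`. -/
theorem traceConst_eq :
    traceConst α (gasketDim α) =
      (((∑' j, edgeWeight α (gasketDim α) j) * (1 / Real.log 3) : ℝ) : ℂ) := by
  have hd := one_lt_gasketDim α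
  have h3 : (1 - (α : ℝ)) ^ gasketDim α * 3 = 2 ^ gasketDim α := by
    have h := ratio_rpow_gasketDim α
    rw [Real.div_rpow (by linarith [α.2.2]) (by norm_num), div_eq_iff (by positivity)] at h
    rw [h]
    ring
  have hlog : Real.log 3 = gasketDim α * (Real.log 2 - Real.log (1 - α)) := by
    have h := neg_log_ratio_pos α
    rw [gasketDim, ← Real.log_div (by norm_num) (by linarith [α.2.2]), ← Real.log_inv, inv_div,
      div_mul_cancel₀]
    rw [← Real.log_inv, inv_div] at h
    exact h.ne'
  rw [traceConst, riemannZeta_ofReal hd, ← Complex.ofReal_mul, (hasSum_edgeWeight α hd).tsum_eq,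
    tsum_abs_two_mul_add_one_rpow hd]
  congr 1
  set d := gasketDim α
  set Z := ∑' n : ℕ, (n : ℝ) ^ (-d)
  have h2d : (0 : ℝ) < 2 ^ d := by positivity
  have hpi : (0 : ℝ) < Real.pi ^ d := Real.rpow_pos_of_pos Real.pi_pos d
  have hl : 0 < Real.log 2 - Real.log (1 - α) := by
    have : 0 < Real.log 3 := Real.log_pos (by norm_num)
    rw [hlog] at this
    exact (mul_pos_iff_of_pos_left (by linarith)).1 this
  have hden : (2 : ℝ) ^ d * Real.log 2 - 3 * (1 - (α : ℝ)) ^ d * Real.log (1 - α) =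
      2 ^ d * (Real.log 2 - Real.log (1 - α)) := by
    rw [mul_comm 3, h3]; ring
  rw [hden, hlog, Real.rpow_add (by norm_num), Real.rpow_one, Real.div_rpow (by norm_num)
    Real.pi_pos.le, Real.rpow_neg (by norm_num)]
  have hd0 : d ≠ 0 := by linarith
  field_simp

end Constant

/-! ### Separation of the cells -/

section Separation

/-- The barycentric coordinates with respect to `p_1, p_2, p_3`. -/
def bary (i : Fin 3) (x : Plane) : ℝ :=
  ![1 - x 0 - x 1 / √3, 2 * (x 1 / √3), x 0 - x 1 / √3] i

theorem continuous_bary (i : Fin 3) : Continuous (bary i) := by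
  unfold bary
  fin_cases i <;> simp <;> fun_prop

theorem bary_sum (x : Plane) : bary 0 x + bary 1 x + bary 2 x = 1 := by
  simp [bary]
  ring

theorem bary_F_corner (α : ℝ) (i j : Fin 3) (x : Plane) :
    bary i (F α (Fin.castAdd 3 j) x) =
      (1 - α) / 2 * bary i x + if i = j then (1 + α) / 2 else 0 := by
  have h3 : √3 * √3 = 3 := Real.mul_self_sqrt (by norm_num)
  have h0 : √3 ≠ 0 := by positivity
  rw [F_corner]
  fin_cases i <;> fin_cases j <;> simp [bary, vtx, pt] <;> field_simp <;> ring

/-- The joining maps are `α` times the orthogonal projection onto the direction of a side, up to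
translation. The opposite vertex projects to the midpoint, hence the half. -/
theorem F_join (α : ℝ) (j : Fin 3) (x : Plane) :
    F α (Fin.natAdd 3 j) x = vtx (j + 1) +
      ((1 - α) / 2 + α * (bary (j + 2) x + bary j x / 2)) • (vtx (j + 2) - vtx (j + 1)) := by
  have h3 : √3 * √3 = 3 := Real.mul_self_sqrt (by norm_num)
  have h4 : √3 ^ 2 = 3 := Real.sq_sqrt (by norm_num)
  have h0 : √3 ≠ 0 := by positivity
  ext k
  fin_cases j <;> fin_cases k <;>
    simp [F, mat, pt, vtx, bary, Matrix.toEuclideanLin, Matrix.toLpLin_apply, Matrix.vecHead,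
      Matrix.vecTail] <;> field_simp <;> grind

theorem bary_F_join (α : ℝ) (i j : Fin 3) (x : Plane) :
    bary i (F α (Fin.natAdd 3 j) x) =
      if i = j then 0 else (1 - α) / 2 + α * (bary i x + bary j x / 2) := by
  have h3 : √3 * √3 = 3 := Real.mul_self_sqrt (by norm_num)
  have h4 : √3 ^ 2 = 3 := Real.sq_sqrt (by norm_num)
  have h0 : √3 ≠ 0 := by positivity
  rw [F_join]
  fin_cases i <;> fin_cases j <;> simp [bary, vtx, pt] <;> field_simp <;> ring

theorem abs_bary_sub_le (i : Fin 3) (x y : Plane) : |bary i x - bary i y| ≤ 2 * dist x y := by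
  have h0 : |x 0 - y 0| ≤ dist x y := by
    rw [dist_eq_norm]; exact PiLp.norm_apply_le (x - y) 0
  have h1 : |x 1 - y 1| ≤ dist x y := by
    rw [dist_eq_norm]; exact PiLp.norm_apply_le (x - y) 1
  have h3 : |x 1 / √3 - y 1 / √3| ≤ dist x y := by
    rw [← sub_div, abs_div]
    refine le_trans (div_le_self ?_ ?_) h1
    · exact abs_nonneg _
    rw [abs_of_nonneg (Real.sqrt_nonneg 3), Real.one_le_sqrt]
    norm_num
  rw [abs_le] at *
  fin_cases i <;> simp [bary] <;> constructor <;> linarith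

variable {α : Set.Ioo (0 : ℝ) (1 / 3)} {K : TopologicalSpace.NonemptyCompacts Plane}

/-- Take the least value `m` of all three coordinates on the compact set. If `m < 0`, the minimizing
point is the image of a point of the gasket under some map, and each map yields a value strictly
above `m`. The joining maps mix coordinates, so the minimum is taken over all three at once. -/
theorem IsGasket.bary_nonneg (hK : IsGasket α K) (i : Fin 3) {x : Plane} (hx : x ∈ K) :
    0 ≤ bary i x := by
  have hα := α.2.1
  have hα' := α.2.2
  choose y hyK hy using fun i => K.isCompact.exists_isMinOn K.nonempty (continuous_bary i).continuousOn
  obtain ⟨i₀, -, hi₀⟩ := Finset.exists_min_image Finset.univ (fun i => bary i (y i))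
    Finset.univ_nonempty
  have hmin : ∀ i, ∀ z ∈ (K : Set Plane), bary i₀ (y i₀) ≤ bary i z := fun i z hz =>
    (hi₀ i (Finset.mem_univ _)).trans (hy i hz)
  refine le_trans ?_ (hmin i x hx)
  by_contra! hneg
  have hmem := hyK i₀
  rw [hK] at hmem
  obtain ⟨j, z, hz, hzy⟩ := Set.mem_iUnion.1 hmem
  set m := bary i₀ (y i₀) with hm
  revert hzy
  refine Fin.addCases (m := 3) (n := 3) (motive := fun j => F α j z = y i₀ → False) (fun j hzy => ?_) (fun j hzy => ?_) j
  · have h1 := bary_F_corner α i₀ j z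
    rw [hzy, ← hm] at h1
    have h2 := hmin i₀ z hz
    split_ifs at h1 <;> nlinarith
  · have h1 := bary_F_join α i₀ j z
    rw [hzy, ← hm] at h1
    have h2 := hmin i₀ z hz
    have h3 := hmin j z hz
    split_ifs at h1 <;> nlinarith

theorem IsGasket.bary_le_one (hK : IsGasket α K) (i : Fin 3) {x : Plane} (hx : x ∈ K) :
    bary i x ≤ 1 := by
  have h := bary_sum x
  have h0 := hK.bary_nonneg 0 hx
  have h1 := hK.bary_nonneg 1 hx
  have h2 := hK.bary_nonneg 2 hx
  fin_cases i <;> simp <;> linarith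

/-- The coordinate `bary i` is at least `(1 + α) / 2` on corner cell `i` and at most `(1 - α) / 2`
on cell `j`; it is Lipschitz with constant `2`. -/
theorem IsGasket.le_dist_corner (hK : IsGasket α K) {i j : Fin 3} (hij : i ≠ j) {x y : Plane}
    (hx : x ∈ K) (hy : y ∈ K) :
    (α : ℝ) / 2 ≤ dist (F α (Fin.castAdd 3 i) x) (F α (Fin.castAdd 3 j) y) := by
  have hα := α.2.1
  have hα' := α.2.2
  have h := abs_bary_sub_le i (F α (Fin.castAdd 3 i) x) (F α (Fin.castAdd 3 j) y)
  rw [bary_F_corner, bary_F_corner, if_pos rfl, if_neg hij] at h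
  have h1 := hK.bary_nonneg i hx
  have h2 := hK.bary_le_one i hy
  have h3 := le_abs_self ((1 - (α : ℝ)) / 2 * bary i x + (1 + α) / 2 -
    ((1 - (α : ℝ)) / 2 * bary i y + 0))
  nlinarith

theorem wordMap_append (α : ℝ) (v w : List (Fin 3)) (x : Plane) :
    wordMap α (v ++ w) x = wordMap α v (wordMap α w x) := by
  induction v with
  | nil => rfl
  | cons i v ih => simp only [List.cons_append, wordMap, Function.comp_apply, ih]

theorem continuous_wordMap (α : Set.Ioo (0 : ℝ) (1 / 3)) (w : List (Fin 3)) :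
    Continuous (wordMap α w) :=
  (LipschitzWith.of_dist_le_mul (K := ⟨((1 - (α : ℝ)) / 2) ^ w.length,
    pow_nonneg (ratio_pos α).le _⟩) fun x y => (dist_wordMap α w x y).le).continuous

theorem IsGasket.disjoint_cells (hK : IsGasket α K) {n : ℕ} {v w : Fin n → Fin 3} (hvw : v ≠ w) :
    Disjoint (wordMap α (List.ofFn v) '' K) (wordMap α (List.ofFn w) '' K) := by
  induction n with
  | zero => exact absurd (Subsingleton.elim v w) hvw
  | succ n ih =>
    rw [Set.disjoint_left]
    rintro _ ⟨x, hx, rfl⟩ ⟨y, hy, hxy⟩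
    simp only [List.ofFn_succ, wordMap, Function.comp_apply] at hxy
    by_cases h0 : v 0 = w 0
    · rw [h0] at hxy
      have hinj : Function.Injective (F α (Fin.castAdd 3 (w 0))) := by
        have := wordMap_injective (α := α) (by linarith [α.2.2]) [w 0]
        simpa [wordMap] using this
      have htail : (fun i : Fin n => v i.succ) ≠ fun i : Fin n => w i.succ := by
        intro h
        refine hvw (funext fun i => Fin.cases h0 (fun i => congrFun h i) i)
      exact Set.disjoint_left.1 (ih htail) ⟨x, hx, rfl⟩ ⟨y, hy, hinj hxy⟩
    · have h := hK.le_dist_corner h0 (hK.wordMap_mem (List.ofFn fun i : Fin n => v i.succ) hx)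
        (hK.wordMap_mem (List.ofFn fun i : Fin n => w i.succ) hy)
      rw [hxy, dist_self] at h
      linarith [α.2.1]

end Separation

/-! ### The Hausdorff measure of the gasket -/

section Hausdorff

open scoped NNReal ENNReal

variable (α : Set.Ioo (0 : ℝ) (1 / 3))

theorem gasketDim_pos : 0 < gasketDim α := zero_lt_one.trans (one_lt_gasketDim α)

/-- Each letter is a homothety whose ratio to the power `gasketDim α` is `1 / 3`. -/
theorem hausdorffMeasure_wordMap_image (w : List (Fin 3)) (S : Set Plane) :
    μH[gasketDim α] (wordMap α w '' S) = ((3 : ℝ≥0∞) ^ w.length)⁻¹ * μH[gasketDim α] S := by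
  induction w with
  | nil => simp [wordMap]
  | cons i w ih =>
    have hF : F α (Fin.castAdd 3 i) = AffineMap.homothety (vtx i) ((1 - (α : ℝ)) / 2) := by
      funext x
      rw [F_corner, AffineMap.homothety_apply, vsub_eq_sub, vadd_eq_add, add_comm]
    have hr : ‖(1 - (α : ℝ)) / 2‖₊ ^ gasketDim α = 3⁻¹ := by
      ext
      rw [NNReal.coe_rpow, coe_nnnorm, Real.norm_of_nonneg (ratio_pos α).le, ratio_rpow_gasketDim]
      rfl
    rw [wordMap, Set.image_comp, hF, hausdorffMeasure_homothety_image (gasketDim_pos α).le _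
      (ratio_pos α).ne', ih, hr, List.length_cons, pow_succ',
      ENNReal.mul_inv (by simp) (by simp), ENNReal.smul_def, smul_eq_mul, mul_assoc]
    congr 1
    rw [ENNReal.coe_inv (by norm_num)]
    rfl

/-- The image lies on a line, and the dimension exceeds `1`. -/
theorem hausdorffMeasure_F_join_image (j : Fin 3) (S : Set Plane) :
    μH[gasketDim α] (F α (Fin.natAdd 3 j) '' S) = 0 := by
  set g : ℝ → Plane := fun t => vtx (j + 1) + t • (vtx (j + 2) - vtx (j + 1)) with hg
  have hL : LipschitzWith ‖vtx (j + 2) - vtx (j + 1)‖₊ g := by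
    refine LipschitzWith.of_dist_le_mul fun s t => ?_
    rw [hg]
    simp only [dist_add_left]
    rw [dist_eq_norm, ← sub_smul, norm_smul, mul_comm, coe_nnnorm, Real.dist_eq, Real.norm_eq_abs]
  have h0 : μH[gasketDim α] (g '' Set.univ) = 0 := by
    have h := hL.hausdorffMeasure_image_le (gasketDim_pos α).le Set.univ
    rw [Real.hausdorffMeasure_of_finrank_lt (E := ℝ) (by simpa using one_lt_gasketDim α)] at h
    simpa using h
  refine measure_mono_null ?_ h0
  rintro _ ⟨x, -, rfl⟩
  exact ⟨_, trivial, (F_join α j x).symm⟩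

variable {α} {K : TopologicalSpace.NonemptyCompacts Plane}

/-- The part of the gasket outside the cells of a given level is null. -/
theorem IsGasket.hausdorffMeasure_diff_cells (hK : IsGasket α K) (n : ℕ) :
    μH[gasketDim α] ((K : Set Plane) \ ⋃ w : Fin n → Fin 3, wordMap α (List.ofFn w) '' K) = 0 := by
  induction n with
  | zero =>
    simp only [List.ofFn_zero, wordMap, Set.image_id, Set.iUnion_const, Set.sdiff_self,
      measure_empty]
  | succ n ih =>
    set R := (K : Set Plane) \ ⋃ w : Fin n → Fin 3, wordMap α (List.ofFn w) '' K with hR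
    -- What the cells of level `n + 1` miss inside a corner copy is the copy of what level `n`
    -- misses; the rest lies in the images of the joining maps.
    have hsub : (K : Set Plane) \ ⋃ w : Fin (n + 1) → Fin 3, wordMap α (List.ofFn w) '' K ⊆
        (⋃ i : Fin 3, wordMap α [i] '' R) ∪ ⋃ j : Fin 3, F α (Fin.natAdd 3 j) '' K := by
      rintro x ⟨hx, hxn⟩
      rw [hK] at hx
      obtain ⟨j, y, hy, rfl⟩ := Set.mem_iUnion.1 hx
      revert hxn
      refine Fin.addCases (m := 3) (n := 3) (motive := fun j => F α j y ∉ _ → F α j y ∈ _)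
        (fun i hxn => ?_) (fun i _ => ?_) j
      · refine Or.inl (Set.mem_iUnion.2 ⟨i, y, ⟨hy, fun hyn => hxn ?_⟩, rfl⟩)
        obtain ⟨w, z, hz, rfl⟩ := Set.mem_iUnion.1 hyn
        refine Set.mem_iUnion.2 ⟨Fin.cons i w, z, hz, ?_⟩
        simp [List.ofFn_succ, wordMap]
      · exact Or.inr (Set.mem_iUnion.2 ⟨i, y, hy, rfl⟩)
    refine measure_mono_null hsub (measure_union_null (measure_iUnion_null fun i => ?_)
      (measure_iUnion_null fun j => hausdorffMeasure_F_join_image α j _))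
    rw [hausdorffMeasure_wordMap_image, ih, mul_zero]

theorem ediam_wordMap_image (α : Set.Ioo (0 : ℝ) (1 / 3)) (w : List (Fin 3)) (S : Set Plane) :
    Metric.ediam (wordMap α w '' S) ≤
      ENNReal.ofReal ((1 - (α : ℝ)) / 2) ^ w.length * Metric.ediam S := by
  have h : LipschitzWith (((1 - (α : ℝ)) / 2).toNNReal ^ w.length) (wordMap α w) := by
    refine LipschitzWith.of_dist_le_mul fun x y => ?_
    rw [dist_wordMap, NNReal.coe_pow, Real.coe_toNNReal _ (ratio_pos α).le]
  have := h.ediam_image_le S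
  rwa [ENNReal.coe_pow] at this

theorem ofReal_ratio_rpow (α : Set.Ioo (0 : ℝ) (1 / 3)) :
    ENNReal.ofReal ((1 - (α : ℝ)) / 2) ^ gasketDim α = 3⁻¹ := by
  rw [ENNReal.ofReal_rpow_of_pos (ratio_pos α), ratio_rpow_gasketDim,
    ENNReal.ofReal_inv_of_pos (by norm_num)]
  norm_num

/-- Outside the null set `Z` every level covers by `3 ^ n` cells of diameter at most `r ^ n δ`, and
`3 ^ n (r ^ n δ) ^ d = δ ^ d`. -/
theorem IsGasket.hausdorffMeasure_lt_top (hK : IsGasket α K) :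
    μH[gasketDim α] (K : Set Plane) < ∞ := by
  set d := gasketDim α with hd
  set ρ := ENNReal.ofReal ((1 - (α : ℝ)) / 2) with hρ
  set δ := Metric.ediam (K : Set Plane) with hδ
  have hδt : δ ≠ ∞ := K.isCompact.isBounded.ediam_ne_top
  set Z := ⋃ n : ℕ, (K : Set Plane) \ ⋃ w : Fin n → Fin 3, wordMap α (List.ofFn w) '' K with hZ
  have hZ0 : μH[d] Z = 0 := measure_iUnion_null fun n => hK.hausdorffMeasure_diff_cells n
  have hd0 : 0 ≤ d := (gasketDim_pos α).le
  have hmain : μH[d] ((K : Set Plane) \ Z) ≤ δ ^ d := by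
    have hlim : Tendsto (fun n : ℕ => ρ ^ n * δ) atTop (𝓝 0) := by
      have := ENNReal.Tendsto.mul_const (b := δ)
        (ENNReal.tendsto_pow_atTop_nhds_zero_of_lt_one (r := ρ)
          (ENNReal.ofReal_lt_one.2 (ratio_lt_one α))) (Or.inr hδt)
      simpa using this
    refine (Measure.hausdorffMeasure_le_liminf_sum (ι := fun n : ℕ => Fin n → Fin 3) d _
      (fun n => ρ ^ n * δ) hlim (fun n w => wordMap α (List.ofFn w) '' K)
      (Eventually.of_forall fun n w => ?_) (Eventually.of_forall fun n => ?_)).trans ?_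
    · simpa using ediam_wordMap_image α (List.ofFn w) (K : Set Plane)
    · rintro x ⟨hx, hxZ⟩
      by_contra h
      exact hxZ (Set.mem_iUnion.2 ⟨n, hx, h⟩)
    · refine (liminf_le_liminf (v := fun _ => δ ^ d) (Eventually.of_forall fun n => ?_)).trans
        (by simp)
      calc ∑ w : Fin n → Fin 3, Metric.ediam (wordMap α (List.ofFn w) '' (K : Set Plane)) ^ d
          ≤ ∑ w : Fin n → Fin 3, (3⁻¹ : ℝ≥0∞) ^ n * δ ^ d := by
            refine Finset.sum_le_sum fun w _ => ?_
            refine (ENNReal.rpow_le_rpow (ediam_wordMap_image α (List.ofFn w) _) hd0).trans ?_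
            rw [ENNReal.mul_rpow_of_nonneg _ _ hd0, List.length_ofFn, ← ENNReal.rpow_natCast,
              ← ENNReal.rpow_mul, mul_comm (n : ℝ), ENNReal.rpow_mul, ofReal_ratio_rpow,
              ENNReal.rpow_natCast]
        _ ≤ δ ^ d := by
            rw [Finset.sum_const, nsmul_eq_mul, Finset.card_univ, Fintype.card_fun,
              Fintype.card_fin, Fintype.card_fin, ← mul_assoc, Nat.cast_pow, ← mul_pow]
            rw [Nat.cast_ofNat, ENNReal.mul_inv_cancel (by simp) (by simp), one_pow, one_mul]
  have hle : μH[d] (K : Set Plane) ≤ μH[d] Z + μH[d] ((K : Set Plane) \ Z) := by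
    refine (measure_mono fun x hx => ?_).trans (measure_union_le _ _)
    by_cases h : x ∈ Z
    · exact Or.inl h
    · exact Or.inr ⟨hx, h⟩
  rw [hZ0, zero_add] at hle
  exact (hle.trans hmain).trans_lt (ENNReal.rpow_lt_top_of_nonneg hd0 hδt)

/-- The points of the gasket that are addressed by the infinite words in `1, 2, 3`. -/
theorem IsGasket.exists_address (hK : IsGasket α K) (ω : ℕ → Fin 3) :
    ∃ x, ∀ n : ℕ, x ∈ wordMap α (List.ofFn fun i : Fin n => ω i) '' (K : Set Plane) := by
  have hc : ∀ n : ℕ, IsCompact (wordMap α (List.ofFn fun i : Fin n => ω i) '' (K : Set Plane)) :=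
    fun n => K.isCompact.image (continuous_wordMap α _)
  have hsub : ∀ n : ℕ, wordMap α (List.ofFn fun i : Fin (n + 1) => ω i) '' (K : Set Plane) ⊆
      wordMap α (List.ofFn fun i : Fin n => ω i) '' K := by
    rintro n _ ⟨y, hy, rfl⟩
    refine ⟨_, hK.wordMap_mem [ω n] hy, ?_⟩
    rw [List.ofFn_succ', List.concat_eq_append, wordMap_append]
    rfl
  obtain ⟨x, hx⟩ := IsCompact.nonempty_iInter_of_sequence_nonempty_isCompact_isClosed
    (fun n : ℕ => wordMap α (List.ofFn fun i : Fin n => ω i) '' (K : Set Plane)) hsub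
    (fun n => K.nonempty.image _) (hc 0) fun n => (hc n).isClosed
  exact ⟨x, fun n => Set.mem_iInter.1 hx n⟩

/-- If the addresses first differ at place `n`, the numbers differ by at most `3⁻ⁿ = (r ^ n) ^ d`.
The points lie in different subcells of one cell of level `n`, hence at distance at least `r ^ n α /
2`. -/
theorem IsGasket.abs_ofDigits_sub_le (hK : IsGasket α K) {ω ω' : ℕ → Fin 3} {x y : Plane}
    (hx : ∀ n : ℕ, x ∈ wordMap α (List.ofFn fun i : Fin n => ω i) '' (K : Set Plane))
    (hy : ∀ n : ℕ, y ∈ wordMap α (List.ofFn fun i : Fin n => ω' i) '' (K : Set Plane)) :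
    |Real.ofDigits ω - Real.ofDigits ω'| ≤ (2 / (α : ℝ)) ^ gasketDim α * dist x y ^ gasketDim α := by
  have hα := α.2.1
  by_cases h : ω = ω'
  · rw [h, sub_self, abs_zero]
    positivity
  set n := PiNat.firstDiff ω ω' with hn
  have heq : ∀ i < n, ω i = ω' i := fun i hi => PiNat.apply_eq_of_lt_firstDiff hi
  have hne : ω n ≠ ω' n := PiNat.apply_firstDiff_ne h
  refine (Real.abs_ofDigits_sub_ofDigits_le heq).trans ?_
  obtain ⟨x', hx', rfl⟩ := hx (n + 1)
  obtain ⟨y', hy', rfl⟩ := hy (n + 1)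
  have hw : (List.ofFn fun i : Fin n => ω' i) = List.ofFn fun i : Fin n => ω i :=
    congrArg List.ofFn (funext fun i => (heq i i.2).symm)
  rw [List.ofFn_succ', List.ofFn_succ', List.concat_eq_append, List.concat_eq_append,
    wordMap_append, wordMap_append]
  simp only [Fin.val_castSucc, Fin.val_last]
  rw [hw, dist_wordMap, List.length_ofFn]
  have hr := ratio_pos α
  have h3 : ((3 : ℝ) ^ n)⁻¹ = (((1 - (α : ℝ)) / 2) ^ n) ^ gasketDim α := by
    rw [← inv_pow, ← ratio_rpow_gasketDim α, ← Real.rpow_natCast, ← Real.rpow_natCast,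
      ← Real.rpow_mul hr.le, ← Real.rpow_mul hr.le, mul_comm]
  rw [Nat.cast_ofNat, h3, ← Real.mul_rpow (by positivity) (by positivity)]
  refine Real.rpow_le_rpow (by positivity) ?_ (gasketDim_pos α).le
  have hd := hK.le_dist_corner hne hx' hy'
  calc ((1 - (α : ℝ)) / 2) ^ n = 2 / α * (((1 - (α : ℝ)) / 2) ^ n * (α / 2)) := by
        field_simp
    _ ≤ _ := by
        simp only [wordMap, Function.comp_apply, id]
        gcongr

/-- A `d`-Hölder image of a set null for `μH[d]` has length `0`, whereas the digit map covers `[0,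
1]`. -/
theorem IsGasket.hausdorffMeasure_ne_zero (hK : IsGasket α K) :
    μH[gasketDim α] (K : Set Plane) ≠ 0 := by
  choose x hx using hK.exists_address
  set σ : Plane → ℕ → Fin 3 := Function.invFun x with hσ
  have hσx : ∀ p ∈ Set.range x, ∀ n : ℕ,
      p ∈ wordMap α (List.ofFn fun i : Fin n => σ p i) '' (K : Set Plane) := by
    intro p hp n
    have h := hx (σ p) n
    rwa [hσ, Function.invFun_eq hp] at h
  have hd := gasketDim_pos α
  have hα := α.2.1
  have hH : HolderOnWith ((2 / (α : ℝ)) ^ gasketDim α).toNNReal (gasketDim α).toNNReal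
      (fun p => Real.ofDigits (σ p)) (Set.range x) := by
    intro p hp q hq
    have h := hK.abs_ofDigits_sub_le (hσx p hp) (hσx q hq)
    rw [edist_dist, edist_dist, Real.dist_eq, Real.coe_toNNReal _ hd.le,
      ENNReal.ofReal_rpow_of_nonneg dist_nonneg hd.le]
    change _ ≤ ENNReal.ofReal _ * _
    rw [← ENNReal.ofReal_mul (by positivity)]
    exact ENNReal.ofReal_le_ofReal h
  have himg : Set.Icc (0 : ℝ) 1 ⊆ (fun p => Real.ofDigits (σ p)) '' Set.range x := by
    intro t ht
    obtain ⟨ω, -, rfl⟩ := Real.ofDigits_SurjOn (b := 3) (by norm_num) ht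
    refine ⟨x ω, ⟨ω, rfl⟩, ?_⟩
    -- The address selected for `x ω` need not literally be `ω`; the Hölder estimate at distance `0`
    -- shows that both represent the same number.
    have h := hK.abs_ofDigits_sub_le (hσx (x ω) ⟨ω, rfl⟩) (hx ω)
    rw [dist_self, Real.zero_rpow hd.ne', mul_zero] at h
    exact sub_eq_zero.1 (abs_nonpos_iff.1 h)
  have hle := hH.hausdorffMeasure_image_le (by simpa using hd) zero_le_one
  rw [mul_one, Real.coe_toNNReal _ hd.le, hausdorffMeasure_real] at hle
  intro h0
  have hsub : Set.range x ⊆ K := by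
    rintro _ ⟨ω, rfl⟩
    simpa [wordMap] using hx ω 0
  rw [measure_mono_null hsub h0, mul_zero] at hle
  have h1 := (measure_mono (μ := volume) himg).trans hle
  simp at h1

end Hausdorff

/-! ### Averages over the cells -/

section Averages

open scoped NNReal ENNReal

variable {α : Set.Ioo (0 : ℝ) (1 / 3)} {K : TopologicalSpace.NonemptyCompacts Plane}

/-- The cell of the gasket that belongs to a finite word. -/
def cell (α : ℝ) (K : TopologicalSpace.NonemptyCompacts Plane) {n : ℕ} (w : Fin n → Fin 3) :
    Set K :=
  (↑) ⁻¹' (wordMap α (List.ofFn w) '' (K : Set Plane))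

theorem hausdorffMeasure_univ_coe (K : TopologicalSpace.NonemptyCompacts Plane) {d : ℝ}
    (hd : 0 ≤ d) : μH[d] (Set.univ : Set K) = μH[d] (K : Set Plane) := by
  have h := (isometry_subtype_coe (s := (K : Set Plane))).hausdorffMeasure_image (Or.inl hd)
    Set.univ
  rw [Set.image_univ, Subtype.range_coe] at h
  exact h.symm

theorem IsGasket.isProbabilityMeasure (hK : IsGasket α K) :
    IsProbabilityMeasure (hausdorffProb K (gasketDim α)) := by
  constructor
  rw [hausdorffProb, Measure.smul_apply, smul_eq_mul,
    hausdorffMeasure_univ_coe K (gasketDim_pos α).le]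
  exact ENNReal.inv_mul_cancel hK.hausdorffMeasure_ne_zero hK.hausdorffMeasure_lt_top.ne

theorem IsGasket.hausdorffProb_cell (hK : IsGasket α K) {n : ℕ} (w : Fin n → Fin 3) :
    hausdorffProb K (gasketDim α) (cell α K w) = ((3 : ℝ≥0∞) ^ n)⁻¹ := by
  have hd := (gasketDim_pos α).le
  have h := (isometry_subtype_coe (s := (K : Set Plane))).hausdorffMeasure_image (Or.inl hd)
    (cell α K w)
  have himg : Subtype.val '' cell α K w = wordMap α (List.ofFn w) '' (K : Set Plane) := by
    refine (Set.image_subset_iff.2 subset_rfl).antisymm ?_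
    rintro _ ⟨x, hx, rfl⟩
    exact ⟨⟨_, hK.wordMap_mem _ hx⟩, ⟨x, hx, rfl⟩, rfl⟩
  replace h : ((3 : ℝ≥0∞) ^ n)⁻¹ * μH[gasketDim α] (K : Set Plane) =
      μH[gasketDim α] (cell α K w) := by
    have hw := hausdorffMeasure_wordMap_image α (List.ofFn w) K
    rw [List.length_ofFn] at hw
    rw [← h, ← hw]
    exact congrArg _ himg.symm
  rw [hausdorffProb, Measure.smul_apply, smul_eq_mul, hausdorffMeasure_univ_coe K hd]
  refine (congrArg (_ * ·) h.symm).trans ?_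
  rw [mul_left_comm, ENNReal.inv_mul_cancel hK.hausdorffMeasure_ne_zero
    hK.hausdorffMeasure_lt_top.ne, mul_one]

theorem measurableSet_cell (α : Set.Ioo (0 : ℝ) (1 / 3))
    (K : TopologicalSpace.NonemptyCompacts Plane) {n : ℕ} (w : Fin n → Fin 3) :
    MeasurableSet (cell α K w) :=
  ((K.isCompact.image (continuous_wordMap α _)).isClosed.preimage
    continuous_subtype_val).measurableSet

theorem IsGasket.pairwise_disjoint_cell (hK : IsGasket α K) (n : ℕ) :
    Pairwise (Function.onFun Disjoint fun w : Fin n → Fin 3 => cell α K w) := fun _ _ hvw =>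
  (hK.disjoint_cells hvw).preimage _

/-- The `3 ^ n` disjoint cells of mass `3⁻ⁿ` exhaust the total mass. -/
theorem IsGasket.iUnion_cell_ae (hK : IsGasket α K) (n : ℕ) :
    (⋃ w : Fin n → Fin 3, cell α K w) =ᵐ[hausdorffProb K (gasketDim α)] Set.univ := by
  have := hK.isProbabilityMeasure
  refine ae_eq_univ_iff_measure_eq ?_ |>.2 ?_
  · exact (MeasurableSet.iUnion fun w => measurableSet_cell α K w).nullMeasurableSet
  · rw [measure_iUnion (hK.pairwise_disjoint_cell n) fun w => measurableSet_cell α K w,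
      tsum_fintype]
    simp only [hK.hausdorffProb_cell, measure_univ]
    rw [Finset.sum_const, nsmul_eq_mul, Finset.card_univ, Fintype.card_fun, Fintype.card_fin,
      Fintype.card_fin, Nat.cast_pow, Nat.cast_ofNat]
    exact ENNReal.mul_inv_cancel (by simp) (by simp)

theorem dist_lt_of_mem_cell (α : Set.Ioo (0 : ℝ) (1 / 3))
    (K : TopologicalSpace.NonemptyCompacts Plane) {n : ℕ} {w : Fin n → Fin 3} {x y : K}
    (hx : x ∈ cell α K w) (hy : y ∈ cell α K w) :
    dist x y ≤ ((1 - (α : ℝ)) / 2) ^ n * Metric.diam (K : Set Plane) := by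
  obtain ⟨x', hx', hx⟩ := hx
  obtain ⟨y', hy', hy⟩ := hy
  rw [Subtype.dist_eq, ← hx, ← hy, dist_wordMap, List.length_ofFn]
  have := (ratio_pos α).le
  gcongr
  exact Metric.dist_le_diam_of_mem K.isCompact.isBounded hx' hy'

theorem tendsto_ratio_pow_mul (α : Set.Ioo (0 : ℝ) (1 / 3)) (c : ℝ) :
    Tendsto (fun n : ℕ => ((1 - (α : ℝ)) / 2) ^ n * c) atTop (𝓝 0) := by
  simpa using (tendsto_pow_atTop_nhds_zero_of_lt_one (ratio_pos α).le (ratio_lt_one α)).mul_const c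

/-- The averages of the values of a continuous function at points of the cells of level `n` tend to
its integral. -/
theorem IsGasket.tendsto_average (hK : IsGasket α K) (g : C(K, ℝ))
    (y : ∀ n, (Fin n → Fin 3) → K) (hy : ∀ n w, y n w ∈ cell α K w) :
    Tendsto (fun n : ℕ => ((3 : ℝ) ^ n)⁻¹ * ∑ w : Fin n → Fin 3, g (y n w)) atTop
      (𝓝 (∫ x, g x ∂hausdorffProb K (gasketDim α))) := by
  have hprob := hK.isProbabilityMeasure
  set μ := hausdorffProb K (gasketDim α) with hμ
  have hint : Integrable g μ := g.continuous.integrable_of_hasCompactSupport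
    (HasCompactSupport.of_compactSpace g)
  have hcell : ∀ (n : ℕ) (w : Fin n → Fin 3), μ.real (cell α K w) = ((3 : ℝ) ^ n)⁻¹ := by
    intro n w
    rw [Measure.real, hK.hausdorffProb_cell]
    simp
  rw [Metric.tendsto_atTop]
  intro ε hε
  have huc : UniformContinuous g := CompactSpace.uniformContinuous_of_continuous g.continuous
  obtain ⟨δ, hδ, hgδ⟩ := Metric.uniformContinuous_iff.1 huc (ε / 2) (half_pos hε)
  obtain ⟨N, hN⟩ := eventually_atTop.1
    ((tendsto_ratio_pow_mul α (Metric.diam (K : Set Plane))).eventually_lt_const hδ)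
  refine ⟨N, fun n hn => ?_⟩
  have hsplit : ∫ x, g x ∂μ = ∑ w : Fin n → Fin 3, ∫ x in cell α K w, g x ∂μ := by
    rw [← integral_iUnion_fintype (fun w => measurableSet_cell α K w) (hK.pairwise_disjoint_cell n)
      fun w => hint.integrableOn, setIntegral_congr_set (hK.iUnion_cell_ae n), setIntegral_univ]
  -- Each cell has mass `3⁻ⁿ`, so the error on it is the integral of `g (y n w) - g x`, which
  -- uniform continuity makes small.
  have hterm : ∀ w : Fin n → Fin 3,
      ‖((3 : ℝ) ^ n)⁻¹ * g (y n w) - ∫ x in cell α K w, g x ∂μ‖ ≤ ε / 2 * ((3 : ℝ) ^ n)⁻¹ := by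
    intro w
    have h1 : ((3 : ℝ) ^ n)⁻¹ * g (y n w) - ∫ x in cell α K w, g x ∂μ =
        ∫ x in cell α K w, (g (y n w) - g x) ∂μ := by
      rw [integral_sub (integrable_const _) hint.integrableOn, setIntegral_const, hcell,
        smul_eq_mul]
    rw [h1, ← hcell n w]
    refine norm_setIntegral_le_of_norm_le_const (measure_lt_top _ _) fun x hx => ?_
    have := hgδ ((dist_lt_of_mem_cell α K (hy n w) hx).trans_lt (hN n hn))
    rw [← dist_eq_norm]
    exact this.le
  rw [dist_eq_norm, hsplit, Finset.mul_sum, ← Finset.sum_sub_distrib]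
  refine (norm_sum_le _ _).trans_lt ((Finset.sum_le_sum fun w _ => hterm w).trans_lt ?_)
  rw [Finset.sum_const, nsmul_eq_mul, Finset.card_univ, Fintype.card_fun, Fintype.card_fin,
    Fintype.card_fin, Nat.cast_pow, Nat.cast_ofNat, mul_left_comm, mul_inv_cancel₀ (by positivity)]
  linarith

end Averages

/-! ### Functions act almost diagonally -/

section CurveRep

variable {l : ℝ} [Fact (0 < l)] {X : Type*} [TopologicalSpace X] (R : C(Set.Icc (0 : ℝ) l, X))

theorem curveRep_sub (f g : C(X, ℂ)) : curveRep l R (f - g) = curveRep l R f - curveRep l R g := by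
  have h : curvePullback l R (f - g) = curvePullback l R f - curvePullback l R g := rfl
  rw [curveRep, h, map_sub, map_sub]
  rfl

theorem curveRep_const (z : ℂ) (u : CurveSpace l) :
    curveRep l R (ContinuousMap.const X z) u = z • u := by
  rw [curveRep]
  ext1
  refine ((ContinuousLinearMap.mul ℂ ℂ).coeFn_holder _ _).trans ?_
  filter_upwards [Lp.coeFn_smul z u, ContinuousMap.coeFn_toLp (p := ⊤)
    (AddCircle.haarAddCircle : Measure (AddCircle (2 * l))) (𝕜 := ℂ)
    (curvePullback l R (ContinuousMap.const X z))] with x h1 h2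
  rw [h1, h2]
  rfl

/-- Passing to `f.comp R` on the parameter interval makes the norm bound see only the values of `f`
along the curve. -/
theorem norm_curveRep_sub_smul_le (f : C(X, ℂ)) (z : ℂ) (u : CurveSpace l) :
    ‖curveRep l R f u - z • u‖ ≤ ‖f.comp R - ContinuousMap.const _ z‖ * ‖u‖ := by
  have h : curveRep l R f = curveRep l (ContinuousMap.id _) (f.comp R) := rfl
  rw [h, ← curveRep_const (ContinuousMap.id _), ← sub_apply, ← curveRep_sub]
  exact (ContinuousLinearMap.le_opNorm _ _).trans
    (mul_le_mul_of_nonneg_right (norm_curveRep_le l _ _) (norm_nonneg _))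

end CurveRep

section GasketRep

variable {α : Set.Ioo (0 : ℝ) (1 / 3)} {K : TopologicalSpace.NonemptyCompacts Plane}

/-- The initial point of an edge, as a point of the gasket. -/
def startPoint (hK : IsGasket α K) (e : Edge) : K :=
  edgeCurve hK e ⟨0, le_rfl, (edgeLength_pos α e).le⟩

theorem coe_startPoint (hK : IsGasket α K) (e : Edge) :
    (startPoint hK e : Plane) = edgeStart α e := by
  have h := (edgeLength_pos α e).ne'
  simp [startPoint, edgeCurve, smul_smul, h]

theorem dist_edgeCurve_le (hK : IsGasket α K) (e : Edge) (t : Set.Icc (0 : ℝ) (edgeLength α e)) :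
    dist (edgeCurve hK e t) (startPoint hK e) ≤ edgeLength α e := by
  have h := edgeLength_pos α e
  rw [Subtype.dist_eq, coe_startPoint]
  have h1 : (edgeCurve hK e t : Plane) - edgeStart α e =
      ((t : ℝ) / edgeLength α e) • (edgeEnd α e - edgeStart α e) := by
    simp only [edgeCurve, ContinuousMap.coe_mk]
    match_scalars
    · field_simp
    · field_simp
      ring
  rw [dist_eq_norm, h1, norm_smul, ← dist_eq_norm, dist_comm]
  change _ * edgeLength α e ≤ _
  rw [Real.norm_of_nonneg (div_nonneg t.2.1 h.le), div_mul_cancel₀ _ h.ne']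
  exact t.2.2

/-- The oscillation of a function along an edge. -/
def edgeOsc (hK : IsGasket α K) (f : C(K, ℂ)) (e : Edge) : ℝ :=
  ‖f.comp (edgeCurve hK e) - ContinuousMap.const _ (f (startPoint hK e))‖

theorem edgeOsc_nonneg (hK : IsGasket α K) (f : C(K, ℂ)) (e : Edge) : 0 ≤ edgeOsc hK f e :=
  norm_nonneg _

theorem edgeOsc_le (hK : IsGasket α K) (f : C(K, ℂ)) (e : Edge) : edgeOsc hK f e ≤ 2 * ‖f‖ := by
  refine (ContinuousMap.norm_le _ (by positivity)).2 fun t => ?_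
  refine (norm_sub_le _ _).trans ?_
  have h1 := f.norm_coe_le_norm (edgeCurve hK e t)
  have h2 := f.norm_coe_le_norm (startPoint hK e)
  simp only [ContinuousMap.comp_apply, ContinuousMap.const_apply]
  linarith

theorem exists_edgeOsc_le (hK : IsGasket α K) (f : C(K, ℂ)) {ε : ℝ} (hε : 0 < ε) :
    ∃ δ > 0, ∀ e, edgeLength α e < δ → edgeOsc hK f e ≤ ε := by
  have huc : UniformContinuous f := CompactSpace.uniformContinuous_of_continuous f.continuous
  obtain ⟨δ, hδ, hf⟩ := Metric.uniformContinuous_iff.1 huc ε hε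
  refine ⟨δ, hδ, fun e he => (ContinuousMap.norm_le _ hε.le).2 fun t => ?_⟩
  have := hf ((dist_edgeCurve_le hK e t).trans_lt he)
  rw [dist_eq_norm] at this
  exact this.le

/-- The representation preserves each edge summand, so the error stays on the edge of the basis
vector. -/
theorem norm_gasketRep_basis_sub_le (hK : IsGasket α K) (f : C(K, ℂ)) (p : Edge × ℤ) :
    ‖gasketRep hK f (gasketBasis α p) - f (startPoint hK p.1) • gasketBasis α p‖ ≤
      edgeOsc hK f p.1 := by
  classical
  obtain ⟨e, k⟩ := p
  set u : CurveSpace (edgeLength α e) := fourierBasis (T := 2 * edgeLength α e) k with hu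
  have hb : gasketBasis α (e, k) = lp.single 2 e u := by
    rw [gasketBasis_apply]
  have hsingle : gasketRep hK f (gasketBasis α (e, k)) - f (startPoint hK e) • gasketBasis α (e, k) =
      lp.single 2 e (curveRep (edgeLength α e) (edgeCurve hK e) f u - f (startPoint hK e) • u) := by
    rw [hb]
    ext1
    funext e'
    change curveRep _ (edgeCurve hK e') f ((lp.single 2 e u : GasketSpace α) e') -
      f (startPoint hK e) • (lp.single 2 e u : GasketSpace α) e' = _
    by_cases he : e' = e
    · subst he
      rw [lp.single_apply_self, lp.single_apply_self]
    · rw [lp.single_apply_ne _ _ _ he, lp.single_apply_ne _ _ _ he, map_zero, smul_zero, sub_zero]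
  have hnorm : ‖u‖ = 1 := (fourierBasis (T := 2 * edgeLength α e)).orthonormal.1 k
  simp only
  rw [hsingle, lp.norm_single (by norm_num)]
  refine (norm_curveRep_sub_smul_le _ f _ u).trans ?_
  rw [hnorm, mul_one]
  rfl

end GasketRep

/-! ### The Dixmier traces -/

section Sorted

/-- The four parts of `T` are the positive parts of `Re (u T)` for `u = 1, -1, -i, i`, so one limit
theorem, with `M` replaced by `u • M`, serves all of them. -/
theorem dixmierTrace_mul_diagonal {H : Type*} [NormedAddCommGroup H] [InnerProductSpace ℂ H]
    [CompleteSpace H] {ι : Type*} (b : HilbertBasis ι ℂ H) {c m : ι → ℝ} {z : ι → ℂ}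
    {P : H →L[ℂ] H} {B C₀ : ℝ} (hP : ∀ k, P (b k) = (c k : ℂ) • b k) (hc : ∀ k, 0 ≤ c k)
    (hfin : ∀ t, 0 < t → {k | t < c k}.Finite) (hC₀ : 0 < C₀)
    (hcount : ∀ t, 0 < t → ({k | t < c k}.ncard : ℝ) ≤ C₀ / t) (M : H →L[ℂ] H) (hB : 0 ≤ B)
    (hz : ∀ k, ‖z k‖ ≤ B) (hm : ∀ k, ‖M (b k) - z k • b k‖ ≤ m k) {L : ℂ → ℝ}
    (hL : ∀ u : ℂ, ‖u‖ = 1 →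
      Tendsto (fun t => truncSum c (fun k => (u * z k).re⁺) t / -Real.log t) (𝓝[>] 0) (𝓝 (L u)))
    (h0 : Tendsto (fun t => truncSum c m t / -Real.log t) (𝓝[>] 0) (𝓝 0)) (w : ExtendedLimit) :
    dixmierTrace w (M * P) =
      L 1 - L (-1) + Complex.I * (L (-Complex.I) - L Complex.I) := by
  have key : ∀ u : ℂ, ‖u‖ = 1 →
      dixmierTracePos w ((realPart (u • (M * P)) : H →L[ℂ] H)⁺) = L u := by
    intro u hu
    rw [← smul_mul_assoc]
    refine dixmierTracePos_eq_of_tendsto w (tendsto_dixmierSeq_posPart b hP hc hfin hC₀ hcount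
      (u • M) hB (z := fun k => u * z k) (m := m) (fun k => ?_) (fun k => ?_) (hL u hu) h0)
    · rw [norm_mul, hu, one_mul]
      exact hz k
    · rw [smul_apply, mul_smul, ← smul_sub, norm_smul, hu, one_mul]
      exact hm k
  have h1 := key 1 (by simp)
  have h2 := key (-1) (by simp)
  have h3 := key (-Complex.I) (by simp)
  have h4 := key Complex.I (by simp)
  rw [one_smul] at h1
  rw [neg_smul, one_smul, map_neg, NegMemClass.coe_neg, CFC.posPart_neg] at h2
  rw [neg_smul, map_neg, realPart_I_smul, neg_neg] at h3
  rw [realPart_I_smul, NegMemClass.coe_neg, CFC.posPart_neg] at h4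
  rw [dixmierTrace, h1, h2, h3, h4]

theorem exists_reindex {H : Type*} [NormedAddCommGroup H] [InnerProductSpace ℂ H] [CompleteSpace H]
    {ι κ : Type*} (b : HilbertBasis ι ℂ H) (e : κ ≃ ι) :
    ∃ B : HilbertBasis κ ℂ H, ∀ k, B k = b (e k) := by
  have hspan : ⊤ ≤ (Submodule.span ℂ (Set.range fun k => b (e k))).topologicalClosure := by
    have h : (Set.range fun k => b (e k)) = Set.range b := e.surjective.range_comp b
    rw [h, b.dense_span]
  exact ⟨HilbertBasis.mk (b.orthonormal.comp e e.injective) hspan, fun k => by simp⟩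

variable (α : Set.Ioo (0 : ℝ) (1 / 3))

/-- The eigenbasis of `D_α`, sorted by word length. -/
def sortedBasis : HilbertBasis (SizedWord × ((Bool × Fin 3) × ℤ)) ℂ (GasketSpace α) :=
  (exists_reindex (gasketBasis α) indexEquiv).choose

theorem sortedBasis_apply (x : SizedWord × ((Bool × Fin 3) × ℤ)) :
    sortedBasis α x = gasketBasis α (indexEquiv x) :=
  (exists_reindex (gasketBasis α) indexEquiv).choose_spec x

theorem absNegPow_sortedBasis (x : SizedWord × ((Bool × Fin 3) × ℤ)) :
    absNegPow (gasketDirac α) (gasketDim α) (sortedBasis α x) =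
      (wordFamily (edgeWeight α (gasketDim α)) x : ℂ) • sortedBasis α x := by
  -- Boundedness of `|c| ^ (-d)` on the spectrum guarantees that `absNegPow` is the genuine power
  -- and not the default value.
  have hbound : ∀ p, |(fun c : ℝ => |c| ^ (-gasketDim α)) (diracEigenvalue α p)| ≤
      ∑' j, edgeWeight α (gasketDim α) j := by
    intro p
    obtain ⟨⟨⟨n, w⟩, j⟩, rfl⟩ := indexEquiv.surjective p
    beta_reduce
    rw [abs_diracEigenvalue_rpow_gasketDim, wordFamily, abs_of_nonneg
      (mul_nonneg (by positivity) (edgeWeight_pos α _ j).le)]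
    have h1 : edgeWeight α (gasketDim α) j ≤ ∑' j, edgeWeight α (gasketDim α) j :=
      (summable_edgeWeight α (one_lt_gasketDim α)).le_tsum j fun i _ => (edgeWeight_pos α _ i).le
    refine le_trans ?_ h1
    refine mul_le_of_le_one_left (edgeWeight_pos α _ j).le ?_
    exact inv_le_one_of_one_le₀ (one_le_pow₀ (by norm_num))
  rw [sortedBasis_apply, ← abs_diracEigenvalue_rpow_gasketDim]
  exact apply_basis_of_inner_eq (gasketBasis α)
    (fun y p => inner_functionOf_gasketDirac α hbound y p) (indexEquiv x)

variable {α} {K : TopologicalSpace.NonemptyCompacts Plane}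

theorem startPoint_mem_cell (hK : IsGasket α K) {n : ℕ} (w : Fin n → Fin 3) (s : Bool) (i : Fin 3) :
    startPoint hK (edgeEquiv (List.ofFn w, (s, i))) ∈ cell α K w := by
  rw [cell, Set.mem_preimage, coe_startPoint]
  cases s
  · exact ⟨vtx (i + 1), hK.vtx_mem _, rfl⟩
  · exact ⟨_, hK.map_mem (Fin.natAdd 3 i) (hK.vtx_mem (i + 1)), rfl⟩

theorem tendsto_average_edgeOsc (hK : IsGasket α K) (f : C(K, ℂ)) (s : Bool) (i : Fin 3) :
    Tendsto (fun n : ℕ => ((3 : ℝ) ^ n)⁻¹ *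
      ∑ w : Fin n → Fin 3, edgeOsc hK f (edgeEquiv (List.ofFn w, (s, i)))) atTop (𝓝 0) := by
  rw [Metric.tendsto_atTop]
  intro ε hε
  obtain ⟨δ, hδ, hosc⟩ := exists_edgeOsc_le hK f (half_pos hε)
  obtain ⟨N, hN⟩ := eventually_atTop.1
    ((tendsto_ratio_pow_mul α (edgeScale α s)).eventually_lt_const hδ)
  refine ⟨N, fun n hn => ?_⟩
  rw [dist_zero_right, Real.norm_of_nonneg
    (mul_nonneg (by positivity) (Finset.sum_nonneg fun w _ => edgeOsc_nonneg hK f _))]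
  have hsum : ∑ w : Fin n → Fin 3, edgeOsc hK f (edgeEquiv (List.ofFn w, (s, i))) ≤
      ∑ _w : Fin n → Fin 3, ε / 2 := by
    refine Finset.sum_le_sum fun w _ => hosc _ ?_
    rw [edgeLength_edgeEquiv, List.length_ofFn, mul_comm]
    exact hN n hn
  rw [Finset.sum_const, nsmul_eq_mul, Finset.card_univ, Fintype.card_fun, Fintype.card_fin,
    Fintype.card_fin, Nat.cast_pow, Nat.cast_ofNat] at hsum
  calc _ ≤ ((3 : ℝ) ^ n)⁻¹ * (3 ^ n * (ε / 2)) := by gcongr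
    _ < ε := by
      rw [inv_mul_cancel_left₀ (by positivity)]
      linarith

/-- For fixed kind, side and mode, the initial points give one sample point in each cell, so the
level averages tend to the same integral for every `j`. -/
theorem tendsto_truncSum_posPart (hK : IsGasket α K) (f : C(K, ℂ)) (u : ℂ) :
    Tendsto (fun t => truncSum (wordFamily (edgeWeight α (gasketDim α)))
      (fun x => (u * f (startPoint hK (indexEquiv x).1)).re⁺) t / -Real.log t) (𝓝[>] 0)
      (𝓝 ((∑' j, edgeWeight α (gasketDim α) j) *
        ((∫ x, (u * f x).re⁺ ∂hausdorffProb K (gasketDim α)) / Real.log 3))) := by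
  refine tendsto_truncSum_wordFamily (edgeWeight_pos α _)
    (summable_edgeWeight α (one_lt_gasketDim α)) (B := ‖u‖ * ‖f‖) (fun x => ?_) ?_
  · rw [abs_of_nonneg (posPart_nonneg _)]
    calc (u * f (startPoint hK (indexEquiv x).1)).re⁺
        ≤ |(u * f (startPoint hK (indexEquiv x).1)).re| := sup_le (le_abs_self _) (abs_nonneg _)
      _ ≤ ‖u * f (startPoint hK (indexEquiv x).1)‖ := Complex.abs_re_le_norm _
      _ ≤ ‖u‖ * ‖f‖ := by
          rw [norm_mul]
          gcongr
          exact f.norm_coe_le_norm _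
  · rintro ⟨⟨s, i⟩, k⟩
    exact hK.tendsto_average ⟨fun x => (u * f x).re⁺, by simp only [posPart_def]; fun_prop⟩
      (fun n w => startPoint hK (edgeEquiv (List.ofFn w, (s, i))))
      fun n w => startPoint_mem_cell hK w s i

theorem tendsto_truncSum_edgeOsc (hK : IsGasket α K) (f : C(K, ℂ)) :
    Tendsto (fun t => truncSum (wordFamily (edgeWeight α (gasketDim α)))
      (fun x => edgeOsc hK f (indexEquiv x).1) t / -Real.log t) (𝓝[>] 0) (𝓝 0) := by
  have h := tendsto_truncSum_wordFamily (edgeWeight_pos α _)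
    (summable_edgeWeight α (one_lt_gasketDim α)) (B := 2 * ‖f‖) (L := 0)
    (g := fun x => edgeOsc hK f (indexEquiv x).1)
    (fun x => (abs_of_nonneg (edgeOsc_nonneg hK f _)).le.trans (edgeOsc_le hK f _))
    fun ⟨⟨s, i⟩, k⟩ => tendsto_average_edgeOsc hK f s i
  simpa using h

theorem inDixmierIdeal_gasket (hK : IsGasket α K) (f : C(K, ℂ)) :
    InDixmierIdeal (gasketRep hK f * absNegPow (gasketDirac α) (gasketDim α)) := by
  have hq := fun j => edgeWeight_pos α (gasketDim α) j
  have hs := summable_edgeWeight α (one_lt_gasketDim α)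
  refine inDixmierIdeal_mul_diagonal (sortedBasis α) (absNegPow_sortedBasis α)
    (fun x => mul_nonneg (by positivity) (hq _).le) (fun t ht => finite_lt_wordFamily hq hs ht)
    (gasketRep hK f) le_rfl (tendsto_truncSum_wordFamily hq hs (B := ‖gasketRep hK f‖)
      (L := ‖gasketRep hK f‖) (fun x => (abs_of_nonneg (norm_nonneg _)).le) fun j => ?_)
  refine tendsto_const_nhds.congr fun n => ?_
  rw [Finset.sum_const, nsmul_eq_mul, Finset.card_univ, Fintype.card_fun, Fintype.card_fin,
    Fintype.card_fin, Nat.cast_pow, Nat.cast_ofNat, inv_mul_cancel_left₀ (by positivity)]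

theorem integral_posPart_sub {X : Type*} [MeasurableSpace X] {μ : Measure X} {g : X → ℝ}
    (hg : Integrable g μ) : ∫ x, (g x)⁺ ∂μ - ∫ x, (-g x)⁺ ∂μ = ∫ x, g x ∂μ := by
  rw [← integral_sub (f := fun x => (g x)⁺) (g := fun x => (-g x)⁺) hg.pos_part hg.neg.pos_part]
  refine integral_congr_ae (Eventually.of_forall fun x => ?_)
  simp only [posPart_neg, posPart_sub_negPart]

theorem integral_eq_posPart {X : Type*} [MeasurableSpace X] {μ : Measure X} {f : X → ℂ}
    (hf : Integrable f μ) :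
    ∫ x, f x ∂μ = (∫ x, (f x).re⁺ ∂μ : ℝ) - (∫ x, (-(f x).re)⁺ ∂μ : ℝ) +
      Complex.I * ((∫ x, (f x).im⁺ ∂μ : ℝ) - (∫ x, (-(f x).im)⁺ ∂μ : ℝ)) := by
  have h1 := integral_posPart_sub hf.re
  have h2 := integral_posPart_sub hf.im
  simp only [RCLike.re_eq_complex_re, RCLike.im_eq_complex_im] at h1 h2
  rw [← Complex.ofReal_sub, ← Complex.ofReal_sub, h1, h2, mul_comm]
  exact (integral_re_add_im hf).symm

theorem dixmierTrace_gasket (hK : IsGasket α K) (w : ExtendedLimit) (f : C(K, ℂ)) :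
    dixmierTrace w (gasketRep hK f * absNegPow (gasketDirac α) (gasketDim α)) =
      traceConst α (gasketDim α) * ∫ x, f x ∂hausdorffProb K (gasketDim α) := by
  have hprob := hK.isProbabilityMeasure
  have hint : Integrable f (hausdorffProb K (gasketDim α)) :=
    f.continuous.integrable_of_hasCompactSupport (HasCompactSupport.of_compactSpace f)
  have hq := edgeWeight_pos α (gasketDim α)
  have hs := summable_edgeWeight α (one_lt_gasketDim α)
  have hpos : 0 < ∑' j, edgeWeight α (gasketDim α) j :=
    hs.tsum_pos (fun j => (hq j).le) ((false, 0), 0) (hq _)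
  have key := dixmierTrace_mul_diagonal (sortedBasis α) (absNegPow_sortedBasis α)
    (fun x => mul_nonneg (by positivity) (hq _).le) (fun t ht => finite_lt_wordFamily hq hs ht)
    (C₀ := 3 / 2 * ∑' j, edgeWeight α (gasketDim α) j) (by positivity)
    (fun t ht => ncard_lt_wordFamily_le hq hs ht) (gasketRep hK f) (norm_nonneg f)
    (z := fun x => f (startPoint hK (indexEquiv x).1)) (fun x => f.norm_coe_le_norm _)
    (m := fun x => edgeOsc hK f (indexEquiv x).1)
    (fun x => by
      rw [sortedBasis_apply]
      exact norm_gasketRep_basis_sub_le hK f (indexEquiv x))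
    (fun u _ => tendsto_truncSum_posPart hK f u) (tendsto_truncSum_edgeOsc hK f) w
  rw [key, traceConst_eq, integral_eq_posPart hint]
  simp only [one_mul, neg_mul, Complex.neg_re, Complex.I_mul_re, neg_neg]
  push_cast
  ring

end Sorted

end StretchedGasket

end

theorem mainTheorem1 (α : Set.Ioo (0 : ℝ) (1 / 3)) (K : TopologicalSpace.NonemptyCompacts Plane)
    (hK : IsGasket α K) (d : ℝ) (hd : d = spectralDimension (gasketDirac α)) :
    IsProbabilityMeasure (hausdorffProb K d) ∧
    ∀ (w : ExtendedLimit) (f : C(K, ℂ)),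
      InDixmierIdeal (gasketRep hK f * absNegPow (gasketDirac α) d) ∧
      dixmierTrace w (gasketRep hK f * absNegPow (gasketDirac α) d) =
        traceConst α d * ∫ x, f x ∂(hausdorffProb K d) := by
  rw [spectralDimension_gasketDirac] at hd
  subst hd
  exact ⟨hK.isProbabilityMeasure, fun w f => ⟨inDixmierIdeal_gasket hK f,
    dixmierTrace_gasket hK w f⟩⟩
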